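/- Let $E=\{1,\dots,N\}$ and let $(\xi,J)$ be a Markov additive process in $\mathbb{R}\times E$: a càdlàg process, adapted to a filtration $(\mathscr{G}_t)_{t\ge0}$, such that $J$ is a continuous-time Markov chain on $E$ with transition rate matrix $Q=(q_{ij})$ and, for all $i\in E$ and $s,t\ge 0$, given $\{J(t)=i\}$ the pair $(\xi(t+s)-\xi(t),J(t+s))$ is independent of $\mathscr{G}_t$ and has the same distribution as $(\xi(s)-\xi(0),J(s))$ given $\{J(0)=i\}$. Assume that $J$ is irreducible. Write $\mathbb{P}_i$, $\mathbb{E}_i$ for the law and expectation of the process started from $\xi(0)=0$, $J(0)=i$. While $J$ stays in state $i$, $\xi$ evolves as a Lévy process $\xi_i$, independent of $J$; let $\psi_i(z)=\log\mathbb{E}[e^{z\xi_i(1)}]$ be its Laplace exponent. (Thus $\xi_i(1)$ is distributed as $\xi(1)$ under $\mathbb{P}_i$ conditioned on $J$ having no jump in $[0,1]$.) When $J$ jumps from $i$ to $j\neq i$, $\xi$ receives an additional independent jump distributed as a random variable $U_{ij}$ (thus $U_{ij}$ is distributed as $\xi(T_1)-\xi(T_1-)$ under $\mathbb{P}_i$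 conditioned on $J(T_1)=j$, where $T_1$ is the first jump time of $J$); put $U_{ij}=0$ if $q_{ij}=0$ or $i=j$. Let $G_{ij}(z)=\mathbb{E}[e^{zU_{ij}}]$. The matrix exponent is $$F(z)=\operatorname{diag}(\psi_1(z),\dots,\psi_N(z))+\bigl(q_{ij}G_{ij}(z)\bigr)_{i,j\in E},$$ for those real $z$ for which all these expectations are finite, and $\kappa(z)$ denotes the leading (Perron–Frobenius) eigenvalue of $F(z)$, i.e. its eigenvalue of largest real part. Assume that $\xi$ satisfies the Cramér condition with Cramér number $\theta\in(0,1)$: there is $z_0<0$ such that $F$ exists on $(z_0,0)$, $\theta\in(0,-z_0)$ and $\kappa(-\theta)=0$. Assume also that $\xi$ is non-degenerate, in the sense that there is no function $g:E\to\mathbb{R}$ such that for all $i\in E$ and $t\ge0$ one has $\xi(t)=g(J(t))-g(J(0))$ $\mathbb{P}_i$-almost surely. Let $I(-\xi)=\int_0^\infty e^{-\xi(t)}\,dt\in[0,\infty]$. Then $I(-\xi)<\infty$ $\mathbb{P}_i$-almost surely for every $i\in E$, and the vector Mellin transform $$\mathcal{M}_i(s)=\mathbb{E}_i\bigl[I(-\xi)^{s-1}\bigr],\qquad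 i\in E,$$ is finite (the expectation converges absolutely) and analytic for $s\in\mathbb{C}$ with $\operatorname{Re}s\in(0,1+\theta)$. Moreover, for every real $s\in(0,\theta)$ the matrix $F(-s)$ is invertible and $$\mathcal{M}(s+1)=-s\,F(-s)^{-1}\mathcal{M}(s).$$ -/

import Mathlib

open MeasureTheory ProbabilityTheory Set Filter Topology
open scoped NNReal ENNReal Matrix

noncomputable section

namespace MAP

variable {Ω E : Type*}

/-- A real-valued path is càdlàg: right-continuous with left limits
(at `0` the condition on the left limit is void). -/
def IsCadlagReal (f : ℝ≥0 → ℝ) : Prop :=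
  ∀ t, Tendsto f (𝓝[≥] t) (𝓝 (f t)) ∧ ∃ l, Tendsto f (𝓝[<] t) (𝓝 l)

/-- A path in the discrete set `E` is càdlàg: at every time it is locally constant from the right,
and locally constant immediately before that time. -/
def IsCadlagDiscrete (f : ℝ≥0 → E) : Prop :=
  ∀ t, (∀ᶠ u in 𝓝[≥] t, f u = f t) ∧ ∃ j, ∀ᶠ u in 𝓝[<] t, f u = j

/-- `(ξ, J)` is a Markov additive process in `ℝ × E` with respect to the filtration `𝒢`, with laws
`P i`, where `P i` is the law started from `ξ 0 = 0`, `J 0 = i`, and `Q` is the transition rate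
matrix of the continuous-time Markov chain `J`. -/
structure IsMAP [Fintype E] [DecidableEq E] [MeasurableSpace E] {m : MeasurableSpace Ω}
    (𝒢 : Filtration ℝ≥0 m) (P : E → Measure Ω) (ξ : ℝ≥0 → Ω → ℝ) (J : ℝ≥0 → Ω → E)
    (Q : Matrix E E ℝ) : Prop where
  prob : ∀ i, IsProbabilityMeasure (P i)
  adapted_fst : ∀ t, Measurable[𝒢 t] (ξ t)
  adapted_snd : ∀ t, Measurable[𝒢 t] (J t)
  cadlag_fst : ∀ ω, IsCadlagReal (fun t => ξ t ω)
  cadlag_snd : ∀ ω, IsCadlagDiscrete (fun t => J t ω)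
  start : ∀ i, ∀ᵐ ω ∂(P i), ξ 0 ω = 0 ∧ J 0 ω = i
  /-- `J` has transition function `t ↦ exp (t Q)`. -/
  transition : ∀ (i j : E) (t : ℝ≥0),
    (P i).real {ω | J t ω = j} = NormedSpace.exp ((t : ℝ) • Q) i j
  /-- Under every starting law, given `J t = i`, the pair `(ξ (t + s) - ξ t, J (t + s))` is
  independent of `𝒢 t` and distributed as `(ξ s - ξ 0, J s)` under `P i`. -/
  markov_additive : ∀ (k i : E) (t s : ℝ≥0) (A : Set Ω) (B : Set (ℝ × E)),
    MeasurableSet[𝒢 t] A → MeasurableSet B →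
    P k ((A ∩ {ω | J t ω = i}) ∩ {ω | (ξ (t + s) ω - ξ t ω, J (t + s) ω) ∈ B}) =
      P k (A ∩ {ω | J t ω = i}) * P i {ω | (ξ s ω - ξ 0 ω, J s ω) ∈ B}

/-- A chain with transition rate matrix `Q` is irreducible: every state leads to every other state
through transitions of positive rate. -/
def IsIrreducibleRate (Q : Matrix E E ℝ) : Prop :=
  ∀ i j, Relation.ReflTransGen (fun a b => 0 < Q a b) i j

/-- The first jump time of `J` (only used on the event that `J` does jump). -/
def firstJump (J : ℝ≥0 → Ω → E) (ω : Ω) : ℝ≥0 :=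
  sInf {t | J t ω ≠ J 0 ω}

/-- The jump `ξ(T₁) - ξ(T₁-)` of `ξ` at the first jump time `T₁` of `J`. -/
def jumpAtFirst (ξ : ℝ≥0 → Ω → ℝ) (J : ℝ≥0 → Ω → E) (ω : Ω) : ℝ :=
  ξ (firstJump J ω) ω - Function.leftLim (fun t => ξ t ω) (firstJump J ω)

/-- The exponential functional `I(-ξ) = ∫_0^∞ exp(-ξ(t)) dt`, with values in `[0, ∞]`. -/
def expFunctional (ξ : ℝ≥0 → Ω → ℝ) (ω : Ω) : ℝ≥0∞ :=
  ∫⁻ t in Ioi (0 : ℝ), ENNReal.ofReal (Real.exp (-ξ t.toNNReal ω))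

variable [MeasurableSpace Ω]

/-- `P i` given that `J` has not jumped up to time `1`. While `J` stays in `i`, the process `ξ`
follows the Lévy process `ξ_i`, which is independent of `J`; hence `ξ 1` under this law is
distributed as `ξ_i(1)`. -/
def levyLaw (P : E → Measure Ω) (J : ℝ≥0 → Ω → E) (i : E) : Measure Ω :=
  (P i)[|{ω | ∀ u ≤ (1 : ℝ≥0), J u ω = i}]

/-- `P i` given that the first jump of `J` leads to `j`. Under this law `jumpAtFirst ξ J` is
distributed as the variable `U_{ij}` added to `ξ` at transitions of `J` from `i` to `j`. -/
def transitionLaw (P : E → Measure Ω) (J : ℝ≥0 → Ω → E) (i j : E) : Measure Ω :=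
  (P i)[|{ω | J (firstJump J ω) ω = j}]

/-- The Laplace exponent `ψ_i(z) = log E[exp(z ξ_i(1))]` of the Lévy process `ξ_i`, `z` real. -/
def laplaceExponent (P : E → Measure Ω) (ξ : ℝ≥0 → Ω → ℝ) (J : ℝ≥0 → Ω → E) (z : ℝ) (i : E) : ℝ :=
  cgf (ξ 1) (levyLaw P J i) z

open Classical in
/-- The matrix `G(z)` of the transforms `E[exp(z U_{ij})]`, `z` real, with the convention that
`U_{ij} = 0` if `i = j` or `q_{ij} = 0`. -/
def jumpTransform (P : E → Measure Ω) (ξ : ℝ≥0 → Ω → ℝ) (J : ℝ≥0 → Ω → E) (Q : Matrix E E ℝ)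
    (z : ℝ) : Matrix E E ℝ :=
  Matrix.of fun i j =>
    if i = j ∨ Q i j = 0 then 1 else mgf (jumpAtFirst ξ J) (transitionLaw P J i j) z

/-- The matrix exponent `F(z) = diag(ψ_1(z), …, ψ_N(z)) + Q ∘ G(z)`, for real `z`. -/
def matrixExponent [DecidableEq E] (P : E → Measure Ω) (ξ : ℝ≥0 → Ω → ℝ) (J : ℝ≥0 → Ω → E)
    (Q : Matrix E E ℝ) (z : ℝ) : Matrix E E ℝ :=
  Matrix.diagonal (laplaceExponent P ξ J z) + Matrix.hadamard Q (jumpTransform P ξ J Q z)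

/-- `F(z)` exists: all the expectations in its definition are finite. -/
def MatrixExponentExists (P : E → Measure Ω) (ξ : ℝ≥0 → Ω → ℝ) (J : ℝ≥0 → Ω → E)
    (Q : Matrix E E ℝ) (z : ℝ) : Prop :=
  (∀ i, Integrable (fun ω => Real.exp (z * ξ 1 ω)) (levyLaw P J i)) ∧
  (∀ i j, i ≠ j → Q i j ≠ 0 →
    Integrable (fun ω => Real.exp (z * jumpAtFirst ξ J ω)) (transitionLaw P J i j))

/-- The leading (Perron-Frobenius) eigenvalue of a real matrix with nonnegative off-diagonal
entries: the largest real part of its complex eigenvalues. -/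
def leadingEigenvalue [Fintype E] [DecidableEq E] (A : Matrix E E ℝ) : ℝ :=
  sSup (Complex.re '' spectrum ℂ (A.map (fun x : ℝ => (x : ℂ))))

/-- The Cramér condition with Cramér number `θ`: `F` exists on some `(z₀, 0)` with `z₀ < 0`,
`θ ∈ (0, -z₀)`, and `κ(-θ) = 0`, where `κ(z)` is the leading eigenvalue of `F(z)`. -/
def CramerCondition [Fintype E] [DecidableEq E] (P : E → Measure Ω) (ξ : ℝ≥0 → Ω → ℝ)
    (J : ℝ≥0 → Ω → E) (Q : Matrix E E ℝ) (θ : ℝ) : Prop :=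
  ∃ z₀ < 0, (∀ s ∈ Ioo z₀ 0, MatrixExponentExists P ξ J Q s) ∧ θ ∈ Ioo 0 (-z₀) ∧
    leadingEigenvalue (matrixExponent P ξ J Q (-θ)) = 0

/-- The degenerate case: `ξ` is merely a function of the chain, `ξ(t) = g(J(t)) - g(J(0))`. -/
def IsDegenerate (P : E → Measure Ω) (ξ : ℝ≥0 → Ω → ℝ) (J : ℝ≥0 → Ω → E) : Prop :=
  ∃ g : E → ℝ, ∀ i t, ∀ᵐ ω ∂(P i), ξ t ω = g (J t ω) - g i

/-- The vector-valued Mellin transform `M_i(s) = E_i[I(-ξ)^(s-1)]`. -/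
def mellin (P : E → Measure Ω) (ξ : ℝ≥0 → Ω → ℝ) (s : ℂ) (i : E) : ℂ :=
  ∫ ω, ((expFunctional ξ ω).toReal : ℂ) ^ (s - 1) ∂(P i)

end MAP

end

/-! The proof rests on the moment matrix with entries E_i[exp(zξ_t); J_t = j]. By the Markov
property it is a semigroup in t, and the first task is to show that it equals exp(tF(z)), although F
is only given through conditional laws (`funMoment_eq_exp_matrixExponent`). Time is cut into n
cells. On a cell where J stays put, the moment is exactly exponential in the length. On a cell where
J changes state, the derivative at zero is found by waiting for the first cell at whose end J has
left i, which in the limit shows the jump at the first transition (`tendsto_funMoment_ne`). Products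
of the cell matrices converge to a matrix exponential; Fatou's lemma bounds the moment from above
and entrywise comparison bounds it from below.

Since κ(-θ) = 0, Perron-Frobenius gives a positive vector h fixed by exp(tF(-θ)), so
exp(-θξ_t)h(J_t) is a martingale. For p < θ Jensen's inequality makes h^(p/θ) superharmonic for
exp(tF(-p)). Equality everywhere would make ξ a function of the chain, so non-degeneracy gives a
strict inequality for some state and time. Irreducibility spreads it to all states, and exp(nT
F(-p)) decays geometrically (`exists_decay`). In particular F(-p) has no null vector
(`isUnit_of_decay`).

The same martingale and Doob's maximal inequality bound the moments of order p < θ of the supremum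
of exp(-ξ) over a bounded interval. Cutting I(-ξ) into blocks of length T, using subadditivity of
x^p for p ≤ 1 and the Markov property, one gets a convergent geometric series for E_i[I^p]
(`lintegral_expFunctional_rpow_lt_top`).

For the recurrence, let R_u be the tail of the integral from time u. The fundamental theorem of
calculus writes I^p as R_t^p plus p times the integral of exp(-ξ_u) R_u^(p-1) over (0,t]. Since R_u
is exp(-ξ_u) times an independent copy of I given J_u, expectations give M_p = exp(tF(-p)) M_p + p
∫_0^t exp(uF(-p)) M_{p-1} du with M_q = E[I^q]. This forces M_{p-1} to be finite, and its derivative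
at t = 0 is F(-p) M_p = -p M_{p-1} (`matrixExponent_mulVec_moment`). Finiteness of the moments of
orders in (-1, θ) makes the Mellin transform analytic, as a complex moment generating function of
log I. -/

noncomputable section

namespace MAP

/-! ### Powers converging to exponentials in Banach algebras. -/

section BanachAlgebra

variable {𝔸 : Type*} [NormedRing 𝔸]

theorem norm_pow_sub_pow_le [NormOneClass 𝔸] {x y : 𝔸} {M : ℝ} (hM : 1 ≤ M)
    (hx : ‖x‖ ≤ M) (hy : ‖y‖ ≤ M) (n : ℕ) :
    ‖x ^ n - y ^ n‖ ≤ n * M ^ n * ‖x - y‖ := by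
  induction n with
  | zero => simp
  | succ n ih =>
    have h0 : 0 ≤ M := zero_le_one.trans hM
    have e : x ^ (n + 1) - y ^ (n + 1) = x ^ n * (x - y) + (x ^ n - y ^ n) * y := by
      rw [pow_succ, pow_succ]; noncomm_ring
    have h1 : ‖x ^ n * (x - y)‖ ≤ M ^ (n + 1) * ‖x - y‖ := by
      refine (norm_mul_le _ _).trans (mul_le_mul_of_nonneg_right ?_ (norm_nonneg _))
      calc ‖x ^ n‖ ≤ ‖x‖ ^ n := norm_pow_le _ _
        _ ≤ M ^ n := pow_le_pow_left₀ (norm_nonneg _) hx n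
        _ ≤ M ^ (n + 1) := pow_le_pow_right₀ hM n.le_succ
    have h2 : ‖(x ^ n - y ^ n) * y‖ ≤ n * M ^ (n + 1) * ‖x - y‖ := by
      refine (norm_mul_le _ _).trans ?_
      calc _ ≤ (n * M ^ n * ‖x - y‖) * M := mul_le_mul ih hy (norm_nonneg _) (by positivity)
        _ = _ := by ring
    rw [e]
    refine (norm_add_le _ _).trans ((add_le_add h1 h2).trans (le_of_eq ?_))
    push_cast; ring

variable [NormedAlgebra ℝ 𝔸] [CompleteSpace 𝔸]

theorem tendsto_smul_exp_sub_one (X : 𝔸) :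
    Tendsto (fun h : ℝ => h⁻¹ • (NormedSpace.exp (h • X) - 1)) (𝓝[≠] 0) (𝓝 X) := by
  have h := (hasDerivAt_exp_smul_const (𝕂 := ℝ) X (0 : ℝ)).tendsto_slope_zero
  simpa using h

/-- Comparison with `Y m`, the exponential of X/m, whose m-th power is exactly the limit. Both bases
have norm at most 1 + O(1/m), so their m-th powers stay bounded, and the m-th powers differ by at
most a constant times m‖C m - Y m‖, which tends to 0. -/
theorem tendsto_pow_exp [NormOneClass 𝔸] {C : ℕ → 𝔸} {X : 𝔸}
    (h : Tendsto (fun m : ℕ => (m : ℝ) • (C m - 1)) atTop (𝓝 X)) :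
    Tendsto (fun m => C m ^ m) atTop (𝓝 (NormedSpace.exp X)) := by
  set Y : ℕ → 𝔸 := fun m => NormedSpace.exp ((m : ℝ)⁻¹ • X) with hY
  have hinv : Tendsto (fun m : ℕ => (m : ℝ)⁻¹) atTop (𝓝[≠] 0) := by
    refine tendsto_nhdsWithin_iff.2 ⟨tendsto_inv_atTop_nhds_zero_nat, ?_⟩
    filter_upwards [eventually_gt_atTop 0] with m hm
    have : (m : ℝ) ≠ 0 := by positivity
    simpa using this
  have hYt : Tendsto (fun m : ℕ => (m : ℝ) • (Y m - 1)) atTop (𝓝 X) := by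
    simpa [Function.comp_def] using (tendsto_smul_exp_sub_one X).comp hinv
  have hYp : ∀ᶠ m in atTop, Y m ^ m = NormedSpace.exp X := by
    filter_upwards [eventually_gt_atTop 0] with m hm
    let := NormedAlgebra.restrictScalars ℚ ℝ 𝔸
    rw [hY, ← NormedSpace.exp_nsmul, ← Nat.cast_smul_eq_nsmul ℝ, smul_smul,
      mul_inv_cancel₀ (by positivity), one_smul]
  have bound : ∀ {Z : ℕ → 𝔸}, Tendsto (fun m : ℕ => (m : ℝ) • (Z m - 1)) atTop (𝓝 X) →
      ∀ᶠ m : ℕ in atTop, ‖Z m‖ ≤ 1 + (‖X‖ + 1) / m := by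
    intro Z hZ
    filter_upwards [hZ.norm.eventually_le_const (lt_add_one ‖X‖),
      eventually_gt_atTop 0] with m h1 h2
    have hm : (0 : ℝ) < m := by exact_mod_cast h2
    rw [norm_smul, Real.norm_natCast] at h1
    have : ‖Z m‖ ≤ ‖(1 : 𝔸)‖ + ‖Z m - 1‖ := by
      simpa using norm_add_le (1 : 𝔸) (Z m - 1)
    rw [norm_one] at this
    have h3 : ‖Z m - 1‖ ≤ (‖X‖ + 1) / m := by rw [le_div_iff₀ hm]; linarith
    linarith
  have key : ∀ᶠ m : ℕ in atTop, ‖C m ^ m - NormedSpace.exp X‖ ≤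
      Real.exp (‖X‖ + 1) * ‖(m : ℝ) • (C m - 1) - (m : ℝ) • (Y m - 1)‖ := by
    filter_upwards [hYp, bound h, bound hYt, eventually_gt_atTop 0] with m h1 h2 h3 h4
    have hm : (0 : ℝ) < m := by exact_mod_cast h4
    rw [← h1]
    refine (norm_pow_sub_pow_le (le_add_of_nonneg_right (by positivity)) h2 h3 m).trans ?_
    rw [← smul_sub, norm_smul, Real.norm_natCast, sub_sub_sub_cancel_right]
    have : (1 + (‖X‖ + 1) / m) ^ m ≤ Real.exp (‖X‖ + 1) := by
      calc _ ≤ (Real.exp ((‖X‖ + 1) / m)) ^ m := by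
            refine pow_le_pow_left₀ (by positivity) ?_ m
            rw [add_comm]; exact Real.add_one_le_exp _
        _ = _ := by rw [← Real.exp_nat_mul]; congr 1; field_simp
    calc _ = (1 + (‖X‖ + 1) / m) ^ m * (m * ‖C m - Y m‖) := by ring
      _ ≤ _ := mul_le_mul_of_nonneg_right this (by positivity)
  rw [tendsto_iff_norm_sub_tendsto_zero]
  refine squeeze_zero' (Eventually.of_forall fun _ => norm_nonneg _) key ?_
  simpa using ((h.sub hYt).norm.const_mul (Real.exp (‖X‖ + 1)))

end BanachAlgebra

/-! ### Matrix exponentials and Perron-Frobenius theory. -/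

section Matrix

variable {E : Type*} [Fintype E] [DecidableEq E]

open scoped Matrix.Norms.Operator

theorem tendsto_matrix_pow_exp [Nonempty E] {C : ℕ → Matrix E E ℝ} {X : Matrix E E ℝ}
    (h : ∀ i j, Tendsto (fun m : ℕ => (m : ℝ) * (C m i j - (1 : Matrix E E ℝ) i j)) atTop
      (𝓝 (X i j))) (i j : E) :
    Tendsto (fun m => (C m ^ m) i j) atTop (𝓝 (NormedSpace.exp X i j)) := by
  have h1 : Tendsto (fun m : ℕ => (m : ℝ) • (C m - 1)) atTop (𝓝 X) :=
    tendsto_pi_nhds.2 fun i => tendsto_pi_nhds.2 fun j => h i j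
  exact tendsto_pi_nhds.1 (tendsto_pi_nhds.1 (tendsto_pow_exp h1) i) j

theorem tendsto_matrix_exp_sub_one (X : Matrix E E ℝ) (i j : E) :
    Tendsto (fun h : ℝ => h⁻¹ * (NormedSpace.exp (h • X) i j - (1 : Matrix E E ℝ) i j)) (𝓝[≠] 0)
      (𝓝 (X i j)) :=
  tendsto_pi_nhds.1 (tendsto_pi_nhds.1 (tendsto_smul_exp_sub_one X) i) j

/-- A generator is the right derivative of its semigroup at 0. This later identifies the holding
rates of the chain with the diagonal of Q. -/
theorem matrix_exp_injective {X Y : Matrix E E ℝ}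
    (h : ∀ t : ℝ≥0, NormedSpace.exp ((t : ℝ) • X) = NormedSpace.exp ((t : ℝ) • Y)) : X = Y := by
  have hle : 𝓝[>] (0 : ℝ) ≤ 𝓝[≠] 0 := nhdsWithin_mono _ fun x hx => ne_of_gt hx
  refine tendsto_nhds_unique ((tendsto_smul_exp_sub_one X).mono_left hle)
    (((tendsto_smul_exp_sub_one Y).mono_left hle).congr' ?_)
  filter_upwards [self_mem_nhdsWithin] with t ht
  have : NormedSpace.exp (t • X) = NormedSpace.exp (t • Y) := h ⟨t, le_of_lt ht⟩
  exact congrArg (fun Z => t⁻¹ • (Z - 1)) this.symm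

theorem continuous_matrix_exp : Continuous (NormedSpace.exp : Matrix E E ℝ → Matrix E E ℝ) :=
  NormedSpace.exp_continuous

theorem continuous_matrix_exp_smul (X : Matrix E E ℝ) (i j : E) :
    Continuous fun t : ℝ => NormedSpace.exp (t • X) i j := by
  have : Continuous fun t : ℝ => NormedSpace.exp (t • X) :=
    continuous_matrix_exp.comp (continuous_id.smul continuous_const)
  exact (continuous_apply j).comp ((continuous_apply i).comp this)

theorem hasSum_matrix_exp (X : Matrix E E ℝ) (i j : E) :
    HasSum (fun n : ℕ => (n.factorial : ℝ)⁻¹ * (X ^ n) i j) (NormedSpace.exp X i j) := by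
  have h := NormedSpace.exp_series_hasSum_exp' (𝕂 := ℝ) X
  exact Pi.hasSum.1 (Pi.hasSum.1 h i) j

theorem matrix_exp_mulVec_eq_self {X : Matrix E E ℝ} {v : E → ℝ} (h : X *ᵥ v = 0) :
    NormedSpace.exp X *ᵥ v = v := by
  have hp : ∀ n : ℕ, n ≠ 0 → X ^ n *ᵥ v = 0 := by
    intro n hn
    obtain ⟨k, rfl⟩ := Nat.exists_eq_succ_of_ne_zero hn
    rw [pow_succ, ← Matrix.mulVec_mulVec, h, Matrix.mulVec_zero]
  funext i
  have h1 : HasSum (fun n : ℕ => ∑ j, (n.factorial : ℝ)⁻¹ * (X ^ n) i j * v j)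
      (∑ j, NormedSpace.exp X i j * v j) :=
    hasSum_sum fun j _ => (hasSum_matrix_exp X i j).mul_right (v j)
  have h2 : ∀ n : ℕ, ∑ j, (n.factorial : ℝ)⁻¹ * (X ^ n) i j * v j
      = (n.factorial : ℝ)⁻¹ * (X ^ n *ᵥ v) i := by
    intro n
    simp [Matrix.mulVec, dotProduct, Finset.mul_sum, mul_assoc]
  simp_rw [h2] at h1
  have h3 := hasSum_single (f := fun n : ℕ => (n.factorial : ℝ)⁻¹ * (X ^ n *ᵥ v) i) 0
    (by intro n hn; simp [hp n hn])
  have := h1.unique h3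
  rw [pow_zero, Matrix.one_mulVec] at this
  simpa [Matrix.mulVec, dotProduct] using this

theorem matrix_pow_nonneg {X : Matrix E E ℝ} (h : ∀ i j, 0 ≤ X i j) (n : ℕ) (i j : E) :
    0 ≤ (X ^ n) i j := by
  induction n generalizing i j with
  | zero => simp only [pow_zero, Matrix.one_apply]; split_ifs <;> norm_num
  | succ n ih =>
    rw [pow_succ, Matrix.mul_apply]
    exact Finset.sum_nonneg fun k _ => mul_nonneg (ih i k) (h k j)

/-- A chain of n positive entries from i to j makes the (i, j) entry of X^n positive, and one
positive term suffices in a series of nonnegative ones. -/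
theorem matrix_exp_nonneg_entries {X : Matrix E E ℝ} (h : ∀ i j, 0 ≤ X i j)
    (hirr : ∀ i j, Relation.ReflTransGen (fun a b => 0 < X a b) i j) (i j : E) :
    0 < NormedSpace.exp X i j := by
  have hex : ∃ n : ℕ, 0 < (X ^ n) i j := by
    induction hirr i j with
    | refl => exact ⟨0, by simp⟩
    | @tail b c _ hbc ih =>
      obtain ⟨n, hn⟩ := ih
      refine ⟨n + 1, ?_⟩
      rw [pow_succ, Matrix.mul_apply]
      exact Finset.sum_pos' (fun k _ => mul_nonneg (matrix_pow_nonneg h n i k) (h k c))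
        ⟨b, Finset.mem_univ _, mul_pos hn hbc⟩
  obtain ⟨n, hn⟩ := hex
  have hs := hasSum_matrix_exp X i j
  have h0 : ∀ n : ℕ, 0 ≤ (n.factorial : ℝ)⁻¹ * (X ^ n) i j := fun n =>
    mul_nonneg (by positivity) (matrix_pow_nonneg h n i j)
  rw [← hs.tsum_eq]
  exact hs.summable.tsum_pos h0 n (mul_pos (by positivity) hn)

theorem matrix_exp_add_smul_one (X : Matrix E E ℝ) (c : ℝ) :
    NormedSpace.exp (X + c • (1 : Matrix E E ℝ)) = Real.exp c • NormedSpace.exp X := by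
  have hcomm : Commute X (c • (1 : Matrix E E ℝ)) := (Commute.one_right X).smul_right _
  have he : NormedSpace.exp (c • (1 : Matrix E E ℝ)) = Real.exp c • 1 := by
    rw [Matrix.smul_one_eq_diagonal, Matrix.smul_one_eq_diagonal, Matrix.exp_diagonal]
    congr 1
    funext k
    rw [Pi.coe_exp, Real.exp_eq_exp_ℝ]
  rw [Matrix.exp_add_of_commute _ _ hcomm, he, mul_smul_comm, mul_one]

/-- Adding a multiple of the identity only rescales the exponential, so results for nonnegative
matrices extend to matrices that are nonnegative off the diagonal. -/
theorem exists_shift_nonneg {X : Matrix E E ℝ} (h : ∀ i j, i ≠ j → 0 ≤ X i j) :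
    ∃ c : ℝ, (∀ i j, 0 ≤ (X + c • (1 : Matrix E E ℝ)) i j) ∧
      ∀ i j, 0 < X i j → 0 < (X + c • (1 : Matrix E E ℝ)) i j := by
  set c : ℝ := 1 + ∑ k, |X k k| with hc
  have hck : ∀ k, 0 < X k k + c := by
    intro k
    have h1 := Finset.single_le_sum (f := fun k => |X k k|) (fun k _ => abs_nonneg _)
      (Finset.mem_univ k)
    have h2 := neg_abs_le (X k k)
    change |X k k| ≤ _ at h1; linarith
  refine ⟨c, fun a b => ?_, fun a b hab => ?_⟩
  · by_cases hab : a = b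
    · subst hab; simpa using (hck a).le
    · simpa [Matrix.one_apply_ne hab] using h a b hab
  · by_cases e : a = b
    · subst e; simpa using (hck a)
    · simpa [Matrix.one_apply_ne e] using hab

theorem matrix_exp_nonneg {X : Matrix E E ℝ} (h : ∀ i j, i ≠ j → 0 ≤ X i j) (i j : E) :
    0 ≤ NormedSpace.exp X i j := by
  obtain ⟨c, hB0, -⟩ := exists_shift_nonneg h
  have h1 : 0 ≤ NormedSpace.exp (X + c • (1 : Matrix E E ℝ)) i j :=
    (hasSum_matrix_exp _ i j).nonneg fun n =>
      mul_nonneg (by positivity) (matrix_pow_nonneg hB0 n i j)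
  rw [matrix_exp_add_smul_one, Matrix.smul_apply, smul_eq_mul] at h1
  exact nonneg_of_mul_nonneg_right h1 (Real.exp_pos c)

/-- The exponential of an irreducible matrix with nonnegative off-diagonal entries is positive. -/
theorem matrix_exp_pos {X : Matrix E E ℝ} (h : ∀ i j, i ≠ j → 0 ≤ X i j)
    (hirr : IsIrreducibleRate X) (i j : E) : 0 < NormedSpace.exp X i j := by
  obtain ⟨c, hB0, hB⟩ := exists_shift_nonneg h
  have h1 := matrix_exp_nonneg_entries hB0
    (fun a b => Relation.ReflTransGen.mono hB _ _ (hirr a b)) i j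
  rw [matrix_exp_add_smul_one, Matrix.smul_apply, smul_eq_mul] at h1
  exact pos_of_mul_pos_right h1 (Real.exp_pos c).le

/-- The Collatz-Wielandt maximum. Normalizing the vectors to the simplex and bounding the value by
the sum `R` of all entries gives a compact set of pairs, on which the first coordinate attains its
maximum. -/
theorem exists_maximal_subeigenvalue [Nonempty E] {P : Matrix E E ℝ} (hP : ∀ i j, 0 ≤ P i j) :
    ∃ r : ℝ, ∃ x : E → ℝ, 0 ≤ r ∧ (∀ i, 0 ≤ x i) ∧ x ≠ 0 ∧ (∀ i, r * x i ≤ (P *ᵥ x) i) ∧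
      ∀ (ρ : ℝ) (y : E → ℝ), (∀ i, 0 ≤ y i) → y ≠ 0 → (∀ i, ρ * y i ≤ (P *ᵥ y) i) → ρ ≤ r := by
  set R : ℝ := ∑ i, ∑ j, P i j with hR
  set S : Set (ℝ × (E → ℝ)) := {q | q.1 ∈ Icc 0 R ∧ q.2 ∈ stdSimplex ℝ E ∧
    ∀ i, q.1 * q.2 i ≤ (P *ᵥ q.2) i} with hS
  have hR0 : 0 ≤ R := Finset.sum_nonneg fun i _ => Finset.sum_nonneg fun j _ => hP i j
  have hcont : Continuous fun q : ℝ × (E → ℝ) => P *ᵥ q.2 :=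
    continuous_const.matrix_mulVec continuous_snd
  have hScl : IsCompact S := by
    refine ((isCompact_Icc (a := (0 : ℝ)) (b := R)).prod
      (isCompact_stdSimplex ℝ E)).of_isClosed_subset ?_ fun q hq => ⟨hq.1, hq.2.1⟩
    refine (isClosed_Icc.preimage continuous_fst).inter
      (((isClosed_stdSimplex ℝ E).preimage continuous_snd).inter ?_)
    have : {q : ℝ × (E → ℝ) | ∀ i, q.1 * q.2 i ≤ (P *ᵥ q.2) i} =
        ⋂ i, {q | q.1 * q.2 i ≤ (P *ᵥ q.2) i} := by ext; simp
    change IsClosed {q : ℝ × (E → ℝ) | ∀ i, q.1 * q.2 i ≤ (P *ᵥ q.2) i}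
    rw [this]
    refine isClosed_iInter fun i => isClosed_le ?_ ((continuous_apply i).comp hcont)
    exact continuous_fst.mul ((continuous_apply i).comp continuous_snd)
  have hmv : ∀ y : E → ℝ, (∀ i, 0 ≤ y i) → ∀ i, 0 ≤ (P *ᵥ y) i := fun y hy i =>
    Finset.sum_nonneg fun j _ => mul_nonneg (hP i j) (hy j)
  have hne : S.Nonempty := by
    obtain ⟨i₀⟩ := ‹Nonempty E›
    refine ⟨(0, Pi.single i₀ 1), ⟨le_refl _, hR0⟩, single_mem_stdSimplex ℝ i₀, fun i => ?_⟩
    rw [zero_mul]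
    exact hmv _ (single_mem_stdSimplex ℝ i₀).1 i
  obtain ⟨⟨r, x⟩, ⟨hr, hx, hrx⟩, hmax⟩ := hScl.exists_isMaxOn hne continuous_fst.continuousOn
  refine ⟨r, x, hr.1, hx.1, ?_, hrx, fun ρ y hy hy0 hρ => ?_⟩
  · rintro rfl
    have := hx.2
    simp at this
  · rcases le_or_gt ρ 0 with h0 | h0
    · exact h0.trans hr.1
    have hpos : 0 < ∑ i, y i := by
      obtain ⟨i, hi⟩ := Function.ne_iff.1 hy0
      exact Finset.sum_pos' (fun i _ => hy i)
        ⟨i, Finset.mem_univ _, lt_of_le_of_ne (hy i) (Ne.symm hi)⟩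
    set c := (∑ i, y i)⁻¹ with hc
    have hc0 : 0 < c := inv_pos.2 hpos
    have hsum : ∑ i, (c • y) i = 1 := by
      simp only [Pi.smul_apply, smul_eq_mul, ← Finset.mul_sum, hc]
      exact inv_mul_cancel₀ hpos.ne'
    have hz : ∀ i, 0 ≤ (c • y) i := fun i => mul_nonneg hc0.le (hy i)
    have hsub : ∀ i, ρ * (c • y) i ≤ (P *ᵥ (c • y)) i := by
      intro i
      rw [Matrix.mulVec_smul, Pi.smul_apply, Pi.smul_apply, smul_eq_mul, smul_eq_mul,
        mul_left_comm]
      exact mul_le_mul_of_nonneg_left (hρ i) hc0.le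
    have hle1 : ∀ j, (c • y) j ≤ 1 := fun j => by
      rw [← hsum]
      exact Finset.single_le_sum (f := fun k => (c • y) k) (fun k _ => hz k) (Finset.mem_univ j)
    have hρR : ρ ≤ R := by
      calc ρ = ∑ i, ρ * (c • y) i := by rw [← Finset.mul_sum, hsum, mul_one]
        _ ≤ ∑ i, (P *ᵥ (c • y)) i := Finset.sum_le_sum fun i _ => hsub i
        _ ≤ R := Finset.sum_le_sum fun i _ => Finset.sum_le_sum fun j _ =>
          mul_le_of_le_one_right (hP i j) (hle1 j)
    exact hmax (a := (ρ, c • y)) ⟨⟨h0.le, hρR⟩, ⟨hz, hsum⟩, hsub⟩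

/-- Perron-Frobenius: the leading eigenvalue of an irreducible matrix with nonnegative off-diagonal
entries has a positive eigenvector. -/
theorem exists_pos_eigenvector [Nonempty E] {X : Matrix E E ℝ} (h : ∀ i j, i ≠ j → 0 ≤ X i j)
    (hirr : IsIrreducibleRate X) :
    ∃ x : E → ℝ, (∀ i, 0 < x i) ∧ X *ᵥ x = leadingEigenvalue X • x := by
  obtain ⟨c, hB0, -⟩ := exists_shift_nonneg h
  set B : Matrix E E ℝ := X + c • 1 with hB
  have hBv : ∀ v : E → ℝ, B *ᵥ v = X *ᵥ v + c • v := by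
    intro v; rw [hB, Matrix.add_mulVec, Matrix.smul_mulVec, Matrix.one_mulVec]
  obtain ⟨r, x, hr0, hx0, hxne, hrx, hmax⟩ := exists_maximal_subeigenvalue hB0
  set P := NormedSpace.exp X with hPdef
  have hP : ∀ i j, 0 < P i j := matrix_exp_pos h hirr
  have hPB : ∀ v, B *ᵥ (P *ᵥ v) = P *ᵥ (B *ᵥ v) := by
    have hc : Commute X P := by
      let := NormedAlgebra.restrictScalars ℚ ℝ (Matrix E E ℝ)
      exact (Commute.refl X).exp_right
    intro v
    rw [hBv, hBv, Matrix.mulVec_add, Matrix.mulVec_smul, Matrix.mulVec_mulVec, Matrix.mulVec_mulVec,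
      hc.eq]
  have hPpos : ∀ v : E → ℝ, (∀ i, 0 ≤ v i) → v ≠ 0 → ∀ i, 0 < (P *ᵥ v) i := by
    intro v hv hne i
    obtain ⟨j, hj⟩ := Function.ne_iff.1 hne
    exact Finset.sum_pos' (fun k _ => mul_nonneg (hP i k).le (hv k))
      ⟨j, Finset.mem_univ _, mul_pos (hP i j) (lt_of_le_of_ne (hv j) (Ne.symm hj))⟩
  -- If B x ≥ r x were not an equality, applying the positive matrix P, which commutes with B, would
  -- make it strict in every coordinate, and P x would allow a value larger than r.
  have hBx : B *ᵥ x = r • x := by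
    by_contra hcon
    have hd : ∀ i, 0 < (P *ᵥ (B *ᵥ x - r • x)) i :=
      hPpos _ (fun i => by simpa using hrx i) (sub_ne_zero.2 hcon)
    have hy := hPpos x hx0 hxne
    obtain ⟨ε, hε, hle⟩ : ∃ ε > 0, ∀ i, ε * (P *ᵥ x) i ≤ (P *ᵥ (B *ᵥ x - r • x)) i := by
      obtain ⟨i₀, hi₀⟩ := Finite.exists_min fun i => (P *ᵥ (B *ᵥ x - r • x)) i / (P *ᵥ x) i
      refine ⟨_, div_pos (hd i₀) (hy i₀), fun i => ?_⟩
      rw [← le_div_iff₀ (hy i)]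
      exact hi₀ i
    have := hmax (r + ε) (P *ᵥ x) (fun i => (hy i).le)
      (Function.ne_iff.2 ⟨Classical.arbitrary E, (hy _).ne'⟩) (fun i => by
        have := hle i
        rw [Matrix.mulVec_sub, Matrix.mulVec_smul, ← hPB] at this
        simp only [Pi.sub_apply, Pi.smul_apply, smul_eq_mul] at this
        linarith)
    linarith
  have hXx : X *ᵥ x = (r - c) • x := by
    have := hBv x
    rw [hBx] at this
    rw [sub_smul, this, add_sub_cancel_right]
  -- x is also an eigenvector of the positive matrix P, and P maps nonzero nonnegative vectors to
  -- positive ones.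
  have hxpos : ∀ i, 0 < x i := by
    have hex : P *ᵥ x = Real.exp (r - c) • x := by
      have e1 : X = (X - (r - c) • 1) + (r - c) • (1 : Matrix E E ℝ) := by simp
      rw [hPdef, e1, matrix_exp_add_smul_one, Matrix.smul_mulVec, matrix_exp_mulVec_eq_self]
      rw [Matrix.sub_mulVec, hXx, Matrix.smul_mulVec, Matrix.one_mulVec, sub_self]
    intro i
    have := hPpos x hx0 hxne i
    rw [hex] at this
    exact pos_of_mul_pos_right this (Real.exp_pos _).le
  refine ⟨x, hxpos, ?_⟩
  have hlead : leadingEigenvalue X = r - c := by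
    have hspec : ∀ (μ : ℂ), μ ∈ spectrum ℂ (X.map (fun x : ℝ => (x : ℂ))) ↔
        ∃ v : E → ℂ, v ≠ 0 ∧ (X.map (fun x : ℝ => (x : ℂ))) *ᵥ v = μ • v := by
      intro μ
      rw [spectrum.mem_iff, Matrix.isUnit_iff_isUnit_det, isUnit_iff_ne_zero, not_not,
        ← Matrix.exists_mulVec_eq_zero_iff]
      refine exists_congr fun v => and_congr_right fun _ => ?_
      rw [Matrix.sub_mulVec, sub_eq_zero, Algebra.algebraMap_eq_smul_one, Matrix.smul_mulVec,
        Matrix.one_mulVec, eq_comm]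
    refine IsGreatest.csSup_eq ⟨⟨((r - c : ℝ) : ℂ), ?_, Complex.ofReal_re _⟩, ?_⟩
    · rw [hspec]
      refine ⟨fun i => (x i : ℂ), fun h0 => ?_, ?_⟩
      · have := congrFun h0 (Classical.arbitrary E)
        exact (hxpos _).ne' (by simpa using this)
      · funext i
        have := congrFun hXx i
        simp only [Matrix.mulVec, dotProduct, Pi.smul_apply, smul_eq_mul, Matrix.map_apply]
          at this ⊢
        exact_mod_cast this
    · rintro _ ⟨μ, hμ, rfl⟩
      obtain ⟨v, hv, hXv⟩ := (hspec μ).1 hμ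
      -- The entrywise modulus of a complex eigenvector is a subeigenvector of B for the value |μ +
      -- c|, so maximality of r applies and bounds Re μ by r - c.
      have hle : ‖μ + c‖ ≤ r := by
        refine hmax _ (fun i => ‖v i‖) (fun i => norm_nonneg _) (fun h0 => hv ?_) fun i => ?_
        · funext i; simpa using congrFun h0 i
        · have e : ∑ j, (B i j : ℂ) * v j = (μ + c) * v i := by
            have h1 := congrFun hXv i
            simp only [Matrix.mulVec, dotProduct, Pi.smul_apply, smul_eq_mul, Matrix.map_apply]
              at h1
            rw [add_mul, ← h1]
            simp [hB, add_mul, Finset.sum_add_distrib, Matrix.one_apply, apply_ite Complex.ofReal]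
          rw [← norm_mul, ← e]
          refine (norm_sum_le _ _).trans (Finset.sum_le_sum fun j _ => ?_)
          rw [norm_mul, Complex.norm_real, Real.norm_of_nonneg (hB0 i j)]
      have := (Complex.re_le_norm (μ + c)).trans hle
      simp only [Complex.add_re, Complex.ofReal_re] at this
      linarith
  rw [hlead, hXx]

end Matrix

end MAP

end

/-! ### Càdlàg paths observed on grids. -/

noncomputable section

namespace MAP

section Paths

variable {E : Type*}

theorem nhdsLT_sup_nhdsGE (t : ℝ≥0) : 𝓝[<] t ⊔ 𝓝[≥] t = 𝓝 t := by
  rw [← nhdsWithin_union, Iio_union_Ici, nhdsWithin_univ]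

theorem IsCadlagReal.exists_bound {f : ℝ≥0 → ℝ} (hf : IsCadlagReal f) (T : ℝ≥0) :
    ∃ C, 0 ≤ C ∧ ∀ u ≤ T, |f u| ≤ C := by
  have hloc : ∀ t, ∃ U ∈ 𝓝 t, ∃ C, ∀ u ∈ U, |f u| ≤ C := by
    intro t
    obtain ⟨h1, l, h2⟩ := hf t
    obtain ⟨C1, hC1⟩ := (h1.abs.eventually_le_const (lt_add_one _)).exists_mem
    obtain ⟨C2, hC2⟩ := (h2.abs.eventually_le_const (lt_add_one _)).exists_mem
    refine ⟨C2 ∪ C1, ?_, max (|l| + 1) (|f t| + 1), ?_⟩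
    · rw [← nhdsLT_sup_nhdsGE]
      exact union_mem_sup hC2.1 hC1.1
    · rintro u (hu | hu)
      · exact (hC2.2 u hu).trans (le_max_left _ _)
      · exact (hC1.2 u hu).trans (le_max_right _ _)
  have : ∃ C, ∀ u ∈ Icc 0 T, |f u| ≤ C := by
    refine (isCompact_Icc (a := (0 : ℝ≥0)) (b := T)).induction_on
      (p := fun s => ∃ C, ∀ u ∈ s, |f u| ≤ C) ⟨0, by simp⟩ ?_ ?_ ?_
    · rintro s t hst ⟨C, hC⟩
      exact ⟨C, fun u hu => hC u (hst hu)⟩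
    · rintro s t ⟨C, hC⟩ ⟨D, hD⟩
      refine ⟨max C D, ?_⟩
      rintro u (hu | hu)
      · exact (hC u hu).trans (le_max_left _ _)
      · exact (hD u hu).trans (le_max_right _ _)
    · intro t _
      obtain ⟨U, hU, C, hC⟩ := hloc t
      exact ⟨U, mem_nhdsWithin_of_mem_nhds hU, C, hC⟩
  obtain ⟨C, hC⟩ := this
  exact ⟨|C|, abs_nonneg _, fun u hu => (hC u ⟨zero_le, hu⟩).trans (le_abs_self C)⟩

/-- On short intervals, a càdlàg path in a discrete set with equal values at the endpoints is
constant. -/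
theorem IsCadlagDiscrete.exists_mesh {f : ℝ≥0 → E} (hf : IsCadlagDiscrete f) (T : ℝ≥0) :
    ∃ δ : ℝ, 0 < δ ∧ ∀ a b : ℝ≥0, a ≤ b → b ≤ T → (b : ℝ) - a < δ → f a = f b →
      ∀ u ∈ Icc a b, f u = f a := by
  have hloc : ∀ t : ℝ≥0, ∃ ε > 0, (∀ u ∈ Metric.ball t ε, t ≤ u → f u = f t) ∧
      ∃ j, ∀ u ∈ Metric.ball t ε, u < t → f u = j := by
    intro t
    obtain ⟨h1, j, h2⟩ := hf t
    obtain ⟨ε1, he1, h1⟩ := Metric.mem_nhdsWithin_iff.1 h1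
    obtain ⟨ε2, he2, h2⟩ := Metric.mem_nhdsWithin_iff.1 h2
    refine ⟨min ε1 ε2, lt_min he1 he2, fun u hu htu => ?_, j, fun u hu hut => ?_⟩
    · exact h1 ⟨Metric.ball_subset_ball (min_le_left _ _) hu, htu⟩
    · exact h2 ⟨Metric.ball_subset_ball (min_le_right _ _) hu, hut⟩
  choose ε hε h1 j h2 using hloc
  obtain ⟨δ, hδ, hcov⟩ := lebesgue_number_lemma_of_metric (s := Icc (0 : ℝ≥0) T)
    (c := fun t : ℝ≥0 => Metric.ball t (ε t)) isCompact_Icc (fun t => Metric.isOpen_ball)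
    (fun t _ => mem_iUnion.2 ⟨t, Metric.mem_ball_self (hε t)⟩)
  refine ⟨δ, hδ, fun a b hab hbT hδab hf' u hu => ?_⟩
  obtain ⟨t, ht⟩ := hcov a ⟨zero_le, hab.trans hbT⟩
  have hmem : ∀ v ∈ Icc a b, v ∈ Metric.ball t (ε t) := by
    intro v hv
    refine ht ?_
    have h3 : (a : ℝ) ≤ v := hv.1
    have h4 : (v : ℝ) ≤ b := hv.2
    rw [Metric.mem_ball, NNReal.dist_eq, abs_of_nonneg (by linarith)]
    linarith
  have ha := hmem a ⟨le_rfl, hab⟩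
  have hb := hmem b ⟨hab, le_rfl⟩
  have huU := hmem u hu
  rcases lt_or_ge b t with hbt | hbt
  · rw [h2 t u huU (hu.2.trans_lt hbt), h2 t a ha (hab.trans_lt hbt)]
  -- When t lies strictly after a and at or before b, the path has one value before t and one from t
  -- on; equality at the endpoints makes the two values agree.
  rcases lt_or_ge a t with hat | hat
  · rcases lt_or_ge u t with hut | hut
    · rw [h2 t u huU hut, h2 t a ha hat]
    · rw [h1 t u huU hut, hf', h1 t b hb hbt]
  · rw [h1 t u huU (hat.trans hu.1), h1 t a ha hat]

theorem tendsto_nnreal_inv_natCast : Tendsto (fun m : ℕ => (m : ℝ≥0)⁻¹) atTop (𝓝 0) := by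
  rw [← NNReal.tendsto_coe]
  simpa using tendsto_inv_atTop_nhds_zero_nat (𝕜 := ℝ)

/-- Rounding up keeps the grid points to the right of u, where the paths are continuous, while u ≤ t
keeps them inside [0, t]. -/
theorem exists_grid_seq {u t : ℝ≥0} (hut : u ≤ t) :
    ∃ k : ℕ → ℕ, (∀ m, k m ≤ m) ∧
      Tendsto (fun m : ℕ => t * ((k m : ℝ≥0) / m)) atTop (𝓝[≥] u) := by
  rcases eq_or_lt_of_le (zero_le (a := t)) with ht | ht
  · subst ht
    have hu : u = 0 := le_antisymm hut zero_le
    subst hu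
    refine ⟨fun _ => 0, fun _ => Nat.zero_le _, ?_⟩
    simp only [zero_mul]
    exact tendsto_const_nhdsWithin self_mem_Ici
  · refine ⟨fun m => ⌈u / t * m⌉₊, fun m => ?_, ?_⟩
    · refine Nat.ceil_le.2 (mul_le_of_le_one_left zero_le ?_)
      exact div_le_one_of_le₀ hut zero_le
    · have hlow : ∀ᶠ m : ℕ in atTop, u ≤ t * ((⌈u / t * m⌉₊ : ℝ≥0) / m) := by
        filter_upwards [eventually_gt_atTop 0] with m hm
        have hm' : (0 : ℝ≥0) < m := by exact_mod_cast hm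
        have := Nat.le_ceil (u / t * m)
        calc u = t * (u / t * m / m) := by field_simp
          _ ≤ _ := by gcongr
      refine tendsto_nhdsWithin_iff.2 ⟨?_, hlow⟩
      have hup : ∀ᶠ m : ℕ in atTop, t * ((⌈u / t * m⌉₊ : ℝ≥0) / m) ≤ u + t * (m : ℝ≥0)⁻¹ := by
        filter_upwards [eventually_gt_atTop 0] with m hm
        have hm' : (0 : ℝ≥0) < m := by exact_mod_cast hm
        have := (Nat.ceil_lt_add_one (zero_le (a := u / t * m))).le
        calc _ ≤ t * ((u / t * m + 1) / m) := by gcongr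
          _ = _ := by field_simp
      have hlim : Tendsto (fun m : ℕ => u + t * (m : ℝ≥0)⁻¹) atTop (𝓝 u) := by
        have : Tendsto (fun m : ℕ => (m : ℝ≥0)⁻¹) atTop (𝓝 0) :=
          tendsto_nnreal_inv_natCast
        simpa using (this.const_mul t).const_add u
      exact tendsto_of_tendsto_of_tendsto_of_le_of_le' tendsto_const_nhds hlim hlow hup

/-- Right-continuity replaces uncountably many times by countably many, which makes the event that J
stays in a state measurable. -/
theorem IsCadlagDiscrete.forall_le_iff_grid {f : ℝ≥0 → E} (hf : IsCadlagDiscrete f) (t : ℝ≥0)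
    (i : E) :
    (∀ m k : ℕ, k ≤ m → f (t * ((k : ℝ≥0) / m)) = i) ↔ ∀ u ≤ t, f u = i := by
  refine ⟨fun h u hu => ?_, fun h m k hk => h _ (mul_le_of_le_one_right zero_le ?_)⟩
  · obtain ⟨k, hk, hlim⟩ := exists_grid_seq hu
    obtain ⟨m, hm⟩ := (hlim.eventually (hf u).1).exists
    rw [← hm, h m _ (hk m)]
  · exact div_le_one_of_le₀ (by exact_mod_cast hk) zero_le

/-- A grid point of mesh `1 / (n + 1)` to the right of `t`. -/
def gridAbove (n : ℕ) (t : ℝ≥0) : ℝ≥0 := ((⌊t * (n + 1)⌋₊ : ℝ≥0) + 1) / (n + 1)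

theorem tendsto_gridAbove (t : ℝ≥0) : Tendsto (fun n => gridAbove n t) atTop (𝓝[≥] t) := by
  have hpos : ∀ n : ℕ, (0 : ℝ≥0) < n + 1 := fun n => by positivity
  have hlow : ∀ n, t ≤ gridAbove n t := by
    intro n
    rw [gridAbove, le_div_iff₀ (hpos n)]
    exact (Nat.lt_floor_add_one _).le
  have hup : ∀ n, gridAbove n t ≤ t + ((n : ℝ≥0) + 1)⁻¹ := by
    intro n
    rw [gridAbove, div_le_iff₀ (hpos n), add_mul, inv_mul_cancel₀ (hpos n).ne']
    gcongr
    exact Nat.floor_le zero_le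
  refine tendsto_nhdsWithin_iff.2 ⟨?_, Eventually.of_forall hlow⟩
  have hlim : Tendsto (fun n : ℕ => t + ((n : ℝ≥0) + 1)⁻¹) atTop (𝓝 t) := by
    have h := (tendsto_nnreal_inv_natCast).comp (tendsto_add_atTop_nat 1)
    simpa [Function.comp_def] using h.const_add t
  exact tendsto_of_tendsto_of_tendsto_of_le_of_le tendsto_const_nhds hlim hlow hup

theorem IsCadlagReal.tendsto_gridAbove {f : ℝ≥0 → ℝ} (hf : IsCadlagReal f) (t : ℝ≥0) :
    Tendsto (fun n => f (gridAbove n t)) atTop (𝓝 (f t)) :=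
  (hf t).1.comp (MAP.tendsto_gridAbove t)

/-- If the path has its initial value at the infimum of the departure times, it keeps it for a while
afterwards, so there are no departure times at all. Hence the value at the first jump time tells
whether a jump occurs, even with the convention that the infimum of the empty set is 0. -/
theorem IsCadlagDiscrete.eq_zero_of_sInf {f : ℝ≥0 → E} (hf : IsCadlagDiscrete f)
    (h : f (sInf {t | f t ≠ f 0}) = f 0) (t : ℝ≥0) : f t = f 0 := by
  by_contra ht
  set T := sInf {t | f t ≠ f 0} with hT
  have hne : {t | f t ≠ f 0}.Nonempty := ⟨t, ht⟩
  obtain ⟨ε, hε, h1⟩ := Metric.mem_nhdsWithin_iff.1 (hf T).1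
  obtain ⟨s, hs, hsT⟩ := exists_lt_of_csInf_lt hne
    (show T < T + ⟨ε, hε.le⟩ from lt_add_of_pos_right T hε)
  have hTs : T ≤ s := csInf_le (OrderBot.bddBelow _) hs
  refine hs ?_
  have : s ∈ Metric.ball T ε ∩ Ici T := by
    refine ⟨?_, hTs⟩
    have h2 : (T : ℝ) ≤ s := hTs
    have h3 : (s : ℝ) < T + ε := hsT
    rw [Metric.mem_ball, NNReal.dist_eq, abs_of_nonneg (by linarith)]
    linarith
  exact (h1 this).trans h

/-- Along grids of vanishing mesh, the cell containing the first jump of `f` is found by looking at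
the grid points only, and the increment of `g` over it converges to the jump of `g`. -/
theorem exists_firstJump_cell {f : ℝ≥0 → E} {g : ℝ≥0 → ℝ} (hf : IsCadlagDiscrete f)
    (hg : IsCadlagReal g) {T : ℝ≥0} (hT : T = sInf {t | f t ≠ f 0}) (hfT : f T ≠ f 0)
    {h : ℕ → ℝ≥0} (hpos : ∀ᶠ m in atTop, 0 < h m) (hlim : Tendsto h atTop (𝓝 0)) :
    ∃ k : ℕ → ℕ, (∀ᶠ m in atTop, ∀ l ≤ k m, f (l * h m) = f 0) ∧
      (∀ᶠ m in atTop, f ((k m + 1) * h m) = f T) ∧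
      Tendsto (fun m => g ((k m + 1) * h m) - g (k m * h m)) atTop
        (𝓝 (g T - Function.leftLim g T)) := by
  have hT0 : 0 < T := by
    rcases eq_or_lt_of_le (zero_le (a := T)) with h0 | h0
    · exact absurd (by rw [← h0]) hfT
    · exact h0
  have hlt : ∀ u < T, f u = f 0 := by
    intro u hu
    by_contra hne
    exact absurd hu (not_lt.2 (hT ▸ csInf_le (OrderBot.bddBelow _) hne))
  -- This choice gives k h < T ≤ (k + 1) h: the left end approaches T strictly from below and sees
  -- the left limit, the right end sees the value at T.
  set k : ℕ → ℕ := fun m => ⌈T / h m⌉₊ - 1 with hk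
  have hk1 : ∀ᶠ m in atTop, (k m : ℝ≥0) * h m < T ∧ T ≤ ((k m : ℝ≥0) + 1) * h m := by
    filter_upwards [hpos] with m hm
    have hc : 0 < ⌈T / h m⌉₊ := Nat.ceil_pos.2 (div_pos hT0 hm)
    have e : ((k m : ℝ≥0) + 1) = (⌈T / h m⌉₊ : ℝ≥0) := by
      have : k m + 1 = ⌈T / h m⌉₊ := Nat.succ_pred_eq_of_pos hc
      exact_mod_cast this
    constructor
    · rw [← lt_div_iff₀ hm]
      exact Nat.lt_ceil.1 (Nat.sub_lt hc one_pos)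
    · rw [e, ← div_le_iff₀ hm]
      exact Nat.le_ceil _
  have hleft : Tendsto (fun m => (k m : ℝ≥0) * h m) atTop (𝓝[<] T) := by
    refine tendsto_nhdsWithin_iff.2 ⟨?_, hk1.mono fun m hm => hm.1⟩
    have h1 : Tendsto (fun m => T - h m) atTop (𝓝 T) := by
      simpa using tendsto_const_nhds.sub hlim
    refine tendsto_of_tendsto_of_tendsto_of_le_of_le' h1 tendsto_const_nhds ?_
      (hk1.mono fun m hm => hm.1.le)
    filter_upwards [hk1] with m hm
    rw [tsub_le_iff_right]
    calc T ≤ _ := hm.2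
      _ = _ := by ring
  have hright : Tendsto (fun m => ((k m : ℝ≥0) + 1) * h m) atTop (𝓝[≥] T) := by
    refine tendsto_nhdsWithin_iff.2 ⟨?_, hk1.mono fun m hm => hm.2⟩
    have h1 : Tendsto (fun m => T + h m) atTop (𝓝 T) := by
      simpa using hlim.const_add T
    refine tendsto_of_tendsto_of_tendsto_of_le_of_le' tendsto_const_nhds h1
      (hk1.mono fun m hm => hm.2) ?_
    filter_upwards [hk1] with m hm
    rw [add_mul, one_mul]
    exact add_le_add_left hm.1.le _
  refine ⟨k, ?_, hright.eventually (hf T).1, ?_⟩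
  · filter_upwards [hk1] with m hm l hl
    refine hlt _ (lt_of_le_of_lt ?_ hm.1)
    gcongr
  · obtain ⟨y, hy⟩ := (hg T).2
    have : (𝓝[<] T).NeBot := nhdsLT_neBot_of_exists_lt ⟨0, hT0⟩
    rw [leftLim_eq_of_tendsto hy]
    exact ((hg T).1.comp hright).sub (hy.comp hleft)

end Paths

end MAP

end

/-! ### The Markov property on path space. -/

noncomputable section

namespace MAP

theorem measure_eq_sum_inter {Ω E : Type*} [Fintype E] [MeasurableSpace E]
    [DiscreteMeasurableSpace E] {m : MeasurableSpace Ω} (μ : Measure Ω) {Y : Ω → E}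
    (hY : Measurable Y) {S : Set Ω} (hS : MeasurableSet S) :
    μ S = ∑ j, μ (S ∩ {ω | Y ω = j}) := by
  classical
  have e : S = ⋃ j ∈ (Finset.univ : Finset E), S ∩ {ω | Y ω = j} := by ext; simp
  conv_lhs => rw [e]
  refine measure_biUnion_finset ?_ fun j _ => hS.inter (hY (measurableSet_singleton j))
  intro a _ b _ hab
  refine Set.disjoint_left.2 ?_
  rintro ω ⟨_, h1⟩ ⟨_, h2⟩
  exact hab (h1.symm.trans h2)

theorem exists_monotone_enum (I : Finset ℝ≥0) :
    ∃ τ : ℕ → ℝ≥0, Monotone τ ∧ τ 0 = 0 ∧ ∀ s ∈ I, ∃ l, τ (l + 1) = s := by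
  rcases I.eq_empty_or_nonempty with rfl | hI
  · exact ⟨fun _ => 0, monotone_const, rfl, by simp⟩
  have hc : 0 < I.card := hI.card_pos
  set e := I.orderEmbOfFin rfl with he
  -- Time 0, then the points of I in increasing order, with the largest repeated forever.
  refine ⟨fun n => Nat.casesOn n 0 fun n => e ⟨min n (I.card - 1), by omega⟩, ?_, rfl, ?_⟩
  · refine monotone_nat_of_le_succ fun n => ?_
    cases n with
    | zero => exact zero_le
    | succ n =>
      refine e.monotone (Fin.mk_le_mk.2 ?_)
      omega
  · intro s hs
    have : s ∈ Set.range e := by rw [he, Finset.range_orderEmbOfFin]; exact hs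
    obtain ⟨⟨l, hl⟩, rfl⟩ := this
    refine ⟨l, ?_⟩
    change e _ = e _
    congr 2
    omega

section Markov

set_option linter.unusedSectionVars false

variable {Ω E : Type*}

/-- The future of the process after time `t`, relative to the position at time `t`. -/
def shiftPath (ξ : ℝ≥0 → Ω → ℝ) (J : ℝ≥0 → Ω → E) (t : ℝ≥0) (ω : Ω) : ℝ≥0 → ℝ × E :=
  fun s => (ξ (t + s) ω - ξ t ω, J (t + s) ω)

/-- The increments of the process after time `t` along a sequence of times. -/
def incrementSeq (ξ : ℝ≥0 → Ω → ℝ) (J : ℝ≥0 → Ω → E) (τ : ℕ → ℝ≥0) (t : ℝ≥0) (ω : Ω) :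
    ℕ → ℝ × E :=
  fun l => (ξ (t + τ (l + 1)) ω - ξ (t + τ l) ω, J (t + τ (l + 1)) ω)

variable [Fintype E] [DecidableEq E] [MeasurableSpace E] [DiscreteMeasurableSpace E]
  {m : MeasurableSpace Ω} {𝒢 : Filtration ℝ≥0 m} {P : E → Measure Ω} {ξ : ℝ≥0 → Ω → ℝ}
  {J : ℝ≥0 → Ω → E} {Q : Matrix E E ℝ}

namespace IsMAP

theorem measurable_fst (hM : IsMAP 𝒢 P ξ J Q) (t : ℝ≥0) : Measurable (ξ t) :=
  (hM.adapted_fst t).mono (𝒢.le t) le_rfl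

theorem measurable_snd (hM : IsMAP 𝒢 P ξ J Q) (t : ℝ≥0) : Measurable (J t) :=
  (hM.adapted_snd t).mono (𝒢.le t) le_rfl

theorem measurable_fst_of_le (hM : IsMAP 𝒢 P ξ J Q) {s t : ℝ≥0} (h : s ≤ t) :
    Measurable[𝒢 t] (ξ s) :=
  (hM.adapted_fst s).mono (𝒢.mono h) le_rfl

theorem measurable_snd_of_le (hM : IsMAP 𝒢 P ξ J Q) {s t : ℝ≥0} (h : s ≤ t) :
    Measurable[𝒢 t] (J s) :=
  (hM.adapted_snd s).mono (𝒢.mono h) le_rfl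

theorem measurable_shiftPath (hM : IsMAP 𝒢 P ξ J Q) (t : ℝ≥0) : Measurable (shiftPath ξ J t) :=
  measurable_pi_lambda _ fun s =>
    ((hM.measurable_fst (t + s)).sub (hM.measurable_fst t)).prodMk (hM.measurable_snd (t + s))

theorem measurable_incrementSeq (hM : IsMAP 𝒢 P ξ J Q) (τ : ℕ → ℝ≥0) (t : ℝ≥0) :
    Measurable (incrementSeq ξ J τ t) :=
  measurable_pi_lambda _ fun _ =>
    ((hM.measurable_fst _).sub (hM.measurable_fst _)).prodMk (hM.measurable_snd _)

theorem measure_inter_step (hM : IsMAP 𝒢 P ξ J Q) (k : E) {s d : ℝ≥0} {S : Set Ω}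
    (hS : MeasurableSet[𝒢 s] S) {C : Set (ℝ × E)} (hC : MeasurableSet C) :
    P k (S ∩ {ω | (ξ (s + d) ω - ξ s ω, J (s + d) ω) ∈ C}) =
      ∑ j, P k (S ∩ {ω | J s ω = j}) * P j {ω | (ξ d ω - ξ 0 ω, J d ω) ∈ C} := by
  have hS' := 𝒢.le s _ hS
  have hC' : MeasurableSet {ω | (ξ (s + d) ω - ξ s ω, J (s + d) ω) ∈ C} :=
    (((hM.measurable_fst _).sub (hM.measurable_fst _)).prodMk (hM.measurable_snd _)) hC
  rw [measure_eq_sum_inter (P k) (hM.measurable_snd s) (hS'.inter hC')]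
  refine Finset.sum_congr rfl fun j _ => ?_
  rw [inter_right_comm, hM.markov_additive k j s d S C hS hC]

/-- Induction on the number of increments. The final state j is recorded because the next increment
depends on the past only through it; summing over j removes it in the end. -/
theorem measure_box (hM : IsMAP 𝒢 P ξ J Q) {τ : ℕ → ℝ≥0} (hτ : Monotone τ) (h0 : τ 0 = 0)
    {B : ℕ → Set (ℝ × E)} (hB : ∀ l, MeasurableSet (B l)) (k i : E) {t : ℝ≥0} {A : Set Ω}
    (hA : MeasurableSet[𝒢 t] A) (n : ℕ) (j : E) :
    P k (((A ∩ {ω | J t ω = i}) ∩ {ω | ∀ l < n, incrementSeq ξ J τ t ω l ∈ B l}) ∩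
        {ω | J (t + τ n) ω = j}) =
      P k (A ∩ {ω | J t ω = i}) *
        P i ({ω | ∀ l < n, incrementSeq ξ J τ 0 ω l ∈ B l} ∩ {ω | J (0 + τ n) ω = j}) := by
  have hmeas : ∀ (t : ℝ≥0) (n : ℕ),
      MeasurableSet[𝒢 (t + τ n)] {ω | ∀ l < n, incrementSeq ξ J τ t ω l ∈ B l} := by
    intro t n
    have e : {ω | ∀ l < n, incrementSeq ξ J τ t ω l ∈ B l} =
        ⋂ l, ⋂ _ : l < n, {ω | incrementSeq ξ J τ t ω l ∈ B l} := by ext; simp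
    rw [e]
    refine MeasurableSet.iInter fun l => MeasurableSet.iInter fun hl => ?_
    have h1 : t + τ (l + 1) ≤ t + τ n := add_le_add_right (hτ hl) t
    have h2 : t + τ l ≤ t + τ n := add_le_add_right (hτ hl.le) t
    exact (((hM.measurable_fst_of_le h1).sub (hM.measurable_fst_of_le h2)).prodMk
      (hM.measurable_snd_of_le h1)) (hB l)
  have hlt : ∀ (S : Set Ω) (t : ℝ≥0) (n : ℕ) (j : E),
      (S ∩ {ω | ∀ l < n + 1, incrementSeq ξ J τ t ω l ∈ B l}) ∩ {ω | J (t + τ (n + 1)) ω = j} =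
      (S ∩ {ω | ∀ l < n, incrementSeq ξ J τ t ω l ∈ B l}) ∩
        {ω | (ξ ((t + τ n) + (τ (n + 1) - τ n)) ω - ξ (t + τ n) ω,
          J ((t + τ n) + (τ (n + 1) - τ n)) ω) ∈ B n ∩ Prod.snd ⁻¹' {j}} := by
    intro S t n j
    ext ω
    have e : (t + τ n) + (τ (n + 1) - τ n) = t + τ (n + 1) := by
      rw [add_assoc, add_tsub_cancel_of_le (hτ n.le_succ)]
    simp only [e, mem_inter_iff, mem_ofPred_eq, Nat.lt_succ_iff_lt_or_eq, or_imp, forall_and,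
      forall_eq, incrementSeq, mem_preimage, mem_singleton_iff]
    tauto
  have hstart : ∀ᵐ ω ∂(P i), J (0 + τ 0) ω = i := by
    filter_upwards [hM.start i] with ω hω
    rw [h0, add_zero, hω.2]
  have := hM.prob i
  induction n generalizing j with
  | zero =>
    simp only [not_lt_zero, false_imp_iff, implies_true, ofPred_true, inter_univ,
      univ_inter]
    by_cases hij : i = j
    · subst hij
      rw [h0, add_zero, inter_assoc, inter_self]
      have : P i {ω | J (0 + τ 0) ω = i} = 1 := (prob_compl_eq_zero_iff
        ((hM.measurable_snd _) (measurableSet_singleton i))).1 hstart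
      rw [h0] at this
      rw [this, mul_one]
    · have e1 : (A ∩ {ω | J t ω = i}) ∩ {ω | J (t + τ 0) ω = j} = ∅ := by
        ext ω
        simp only [h0, add_zero, mem_inter_iff, mem_ofPred_eq, mem_empty_iff_false, iff_false]
        rintro ⟨⟨_, h1⟩, h2⟩
        exact hij (h1.symm.trans h2)
      have e2 : P i {ω | J (0 + τ 0) ω = j} = 0 := by
        refine measure_mono_null ?_ hstart
        intro ω hω h
        exact hij ((show J (0 + τ 0) ω = i from h).symm.trans hω)
      rw [e1, e2, measure_empty, mul_zero]
  | succ n ih =>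
    have hC : MeasurableSet (B n ∩ Prod.snd ⁻¹' {j} : Set (ℝ × E)) :=
      (hB n).inter (_root_.measurable_snd (measurableSet_singleton j))
    have hS : MeasurableSet[𝒢 (t + τ n)]
        ((A ∩ {ω | J t ω = i}) ∩ {ω | ∀ l < n, incrementSeq ξ J τ t ω l ∈ B l}) := by
      refine MeasurableSet.inter (𝒢.mono le_self_add _ (hA.inter ?_)) (hmeas t n)
      exact (hM.adapted_snd t) (measurableSet_singleton i)
    have h1 := hlt (A ∩ {ω | J t ω = i}) t n j
    have h2 := hlt univ 0 n j
    rw [univ_inter, univ_inter] at h2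
    rw [h1, h2, hM.measure_inter_step k hS hC, hM.measure_inter_step i (hmeas 0 n) hC,
      Finset.mul_sum]
    exact Finset.sum_congr rfl fun j' _ => by rw [ih j', mul_assoc]

/-- Both sides are finite measures that agree on boxes depending on finitely many increments, and
these form a generating π-system. -/
theorem map_incrementSeq (hM : IsMAP 𝒢 P ξ J Q) {τ : ℕ → ℝ≥0} (hτ : Monotone τ) (h0 : τ 0 = 0)
    (k i : E) {t : ℝ≥0} {A : Set Ω} (hA : MeasurableSet[𝒢 t] A) :
    ((P k).restrict (A ∩ {ω | J t ω = i})).map (incrementSeq ξ J τ t) =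
      P k (A ∩ {ω | J t ω = i}) • (P i).map (incrementSeq ξ J τ 0) := by
  have := hM.prob i
  have := hM.prob k
  have hbox : ∀ {B : ℕ → Set (ℝ × E)}, (∀ l, MeasurableSet (B l)) → ∀ n : ℕ,
      P k ((A ∩ {ω | J t ω = i}) ∩ {ω | ∀ l < n, incrementSeq ξ J τ t ω l ∈ B l}) =
      P k (A ∩ {ω | J t ω = i}) * P i {ω | ∀ l < n, incrementSeq ξ J τ 0 ω l ∈ B l} := by
    intro B hB n
    have hm : ∀ t, MeasurableSet {ω | ∀ l < n, incrementSeq ξ J τ t ω l ∈ B l} := by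
      intro t
      have e : {ω | ∀ l < n, incrementSeq ξ J τ t ω l ∈ B l} =
          ⋂ l, ⋂ _ : l < n, {ω | incrementSeq ξ J τ t ω l ∈ B l} := by ext; simp
      rw [e]
      exact MeasurableSet.iInter fun l => MeasurableSet.iInter fun _ =>
        (measurable_pi_apply l).comp (hM.measurable_incrementSeq τ t) (hB l)
    have hA' : MeasurableSet (A ∩ {ω | J t ω = i}) :=
      (𝒢.le t _ hA).inter (hM.measurable_snd t (measurableSet_singleton i))
    rw [measure_eq_sum_inter (P k) (hM.measurable_snd (t + τ n)) (hA'.inter (hm t)),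
      measure_eq_sum_inter (P i) (hM.measurable_snd (0 + τ n)) (hm 0), Finset.mul_sum]
    exact Finset.sum_congr rfl fun j _ => hM.measure_box hτ h0 hB k i hA n j
  have hinc := hM.measurable_incrementSeq τ
  refine ext_of_generate_finite _ generateFrom_squareCylinders.symm
    (isPiSystem_squareCylinders (fun _ => MeasurableSpace.isPiSystem_measurableSet)
      (fun _ => by simp)) ?_ ?_
  · rintro _ ⟨s, T, hT, rfl⟩
    obtain ⟨n, hn⟩ := s.exists_nat_subset_range
    classical
    have hB : ∀ l, MeasurableSet (if l ∈ s then T l else univ) := by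
      intro l
      split_ifs
      · exact hT l (mem_univ l)
      · exact MeasurableSet.univ
    have e : ∀ t, incrementSeq ξ J τ t ⁻¹' ((s : Set ℕ).pi T) =
        {ω | ∀ l < n, incrementSeq ξ J τ t ω l ∈ if l ∈ s then T l else univ} := by
      intro t
      ext ω
      simp only [mem_preimage, Set.mem_pi, Finset.mem_coe, mem_ofPred_eq]
      constructor
      · intro h l _
        split_ifs with hl
        · exact h l hl
        · trivial
      · intro h l hl
        have := h l (Finset.mem_range.1 (hn hl))
        rwa [if_pos hl] at this
    have hms : MeasurableSet ((s : Set ℕ).pi T) :=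
      MeasurableSet.pi s.countable_toSet fun l _ => hT l (mem_univ l)
    rw [Measure.map_apply (hinc t) hms, Measure.restrict_apply (hinc t hms), Measure.smul_apply,
      Measure.map_apply (hinc 0) hms, e, e, smul_eq_mul, inter_comm]
    exact hbox hB n
  · rw [Measure.map_apply (hinc t) MeasurableSet.univ, Measure.smul_apply,
      Measure.map_apply (hinc 0) MeasurableSet.univ]
    simp

/-- The Markov property on path space. -/
theorem map_shiftPath (hM : IsMAP 𝒢 P ξ J Q) (k i : E) {t : ℝ≥0} {A : Set Ω}
    (hA : MeasurableSet[𝒢 t] A) :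
    ((P k).restrict (A ∩ {ω | J t ω = i})).map (shiftPath ξ J t) =
      P k (A ∩ {ω | J t ω = i}) • (P i).map (shiftPath ξ J 0) := by
  have := hM.prob i
  have := hM.prob k
  have hsh := hM.measurable_shiftPath
  refine ext_of_generate_finite _ generateFrom_measurableCylinders.symm
    isPiSystem_measurableCylinders ?_ ?_
  · intro C hC
    obtain ⟨I, S, hS, rfl⟩ := (mem_measurableCylinders _).1 hC
    obtain ⟨τ, hτ, h0, hI⟩ := exists_monotone_enum I
    choose idx hidx using hI
    -- The values of the shifted path at the times of I are partial sums of increments, so a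
    -- cylinder event is a measurable event for the increment sequence.
    set Ψ : (ℕ → ℝ × E) → (I → ℝ × E) := fun x s =>
      (∑ l ∈ Finset.range (idx s.1 s.2 + 1), (x l).1, (x (idx s.1 s.2)).2) with hΨ
    have hΨm : Measurable Ψ := by
      refine measurable_pi_lambda _ fun s => Measurable.prodMk ?_ ?_
      · exact Finset.measurable_sum _ fun l _ =>
          _root_.measurable_fst.comp (measurable_pi_apply l)
      · exact _root_.measurable_snd.comp (measurable_pi_apply _)
    have e : ∀ t, shiftPath ξ J t ⁻¹' (cylinder I S) = incrementSeq ξ J τ t ⁻¹' (Ψ ⁻¹' S) := by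
      intro t
      ext ω
      have : I.restrict (shiftPath ξ J t ω) = Ψ (incrementSeq ξ J τ t ω) := by
        funext s
        have h1 : ∑ l ∈ Finset.range (idx s.1 s.2 + 1), (incrementSeq ξ J τ t ω l).1 =
            ξ (t + s) ω - ξ t ω := by
          have := Finset.sum_range_sub (fun l => ξ (t + τ l) ω) (idx s.1 s.2 + 1)
          rw [h0, add_zero, hidx] at this
          exact this
        refine Prod.ext h1.symm ?_
        simp only [hΨ, Finset.restrict, shiftPath, incrementSeq, hidx]
      simp only [mem_preimage, mem_cylinder, ← this]
    have hcyl : MeasurableSet (cylinder I S : Set (ℝ≥0 → ℝ × E)) := MeasurableSet.cylinder I hS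
    have hinc := hM.measurable_incrementSeq τ
    have key := congrArg (fun μ => μ (Ψ ⁻¹' S)) (hM.map_incrementSeq hτ h0 k i hA)
    simp only [Measure.smul_apply] at key
    rw [Measure.map_apply (hinc t) (hΨm hS), Measure.map_apply (hinc 0) (hΨm hS)] at key
    rw [Measure.map_apply (hsh t) hcyl, Measure.smul_apply, Measure.map_apply (hsh 0) hcyl, e, e]
    exact key
  · rw [Measure.map_apply (hsh t) MeasurableSet.univ, Measure.smul_apply,
      Measure.map_apply (hsh 0) MeasurableSet.univ]
    simp

theorem setLIntegral_shiftPath (hM : IsMAP 𝒢 P ξ J Q) (k : E) {t : ℝ≥0} {A : Set Ω}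
    (hA : MeasurableSet[𝒢 t] A) {F : (ℝ≥0 → ℝ × E) → ℝ≥0∞} (hF : Measurable F) :
    ∫⁻ ω in A, F (shiftPath ξ J t ω) ∂(P k) =
      ∑ i, P k (A ∩ {ω | J t ω = i}) * ∫⁻ ω, F (shiftPath ξ J 0 ω) ∂(P i) := by
  have hA' := 𝒢.le t _ hA
  have hJ : ∀ i, MeasurableSet {ω | J t ω = i} := fun i =>
    hM.measurable_snd t (measurableSet_singleton i)
  have e : A = ⋃ i ∈ (Finset.univ : Finset E), A ∩ {ω | J t ω = i} := by ext; simp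
  conv_lhs => rw [e]
  rw [lintegral_biUnion_finset]
  · refine Finset.sum_congr rfl fun i _ => ?_
    rw [← lintegral_map hF (hM.measurable_shiftPath t), hM.map_shiftPath k i hA,
      lintegral_smul_measure, lintegral_map hF (hM.measurable_shiftPath 0), smul_eq_mul]
  · intro a _ b _ hab
    refine Set.disjoint_left.2 ?_
    rintro ω ⟨_, h1⟩ ⟨_, h2⟩
    exact hab (h1.symm.trans h2)
  · exact fun i _ => hA'.inter (hJ i)

/-- Since X is measurable for the past, only the restrictions to 𝒢 t of the measures with the two
densities matter, and these agree by the version for sets. -/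
theorem lintegral_mul_shiftPath (hM : IsMAP 𝒢 P ξ J Q) (k : E) {t : ℝ≥0} {X : Ω → ℝ≥0∞}
    (hX : Measurable[𝒢 t] X) {F : (ℝ≥0 → ℝ × E) → ℝ≥0∞} (hF : Measurable F) :
    ∫⁻ ω, X ω * F (shiftPath ξ J t ω) ∂(P k) =
      ∫⁻ ω, X ω * ∫⁻ ω', F (shiftPath ξ J 0 ω') ∂(P (J t ω)) ∂(P k) := by
  set G : Ω → ℝ≥0∞ := fun ω => F (shiftPath ξ J t ω)
  set G' : Ω → ℝ≥0∞ := fun ω => ∫⁻ ω', F (shiftPath ξ J 0 ω') ∂(P (J t ω))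
  have hG : Measurable G := hF.comp (hM.measurable_shiftPath t)
  have hG' : Measurable G' :=
    (Measurable.of_discrete (f := fun i => ∫⁻ ω', F (shiftPath ξ J 0 ω') ∂(P i))).comp
      (hM.measurable_snd t)
  have hX' : Measurable X := hX.mono (𝒢.le t) le_rfl
  have htrim : ((P k).withDensity G).trim (𝒢.le t) = ((P k).withDensity G').trim (𝒢.le t) := by
    refine @Measure.ext _ (𝒢 t) _ _ fun A hA => ?_
    rw [trim_measurableSet_eq _ hA, trim_measurableSet_eq _ hA,
      withDensity_apply _ (𝒢.le t _ hA), withDensity_apply _ (𝒢.le t _ hA),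
      hM.setLIntegral_shiftPath k hA hF]
    have hA' := 𝒢.le t _ hA
    have hJ : ∀ i, MeasurableSet {ω | J t ω = i} := fun i =>
      hM.measurable_snd t (measurableSet_singleton i)
    have e : A = ⋃ i ∈ (Finset.univ : Finset E), A ∩ {ω | J t ω = i} := by ext; simp
    conv_rhs => rw [e]
    rw [lintegral_biUnion_finset]
    · refine Finset.sum_congr rfl fun i _ => ?_
      rw [setLIntegral_congr_fun (g := fun _ => ∫⁻ ω', F (shiftPath ξ J 0 ω') ∂(P i))
        (hA'.inter (hJ i)), setLIntegral_const, mul_comm]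
      rintro ω ⟨_, hω⟩
      simp only [G', show J t ω = i from hω]
    · intro a _ b _ hab
      refine Set.disjoint_left.2 ?_
      rintro ω ⟨_, h1⟩ ⟨_, h2⟩
      exact hab (h1.symm.trans h2)
    · exact fun i _ => hA'.inter (hJ i)
  have h1 : ∀ {H : Ω → ℝ≥0∞}, Measurable H →
      ∫⁻ ω, X ω * H ω ∂(P k) = ∫⁻ ω, X ω ∂(((P k).withDensity H).trim (𝒢.le t)) := by
    intro H hH
    rw [lintegral_trim _ hX, lintegral_withDensity_eq_lintegral_mul _ hH hX']
    simp only [Pi.mul_apply, mul_comm]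
  rw [h1 hG, h1 hG', htrim]

theorem lintegral_shiftPath_zero (hM : IsMAP 𝒢 P ξ J Q) (i : E)
    (F : (ℝ≥0 → ℝ × E) → ℝ≥0∞) :
    ∫⁻ ω, F (shiftPath ξ J 0 ω) ∂(P i) = ∫⁻ ω, F (fun s => (ξ s ω, J s ω)) ∂(P i) := by
  refine lintegral_congr_ae ?_
  filter_upwards [hM.start i] with ω hω
  congr 1
  funext s
  simp [shiftPath, hω.1]

theorem lintegral_mul_shiftPath_of_support (hM : IsMAP 𝒢 P ξ J Q) (k a : E) {t : ℝ≥0}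
    {X : Ω → ℝ≥0∞} (hX : Measurable[𝒢 t] X) (hsupp : ∀ ω, J t ω ≠ a → X ω = 0)
    {F : (ℝ≥0 → ℝ × E) → ℝ≥0∞} (hF : Measurable F) :
    ∫⁻ ω, X ω * F (shiftPath ξ J t ω) ∂(P k) =
      (∫⁻ ω, X ω ∂(P k)) * ∫⁻ ω, F (fun s => (ξ s ω, J s ω)) ∂(P a) := by
  rw [hM.lintegral_mul_shiftPath k hX hF, ← lintegral_mul_const _ (hX.mono (𝒢.le t) le_rfl)]
  refine lintegral_congr fun ω => ?_
  by_cases h : J t ω = a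
  · rw [h, hM.lintegral_shiftPath_zero]
  · rw [hsupp ω h, zero_mul, zero_mul]

end IsMAP

end Markov

end MAP

end

/-! ### Exponential moments and their multiplicativity. -/

noncomputable section

namespace MAP

/-- A multiplicative function on `[0, ∞)` that is finite at `1` and bounded below near `0` is an
exponential function. -/
theorem exists_exp_of_multiplicative {f : ℝ≥0 → ℝ≥0∞} (hmul : ∀ s t, f (s + t) = f s * f t)
    (h1 : f 1 ≠ ∞) {δ : ℝ≥0} (hδ : 0 < δ) (hlow : ∀ t < δ, 2⁻¹ ≤ f t) :
    ∃ c : ℝ, ∀ t : ℝ≥0, f t = ENNReal.ofReal (Real.exp (c * t)) := by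
  have hf0 : f 0 ≠ 0 := by
    intro h
    have := hlow 0 hδ
    rw [h] at this
    simp at this
  have hne0 : ∀ t, f t ≠ 0 := by
    have hind : ∀ (n : ℕ) (t : ℝ≥0), t < δ → f (n * t) ≠ 0 := by
      intro n t ht
      induction n with
      | zero => simpa using hf0
      | succ n ih =>
        rw [Nat.cast_succ, add_mul, one_mul, hmul]
        refine mul_ne_zero ih fun h => ?_
        have := hlow t ht
        rw [h] at this
        simp at this
    intro t
    obtain ⟨n, hn⟩ := exists_nat_gt (t / δ)
    have hn0 : (0 : ℝ≥0) < n := lt_of_le_of_lt zero_le hn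
    have := hind n (t / n) (by rw [div_lt_iff₀ hn0]; rwa [div_lt_iff₀ hδ, mul_comm] at hn)
    rwa [mul_div_cancel₀ _ hn0.ne'] at this
  have hf01 : f 0 = 1 := by
    have h0 : f 0 ≠ ∞ := by
      intro h
      have := hmul 0 1
      rw [zero_add, h, ENNReal.top_mul (hne0 1)] at this
      exact h1 this
    have := hmul 0 0
    rw [add_zero] at this
    exact ((ENNReal.mul_eq_left hf0 h0).1 this.symm)
  have hnat : ∀ n : ℕ, f n ≠ ∞ := by
    intro n
    induction n with
    | zero => simp [hf01]
    | succ n ih => rw [Nat.cast_succ, hmul]; exact ENNReal.mul_ne_top ih h1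
  have hfin : ∀ t, f t ≠ ∞ := by
    intro t h
    obtain ⟨n, hn⟩ := exists_nat_ge t
    have := hmul t (n - t)
    rw [add_tsub_cancel_of_le hn, h, ENNReal.top_mul (hne0 _)] at this
    exact hnat n this
  set u : ℝ≥0 → ℝ := fun t => Real.log (f t).toReal with hu
  have huadd : ∀ s t, u (s + t) = u s + u t := by
    intro s t
    simp only [hu, hmul, ENNReal.toReal_mul]
    exact Real.log_mul (ENNReal.toReal_ne_zero.2 ⟨hne0 s, hfin s⟩)
      (ENNReal.toReal_ne_zero.2 ⟨hne0 t, hfin t⟩)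
  have hulow : ∀ t < δ, -Real.log 2 ≤ u t := by
    intro t ht
    rw [← Real.log_inv]
    refine Real.log_le_log (by norm_num) ?_
    have := ENNReal.toReal_mono (hfin t) (hlow t ht)
    simpa using this
  have hu0 : u 0 = 0 := by simp [hu, hf01]
  -- The logarithm of f minus its expected linear part; it is additive and vanishes at all
  -- rationals.
  let v : ℝ≥0 →+ ℝ :=
    { toFun := fun t => u t - u 1 * t
      map_zero' := by simp [hu0]
      map_add' := fun s t => by simp only [huadd]; push_cast; ring }
  have hv : ∀ t, v t = u t - u 1 * t := fun t => rfl
  have hvnat : ∀ n : ℕ, v n = 0 := by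
    intro n
    have := map_nsmul v n 1
    rw [nsmul_one] at this
    rw [this, hv]
    simp
  have hvrat : ∀ k m : ℕ, 0 < m → v ((k : ℝ≥0) / m) = 0 := by
    intro k m hm
    have hm' : (m : ℝ≥0) ≠ 0 := by exact_mod_cast hm.ne'
    have := map_nsmul v m ((k : ℝ≥0) / m)
    rw [nsmul_eq_mul, mul_div_cancel₀ _ hm', hvnat, nsmul_eq_mul] at this
    have hm'' : (m : ℝ) ≠ 0 := by exact_mod_cast hm.ne'
    exact (mul_eq_zero.1 this.symm).resolve_left hm''
  -- Subtracting a rational does not change v and brings t into [0, δ), where f is bounded below.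
  have hvlow : ∀ t, -(Real.log 2 + |u 1| * δ) ≤ v t := by
    intro t
    obtain ⟨m, hm⟩ := exists_nat_gt δ⁻¹
    have hm0 : (0 : ℝ≥0) < m := lt_of_le_of_lt zero_le hm
    set q : ℝ≥0 := (⌊t * m⌋₊ : ℝ≥0) / m with hq
    have hqt : q ≤ t := by rw [hq, div_le_iff₀ hm0]; exact Nat.floor_le zero_le
    have htq : t - q < δ := by
      rw [tsub_lt_iff_left hqt]
      have h2 : t < q + 1 / m := by
        rw [hq, ← add_div, lt_div_iff₀ hm0]; exact Nat.lt_floor_add_one _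
      refine h2.trans_le (add_le_add_right ?_ q)
      rw [one_div]
      exact inv_le_of_inv_le₀ hδ hm.le
    have e : v t = v (t - q) := by
      conv_lhs => rw [← tsub_add_cancel_of_le hqt]
      rw [map_add, hvrat _ _ (by exact_mod_cast hm0), add_zero]
    rw [e, hv]
    have h3 := hulow _ htq
    have h4 : u 1 * ((t - q : ℝ≥0) : ℝ) ≤ |u 1| * δ :=
      mul_le_mul (le_abs_self _) (by exact_mod_cast htq.le) NNReal.zero_le_coe (abs_nonneg _)
    linarith
  -- A negative value would be multiplied by n along n t, against the lower bound.
  have hvnn : ∀ t, 0 ≤ v t := by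
    intro t
    by_contra hneg
    push Not at hneg
    set C := Real.log 2 + |u 1| * δ
    obtain ⟨n, hn⟩ := exists_nat_gt (C / (-v t))
    rw [div_lt_iff₀ (by linarith)] at hn
    have h2 := hvlow (n • t)
    rw [map_nsmul, nsmul_eq_mul] at h2
    linarith
  -- The values at t and n - t are nonnegative and add up to v(n) = 0.
  have hvz : ∀ t, v t = 0 := by
    intro t
    obtain ⟨n, hn⟩ := exists_nat_ge t
    have h2 : v n = v t + v (n - t) := by rw [← map_add, add_tsub_cancel_of_le hn]
    rw [hvnat] at h2
    have h3 := hvnn t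
    have h4 := hvnn (n - t)
    linarith
  refine ⟨u 1, fun t => ?_⟩
  have h2 : u t = u 1 * t := by
    have := hvz t
    rw [hv] at this
    linarith
  rw [← h2, Real.exp_log (ENNReal.toReal_pos (hne0 t) (hfin t)), ENNReal.ofReal_toReal (hfin t)]

theorem IsCadlagDiscrete.shift {E : Type*} {f : ℝ≥0 → E} (hf : IsCadlagDiscrete f) (t : ℝ≥0) :
    IsCadlagDiscrete fun u => f (t + u) := by
  intro u
  have hc : Continuous fun v : ℝ≥0 => t + v := by fun_prop
  obtain ⟨h1, j, h2⟩ := hf (t + u)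
  refine ⟨?_, j, ?_⟩
  · exact (tendsto_nhdsWithin_of_tendsto_nhds_of_eventually_within _
      (hc.continuousAt.tendsto.mono_left nhdsWithin_le_nhds)
      (eventually_nhdsWithin_of_forall fun v (hv : u ≤ v) => add_le_add_right hv t)).eventually h1
  · exact (tendsto_nhdsWithin_of_tendsto_nhds_of_eventually_within _
      (hc.continuousAt.tendsto.mono_left nhdsWithin_le_nhds)
      (eventually_nhdsWithin_of_forall fun v (hv : v < u) => add_lt_add_right hv t)).eventually h2

/-- The exponential `exp (z x)` in `[0, ∞]`. -/
def expz (z x : ℝ) : ℝ≥0∞ := ENNReal.ofReal (Real.exp (z * x))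

theorem expz_add (z x y : ℝ) : expz z (x + y) = expz z x * expz z y := by
  rw [expz, mul_add, Real.exp_add, ENNReal.ofReal_mul (Real.exp_pos _).le, expz, expz]

theorem expz_zero_right (z : ℝ) : expz z 0 = 1 := by simp [expz]

theorem expz_zero_left (x : ℝ) : expz 0 x = 1 := by simp [expz]

theorem expz_ne_top (z x : ℝ) : expz z x ≠ ∞ := ENNReal.ofReal_ne_top

theorem expz_pos (z x : ℝ) : 0 < expz z x := ENNReal.ofReal_pos.2 (Real.exp_pos _)

theorem continuous_expz (z : ℝ) : Continuous (expz z) :=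
  ENNReal.continuous_ofReal.comp (by fun_prop)

theorem measurable_expz (z : ℝ) : Measurable (expz z) := (continuous_expz z).measurable

section Moments

set_option linter.unusedSectionVars false

variable {Ω E : Type*}

/-- Paths whose second component stays in `i` at the grid times of `[0, t]`. -/
def stayPath (t : ℝ≥0) (i : E) : Set (ℝ≥0 → ℝ × E) :=
  {x | ∀ m k : ℕ, k ≤ m → (x (t * ((k : ℝ≥0) / m))).2 = i}

/-- The event that `J` stays in `i` up to time `t`. -/
def stay (J : ℝ≥0 → Ω → E) (t : ℝ≥0) (i : E) : Set Ω := {ω | ∀ u ≤ t, J u ω = i}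

variable {m : MeasurableSpace Ω}

/-- The moment `E_i[exp(z ξ_t); J stays in i up to time t]`. -/
def stayMoment (P : E → Measure Ω) (ξ : ℝ≥0 → Ω → ℝ) (J : ℝ≥0 → Ω → E) (z : ℝ) (i : E)
    (t : ℝ≥0) : ℝ≥0∞ :=
  ∫⁻ ω in stay J t i, expz z (ξ t ω) ∂(P i)

/-- The matrix of moments `E_i[f(ξ_t); J_t = j]`. -/
def funMoment (P : E → Measure Ω) (ξ : ℝ≥0 → Ω → ℝ) (J : ℝ≥0 → Ω → E) (f : ℝ → ℝ≥0∞)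
    (t : ℝ≥0) : Matrix E E ℝ≥0∞ :=
  Matrix.of fun i j => ∫⁻ ω in {ω | J t ω = j}, f (ξ t ω) ∂(P i)

variable [Fintype E] [DecidableEq E] [MeasurableSpace E] [DiscreteMeasurableSpace E]
  {𝒢 : Filtration ℝ≥0 m} {P : E → Measure Ω} {ξ : ℝ≥0 → Ω → ℝ}
  {J : ℝ≥0 → Ω → E} {Q : Matrix E E ℝ}

theorem measurableSet_stayPath (t : ℝ≥0) (i : E) : MeasurableSet (stayPath t i) := by
  have : stayPath t i = ⋂ m : ℕ, ⋂ k : ℕ, ⋂ _ : k ≤ m,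
      {x : ℝ≥0 → ℝ × E | (x (t * ((k : ℝ≥0) / m))).2 = i} := by
    ext; simp [stayPath]
  rw [this]
  exact MeasurableSet.iInter fun m => MeasurableSet.iInter fun k => MeasurableSet.iInter fun _ =>
    (measurable_snd.comp (measurable_pi_apply _)) (measurableSet_singleton i)

namespace IsMAP

theorem shiftPath_mem_stayPath (hM : IsMAP 𝒢 P ξ J Q) (t s : ℝ≥0) (i : E) (ω : Ω) :
    shiftPath ξ J t ω ∈ stayPath s i ↔ ∀ u ≤ s, J (t + u) ω = i :=
  ((hM.cadlag_snd ω).shift t).forall_le_iff_grid s i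

theorem path_mem_stayPath (hM : IsMAP 𝒢 P ξ J Q) (s : ℝ≥0) (i : E) (ω : Ω) :
    (fun s => (ξ s ω, J s ω)) ∈ stayPath s i ↔ ω ∈ stay J s i :=
  (hM.cadlag_snd ω).forall_le_iff_grid s i

theorem measurableSet_stay (hM : IsMAP 𝒢 P ξ J Q) (t : ℝ≥0) (i : E) :
    MeasurableSet[𝒢 t] (stay J t i) := by
  have : stay J t i = ⋂ m : ℕ, ⋂ k : ℕ, ⋂ _ : k ≤ m, {ω | J (t * ((k : ℝ≥0) / m)) ω = i} := by
    ext ω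
    simp only [mem_iInter]
    exact ((hM.cadlag_snd ω).forall_le_iff_grid t i).symm
  rw [this]
  refine MeasurableSet.iInter fun m => MeasurableSet.iInter fun k =>
    MeasurableSet.iInter fun h => ?_
  refine hM.measurable_snd_of_le ?_ (measurableSet_singleton i)
  exact mul_le_of_le_one_right zero_le (div_le_one_of_le₀ (by exact_mod_cast h) zero_le)

theorem measurable_path_apply (f : ℝ → ℝ≥0∞) (hf : Measurable f) (s : ℝ≥0) :
    Measurable fun x : ℝ≥0 → ℝ × E => f (x s).1 :=
  hf.comp (_root_.measurable_fst.comp (measurable_pi_apply s))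

/-- Staying in i up to s + t means staying up to s and then, for the future started again from i,
staying for a further time t; the increments of ξ add up in the exponent. -/
theorem stayMoment_add (hM : IsMAP 𝒢 P ξ J Q) (z : ℝ) (i : E) (s t : ℝ≥0) :
    stayMoment P ξ J z i (s + t) = stayMoment P ξ J z i s * stayMoment P ξ J z i t := by
  have hs := 𝒢.le s _ (hM.measurableSet_stay s i)
  have ht := 𝒢.le t _ (hM.measurableSet_stay t i)
  have hst := 𝒢.le (s + t) _ (hM.measurableSet_stay (s + t) i)
  have hF : Measurable ((stayPath t i).indicator fun x : ℝ≥0 → ℝ × E => expz z (x t).1) :=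
    (measurable_path_apply _ (measurable_expz z) t).indicator (measurableSet_stayPath t i)
  have hX : Measurable[𝒢 s] ((stay J s i).indicator fun ω => expz z (ξ s ω)) :=
    ((measurable_expz z).comp (hM.adapted_fst s)).indicator (hM.measurableSet_stay s i)
  have key := hM.lintegral_mul_shiftPath_of_support i i hX (fun ω hω => by
    exact indicator_of_notMem (fun h : ω ∈ stay J s i => hω (h s le_rfl)) _) hF
  rw [stayMoment, stayMoment, stayMoment, ← lintegral_indicator hs, ← lintegral_indicator ht,
    ← lintegral_indicator hst]
  refine Eq.trans ?_ (key.trans ?_)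
  · refine lintegral_congr fun ω => ?_
    have hiff : ω ∈ stay J (s + t) i ↔ ω ∈ stay J s i ∧ shiftPath ξ J s ω ∈ stayPath t i := by
      rw [hM.shiftPath_mem_stayPath]
      constructor
      · exact fun h => ⟨fun u hu => h u (hu.trans le_self_add),
          fun u hu => h _ (add_le_add_right hu s)⟩
      · rintro ⟨h1, h2⟩ u hu
        rcases le_total u s with h | h
        · exact h1 u h
        · have := h2 (u - s) (tsub_le_iff_left.2 hu)
          rwa [add_tsub_cancel_of_le h] at this
    by_cases h1 : ω ∈ stay J s i
    · by_cases h2 : shiftPath ξ J s ω ∈ stayPath t i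
      · rw [indicator_of_mem (hiff.2 ⟨h1, h2⟩), indicator_of_mem h1, indicator_of_mem h2,
          ← expz_add]
        simp [shiftPath]
      · rw [indicator_of_notMem (fun h => h2 (hiff.1 h).2), indicator_of_notMem h2, mul_zero]
    · rw [indicator_of_notMem (fun h => h1 (hiff.1 h).1), indicator_of_notMem h1, zero_mul]
  · congr 1
    refine lintegral_congr fun ω => ?_
    by_cases h : ω ∈ stay J t i
    · rw [indicator_of_mem h, indicator_of_mem ((hM.path_mem_stayPath t i ω).2 h)]
    · rw [indicator_of_notMem h,
        indicator_of_notMem (fun h' => h ((hM.path_mem_stayPath t i ω).1 h'))]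

/-- Otherwise there are times tending to 0 with moments below 1/2. Along them the integrand
converges to 1 almost surely by right-continuity of ξ and J, contradicting Fatou's lemma. -/
theorem exists_stayMoment_lower (hM : IsMAP 𝒢 P ξ J Q) (z : ℝ) (i : E) :
    ∃ δ : ℝ≥0, 0 < δ ∧ ∀ t < δ, 2⁻¹ ≤ stayMoment P ξ J z i t := by
  by_contra hcon
  push Not at hcon
  have hpos : ∀ n : ℕ, (0 : ℝ≥0) < ((n : ℝ≥0) + 1)⁻¹ := fun n => by positivity
  choose t htδ htlt using fun n : ℕ => hcon _ (hpos n)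
  have := hM.prob i
  have hlim0 : Tendsto (fun n : ℕ => ((n : ℝ≥0) + 1)⁻¹) atTop (𝓝 0) := by
    simpa [Function.comp_def] using tendsto_nnreal_inv_natCast.comp (tendsto_add_atTop_nat 1)
  have hlim : Tendsto t atTop (𝓝[≥] 0) := tendsto_nhdsWithin_iff.2
    ⟨tendsto_of_tendsto_of_tendsto_of_le_of_le tendsto_const_nhds hlim0 (fun _ => zero_le)
      fun n => (htδ n).le, Eventually.of_forall fun _ => mem_Ici.2 zero_le⟩
  have hst := fun n => 𝒢.le (t n) _ (hM.measurableSet_stay (t n) i)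
  have hae : ∀ᵐ ω ∂(P i), 1 ≤ liminf
      (fun n => (stay J (t n) i).indicator (fun ω => expz z (ξ (t n) ω)) ω) atTop := by
    filter_upwards [hM.start i] with ω hω
    have h1 : Tendsto (fun n => expz z (ξ (t n) ω)) atTop (𝓝 1) := by
      have h0 : Tendsto (fun n => ξ (t n) ω) atTop (𝓝 (ξ 0 ω)) :=
        ((hM.cadlag_fst ω) 0).1.comp hlim
      rw [hω.1] at h0
      have := ((continuous_expz z).tendsto 0).comp h0
      rwa [expz_zero_right] at this
    have h2 : ∀ᶠ n in atTop, ω ∈ stay J (t n) i := by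
      obtain ⟨ε, hε, h2⟩ := Metric.mem_nhdsWithin_iff.1 ((hM.cadlag_snd ω) 0).1
      have h3 := (hlim.mono_right nhdsWithin_le_nhds).eventually (Metric.ball_mem_nhds 0 hε)
      filter_upwards [h3] with n hn u hu
      rw [← hω.2]
      refine h2 ⟨?_, mem_Ici.2 zero_le⟩
      rw [NNReal.dist_eq, NNReal.coe_zero, sub_zero, abs_of_nonneg NNReal.zero_le_coe] at hn
      rw [Metric.mem_ball, NNReal.dist_eq, NNReal.coe_zero, sub_zero,
        abs_of_nonneg NNReal.zero_le_coe]
      exact lt_of_le_of_lt (by exact_mod_cast hu) hn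
    have h3 : Tendsto (fun n => (stay J (t n) i).indicator (fun ω => expz z (ξ (t n) ω)) ω)
        atTop (𝓝 1) := by
      refine h1.congr' ?_
      filter_upwards [h2] with n hn
      rw [indicator_of_mem hn]
    exact h3.liminf_eq.ge
  have hfatou := lintegral_liminf_le (μ := P i) (u := atTop)
    (f := fun n => (stay J (t n) i).indicator (fun ω => expz z (ξ (t n) ω)))
    (fun n => ((measurable_expz z).comp (hM.measurable_fst _)).indicator (hst n))
  have h1 : (1 : ℝ≥0∞) ≤ ∫⁻ ω, liminf
      (fun n => (stay J (t n) i).indicator (fun ω => expz z (ξ (t n) ω)) ω) atTop ∂(P i) := by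
    calc (1 : ℝ≥0∞) = ∫⁻ _, 1 ∂(P i) := by simp
      _ ≤ _ := lintegral_mono_ae hae
  have h2 : liminf (fun n => ∫⁻ ω, (stay J (t n) i).indicator
      (fun ω => expz z (ξ (t n) ω)) ω ∂(P i)) atTop ≤ 2⁻¹ := by
    refine (liminf_le_liminf (v := fun _ => 2⁻¹) (Eventually.of_forall fun n => ?_)).trans
      (by simp)
    rw [lintegral_indicator (hst n)]
    exact (htlt n).le
  have h3 := h1.trans (hfatou.trans h2)
  rw [← not_lt] at h3
  exact h3 (ENNReal.inv_lt_one.2 (by norm_num))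

theorem exists_stayMoment_eq (hM : IsMAP 𝒢 P ξ J Q) (z : ℝ) (i : E)
    (h1 : stayMoment P ξ J z i 1 ≠ ∞) :
    ∃ c : ℝ, ∀ t : ℝ≥0, stayMoment P ξ J z i t = ENNReal.ofReal (Real.exp (c * t)) := by
  obtain ⟨δ, hδ, hlow⟩ := hM.exists_stayMoment_lower z i
  exact exists_exp_of_multiplicative (hM.stayMoment_add z i) h1 hδ hlow

theorem funMoment_zero (hM : IsMAP 𝒢 P ξ J Q) (z : ℝ) :
    funMoment P ξ J (expz z) 0 = 1 := by
  ext i j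
  have := hM.prob i
  have hm : MeasurableSet {ω | J 0 ω = j} := hM.measurable_snd 0 (measurableSet_singleton j)
  simp only [funMoment, Matrix.of_apply]
  rw [← lintegral_indicator hm]
  have : ∀ᵐ ω ∂(P i), {ω | J 0 ω = j}.indicator (fun ω => expz z (ξ 0 ω)) ω =
      (1 : Matrix E E ℝ≥0∞) i j := by
    filter_upwards [hM.start i] with ω hω
    by_cases hij : i = j
    · subst hij
      rw [indicator_of_mem (show ω ∈ {ω | J 0 ω = i} from hω.2), hω.1, expz_zero_right,
        Matrix.one_apply_eq]
    · rw [indicator_of_notMem (show ω ∉ {ω | J 0 ω = j} from fun h => hij (hω.2.symm.trans h)),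
        Matrix.one_apply_ne hij]
  rw [lintegral_congr_ae this, lintegral_const, measure_univ, mul_one]

/-- Chapman-Kolmogorov with a weight from the past: the constant weight gives the semigroup
property, general weights the martingale property. -/
theorem lintegral_mul_expz_shift (hM : IsMAP 𝒢 P ξ J Q) (z : ℝ) (k j : E) {t : ℝ≥0}
    {X : Ω → ℝ≥0∞} (hX : Measurable[𝒢 t] X) (s : ℝ≥0) :
    ∫⁻ ω in {ω | J (t + s) ω = j}, X ω * expz z (ξ (t + s) ω) ∂(P k) =
      ∑ a, (∫⁻ ω in {ω | J t ω = a}, X ω * expz z (ξ t ω) ∂(P k)) *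
        funMoment P ξ J (expz z) s a j := by
  have hJ : ∀ t j, MeasurableSet {ω | J t ω = j} := fun t j =>
    hM.measurable_snd t (measurableSet_singleton j)
  have hF : Measurable (({x : ℝ≥0 → ℝ × E | (x s).2 = j}).indicator fun x => expz z (x s).1) :=
    (measurable_path_apply _ (measurable_expz z) s).indicator
      ((_root_.measurable_snd.comp (measurable_pi_apply s)) (measurableSet_singleton j))
  have hXa : ∀ a, Measurable[𝒢 t]
      ({ω | J t ω = a}.indicator fun ω => X ω * expz z (ξ t ω)) := fun a =>
    (hX.mul ((measurable_expz z).comp (hM.adapted_fst t))).indicator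
      (hM.adapted_snd t (measurableSet_singleton a))
  have key := fun a => hM.lintegral_mul_shiftPath_of_support k a (hXa a) (fun ω hω =>
    indicator_of_notMem (show ω ∉ {ω | J t ω = a} from hω) _) hF
  have hR : ∀ a, ∫⁻ ω, ({x : ℝ≥0 → ℝ × E | (x s).2 = j}).indicator (fun x => expz z (x s).1)
      (fun s => (ξ s ω, J s ω)) ∂(P a) = funMoment P ξ J (expz z) s a j := by
    intro a
    rw [funMoment, Matrix.of_apply, ← lintegral_indicator (hJ s j)]
    rfl
  have hsum : ∀ ω, ({ω | J (t + s) ω = j}).indicator (fun ω => X ω * expz z (ξ (t + s) ω)) ω =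
      ∑ a, ({ω | J t ω = a}.indicator (fun ω => X ω * expz z (ξ t ω)) ω) *
        ({x : ℝ≥0 → ℝ × E | (x s).2 = j}).indicator (fun x => expz z (x s).1)
          (shiftPath ξ J t ω) := by
    intro ω
    rw [Finset.sum_eq_single (J t ω)]
    · rw [indicator_of_mem (show ω ∈ {ω' | J t ω' = J t ω} from rfl)]
      by_cases h : J (t + s) ω = j
      · rw [indicator_of_mem (show ω ∈ {ω | J (t + s) ω = j} from h),
          indicator_of_mem (show shiftPath ξ J t ω ∈ {x | (x s).2 = j} from h), mul_assoc,
          ← expz_add]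
        simp [shiftPath]
      · rw [indicator_of_notMem (show ω ∉ {ω | J (t + s) ω = j} from h),
          indicator_of_notMem (show shiftPath ξ J t ω ∉ {x | (x s).2 = j} from h), mul_zero]
    · intro a _ ha
      rw [indicator_of_notMem (show ω ∉ {ω | J t ω = a} from fun h => ha h.symm), zero_mul]
    · simp
  rw [← lintegral_indicator (hJ _ j), lintegral_congr hsum, lintegral_finsetSum]
  · refine Finset.sum_congr rfl fun a _ => ?_
    rw [key a, hR, lintegral_indicator (hJ t a)]
  · exact fun a _ => ((hXa a).mono (𝒢.le t) le_rfl).mul (hF.comp (hM.measurable_shiftPath t))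

theorem funMoment_add (hM : IsMAP 𝒢 P ξ J Q) (z : ℝ) (t s : ℝ≥0) :
    funMoment P ξ J (expz z) (t + s) =
      funMoment P ξ J (expz z) t * funMoment P ξ J (expz z) s := by
  ext i j
  have := hM.lintegral_mul_expz_shift z i j (t := t) (X := fun _ => 1) measurable_const s
  simp only [one_mul] at this
  rw [Matrix.mul_apply]
  exact this

theorem funMoment_nsmul (hM : IsMAP 𝒢 P ξ J Q) (z : ℝ) (t : ℝ≥0) (n : ℕ) :
    funMoment P ξ J (expz z) (n * t) = funMoment P ξ J (expz z) t ^ n := by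
  induction n with
  | zero => simp [hM.funMoment_zero z]
  | succ n ih => rw [Nat.cast_succ, add_mul, one_mul, hM.funMoment_add, ih, pow_succ]

theorem funMoment_expz_zero (hM : IsMAP 𝒢 P ξ J Q) (t : ℝ≥0) (i j : E) :
    funMoment P ξ J (expz 0) t i j = ENNReal.ofReal (NormedSpace.exp ((t : ℝ) • Q) i j) := by
  have := hM.prob i
  rw [funMoment, Matrix.of_apply, ← hM.transition i j t, ofReal_measureReal (measure_ne_top _ _)]
  simp [expz_zero_left]

end IsMAP

end Moments

end MAP

end

/-! ### Transition rates and the jump at the first transition. -/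

noncomputable section

namespace MAP

section Rates

set_option linter.unusedSectionVars false

variable {Ω E : Type*} {m : MeasurableSpace Ω}
  [Fintype E] [DecidableEq E] [MeasurableSpace E] [DiscreteMeasurableSpace E]
  {𝒢 : Filtration ℝ≥0 m} {P : E → Measure Ω} {ξ : ℝ≥0 → Ω → ℝ}
  {J : ℝ≥0 → Ω → E} {Q : Matrix E E ℝ}

theorem tendsto_div_natCast_nhdsNE {t : ℝ≥0} (ht : 0 < t) :
    Tendsto (fun m : ℕ => ((t / m : ℝ≥0) : ℝ)) atTop (𝓝[≠] 0) := by
  refine tendsto_nhdsWithin_iff.2 ⟨?_, ?_⟩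
  · simpa using tendsto_const_div_atTop_nhds_zero_nat (t : ℝ)
  · filter_upwards [eventually_gt_atTop 0] with n hn
    have h1 : (0 : ℝ≥0) < n := by exact_mod_cast hn
    have : (0 : ℝ≥0) < t / n := div_pos ht h1
    simpa using ⟨ht.ne', hn.ne'⟩

theorem tendsto_natCast_mul_matrix_exp_sub_one (X : Matrix E E ℝ) {t : ℝ≥0} (ht : 0 < t)
    (i j : E) :
    Tendsto (fun n : ℕ => (n : ℝ) *
      (NormedSpace.exp (((t / n : ℝ≥0) : ℝ) • X) i j - (1 : Matrix E E ℝ) i j)) atTop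
      (𝓝 (t * X i j)) := by
  have h := ((tendsto_matrix_exp_sub_one X i j).comp (tendsto_div_natCast_nhdsNE ht)).const_mul
    (t : ℝ)
  refine h.congr' ?_
  filter_upwards [eventually_gt_atTop 0] with n hn
  have h1 : (n : ℝ) ≠ 0 := by exact_mod_cast hn.ne'
  have h2 : (t : ℝ) ≠ 0 := by exact_mod_cast ht.ne'
  simp only [Function.comp_apply, NNReal.coe_div, NNReal.coe_natCast]
  field_simp

theorem tendsto_div_natCast (t : ℝ≥0) : Tendsto (fun n : ℕ => t / n) atTop (𝓝 0) := by
  simpa [div_eq_mul_inv] using tendsto_nnreal_inv_natCast.const_mul t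

namespace IsMAP

/-- Only the transition function is given, so the properties of a rate matrix are recovered by
differentiating it at time 0. -/
theorem rate_nonneg (hM : IsMAP 𝒢 P ξ J Q) {i j : E} (hij : i ≠ j) : 0 ≤ Q i j := by
  have h := tendsto_natCast_mul_matrix_exp_sub_one Q one_pos i j
  rw [NNReal.coe_one, one_mul] at h
  refine ge_of_tendsto' h fun n => mul_nonneg (Nat.cast_nonneg n) ?_
  rw [Matrix.one_apply_ne hij, sub_zero, ← hM.transition]
  exact measureReal_nonneg

theorem sum_transition (hM : IsMAP 𝒢 P ξ J Q) (i : E) (t : ℝ≥0) :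
    ∑ j, NormedSpace.exp ((t : ℝ) • Q) i j = 1 := by
  have := hM.prob i
  have h := measure_eq_sum_inter (P i) (hM.measurable_snd t) MeasurableSet.univ
  simp only [measure_univ, univ_inter] at h
  have h2 := congrArg ENNReal.toReal h
  rw [ENNReal.toReal_sum fun j _ => measure_ne_top _ _] at h2
  simp only [← hM.transition]
  exact h2.symm

theorem rate_sum (hM : IsMAP 𝒢 P ξ J Q) (i : E) : ∑ j, Q i j = 0 := by
  have h := tendsto_finsetSum Finset.univ fun j _ =>
    tendsto_natCast_mul_matrix_exp_sub_one Q one_pos i j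
  simp only [NNReal.coe_one, one_mul] at h
  refine tendsto_nhds_unique h ?_
  have : ∀ n : ℕ, ∑ j, (n : ℝ) * (NormedSpace.exp (((1 / n : ℝ≥0) : ℝ) • Q) i j -
      (1 : Matrix E E ℝ) i j) = 0 := by
    intro n
    rw [← Finset.mul_sum, Finset.sum_sub_distrib, hM.sum_transition]
    simp [Matrix.one_apply]
  simp only [this]
  exact tendsto_const_nhds

theorem rate_diag_neg (hM : IsMAP 𝒢 P ξ J Q) {i j : E} (hij : i ≠ j) (hq : Q i j ≠ 0) :
    Q i i < 0 := by
  have h := hM.rate_sum i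
  rw [← Finset.add_sum_erase _ _ (Finset.mem_univ i)] at h
  have h2 : 0 < ∑ k ∈ Finset.univ.erase i, Q i k :=
    Finset.sum_pos' (fun k hk => hM.rate_nonneg (Finset.ne_of_mem_erase hk).symm)
      ⟨j, Finset.mem_erase.2 ⟨hij.symm, Finset.mem_univ _⟩,
        lt_of_le_of_ne (hM.rate_nonneg hij) hq.symm⟩
  linarith

/-- The event that `J` is in `i` at the times `0, h, …, k h`. -/
def gridStay (J : ℝ≥0 → Ω → E) (i : E) (h : ℝ≥0) (k : ℕ) : Set Ω := {ω | ∀ l ≤ k, J (l * h) ω = i}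

theorem measurableSet_gridStay (hM : IsMAP 𝒢 P ξ J Q) (i : E) (h : ℝ≥0) (k : ℕ) :
    MeasurableSet[𝒢 (k * h)] (gridStay J i h k) := by
  have : gridStay J i h k = ⋂ l : ℕ, ⋂ _ : l ≤ k, {ω | J (l * h) ω = i} := by
    ext; simp [gridStay]
  rw [this]
  refine MeasurableSet.iInter fun l => MeasurableSet.iInter fun hl => ?_
  refine hM.measurable_snd_of_le ?_ (measurableSet_singleton i)
  gcongr

theorem lintegral_gridStay_cell (hM : IsMAP 𝒢 P ξ J Q) (i j : E) (h : ℝ≥0) (k : ℕ)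
    {f : ℝ → ℝ≥0∞} (hf : Measurable f) :
    ∫⁻ ω, (gridStay J i h k ∩ {ω | J ((k + 1) * h) ω = j}).indicator
      (fun ω => f (ξ ((k + 1) * h) ω - ξ (k * h) ω)) ω ∂(P i) =
      P i (gridStay J i h k) * funMoment P ξ J f h i j := by
  have hg := hM.measurableSet_gridStay i h k
  have hX : Measurable[𝒢 (k * h)] ((gridStay J i h k).indicator fun _ => (1 : ℝ≥0∞)) :=
    Measurable.indicator measurable_const hg
  have hF : Measurable (({x : ℝ≥0 → ℝ × E | (x h).2 = j}).indicator fun x => f (x h).1) :=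
    (measurable_path_apply _ hf h).indicator
      ((_root_.measurable_snd.comp (measurable_pi_apply h)) (measurableSet_singleton j))
  have key := hM.lintegral_mul_shiftPath_of_support i i hX (fun ω hω =>
    indicator_of_notMem (show ω ∉ gridStay J i h k from fun h => hω (h k le_rfl)) _) hF
  have e1 : ∀ ω, (gridStay J i h k ∩ {ω | J ((k + 1) * h) ω = j}).indicator
      (fun ω => f (ξ ((k + 1) * h) ω - ξ (k * h) ω)) ω =
      (gridStay J i h k).indicator (fun _ => (1 : ℝ≥0∞)) ω *
        ({x : ℝ≥0 → ℝ × E | (x h).2 = j}).indicator (fun x => f (x h).1)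
          (shiftPath ξ J (k * h) ω) := by
    intro ω
    have e : (k + 1) * h = k * h + h := by ring
    by_cases h1 : ω ∈ gridStay J i h k
    · by_cases h2 : J ((k + 1) * h) ω = j
      · rw [indicator_of_mem (show ω ∈ gridStay J i h k ∩ {ω | J ((k + 1) * h) ω = j} from
          ⟨h1, h2⟩), indicator_of_mem h1, indicator_of_mem (show shiftPath ξ J (k * h) ω ∈
            {x : ℝ≥0 → ℝ × E | (x h).2 = j} by rw [e] at h2; exact h2), one_mul, e]
        rfl
      · rw [indicator_of_notMem (show ω ∉ gridStay J i h k ∩ {ω | J ((k + 1) * h) ω = j} from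
          fun h => h2 h.2), indicator_of_notMem (show shiftPath ξ J (k * h) ω ∉
            {x : ℝ≥0 → ℝ × E | (x h).2 = j} by rw [e] at h2; exact h2), mul_zero]
    · rw [indicator_of_notMem (show ω ∉ gridStay J i h k ∩ {ω | J ((k + 1) * h) ω = j} from
          fun h => h1 h.1), indicator_of_notMem h1, zero_mul]
  have hm : MeasurableSet {ω | J h ω = j} := hM.measurable_snd h (measurableSet_singleton j)
  rw [lintegral_congr e1, key, lintegral_indicator_const (𝒢.le _ _ hg), one_mul, funMoment,
    Matrix.of_apply, ← lintegral_indicator hm]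
  rfl

theorem measure_gridStay (hM : IsMAP 𝒢 P ξ J Q) (i : E) (h : ℝ≥0) (k : ℕ) :
    P i (gridStay J i h k) = (P i {ω | J h ω = i}) ^ k := by
  have := hM.prob i
  induction k with
  | zero =>
    rw [pow_zero, ← prob_compl_eq_zero_iff (𝒢.le _ _ (hM.measurableSet_gridStay i h 0))]
    have : ∀ᵐ ω ∂(P i), ω ∈ gridStay J i h 0 := by
      filter_upwards [hM.start i] with ω hω l hl
      obtain rfl := Nat.le_zero.1 hl
      simpa using hω.2
    exact this
  | succ k ih =>
    have e : gridStay J i h (k + 1) = gridStay J i h k ∩ {ω | J ((k + 1) * h) ω = i} := by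
      ext ω
      simp only [gridStay, mem_ofPred_eq, mem_inter_iff, Nat.le_succ_iff, or_imp, forall_and,
        forall_eq, Nat.cast_succ]
    have key := hM.lintegral_gridStay_cell (ξ := ξ) i i h k (f := fun _ => 1) measurable_const
    rw [← e, lintegral_indicator_const (𝒢.le _ _ (hM.measurableSet_gridStay i h (k + 1))),
      one_mul, ih] at key
    rw [key, pow_succ]
    congr 1
    simp [funMoment]

/-- The value of `f` at the increment of `ξ` over the first grid cell at whose end `J ≠ i`,
if `J = j` there. -/
def firstCell (ξ : ℝ≥0 → Ω → ℝ) (J : ℝ≥0 → Ω → E) (f : ℝ → ℝ≥0∞) (i j : E) (h : ℝ≥0) (ω : Ω) :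
    ℝ≥0∞ :=
  ∑' k : ℕ, (gridStay J i h k ∩ {ω | J ((k + 1) * h) ω = j}).indicator
    (fun ω => f (ξ ((k + 1) * h) ω - ξ (k * h) ω)) ω

theorem firstCell_eq {f : ℝ → ℝ≥0∞} {i j : E} (hij : i ≠ j) {h : ℝ≥0} {k : ℕ} {ω : Ω}
    (h1 : ω ∈ gridStay J i h k) (h2 : J ((k + 1) * h) ω = j) :
    firstCell ξ J f i j h ω = f (ξ ((k + 1) * h) ω - ξ (k * h) ω) := by
  rw [firstCell, tsum_eq_single k, indicator_of_mem
    (show ω ∈ gridStay J i h k ∩ {ω | J ((k + 1) * h) ω = j} from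
    ⟨h1, h2⟩)]
  intro l hl
  refine indicator_of_notMem ?_ _
  rintro ⟨h3, h4⟩
  rcases lt_or_gt_of_ne hl with hlt | hlt
  · refine hij ((h1 (l + 1) hlt).symm.trans ?_)
    rw [Nat.cast_succ]; exact h4
  · refine hij ((h3 (k + 1) hlt).symm.trans ?_)
    rw [Nat.cast_succ]; exact h2

theorem firstCell_eq_zero {f : ℝ → ℝ≥0∞} {i j : E} {h : ℝ≥0} {ω : Ω}
    (hk : ∀ k, ω ∈ gridStay J i h k → J ((k + 1) * h) ω ≠ j) :
    firstCell ξ J f i j h ω = 0 := by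
  rw [firstCell, ENNReal.tsum_eq_zero]
  exact fun k => indicator_of_notMem (fun h => hk k h.1 h.2) _

/-- Being seen in i at the first k grid times after 0 has the k-th power of a one-step probability,
and the following cell is fresh. Summing over k gives a geometric series. -/
theorem lintegral_firstCell (hM : IsMAP 𝒢 P ξ J Q) (i j : E) (h : ℝ≥0)
    {f : ℝ → ℝ≥0∞} (hf : Measurable f) :
    ∫⁻ ω, firstCell ξ J f i j h ω ∂(P i) =
      (1 - P i {ω | J h ω = i})⁻¹ * funMoment P ξ J f h i j := by
  have hm : ∀ k : ℕ, MeasurableSet (gridStay J i h k ∩ {ω | J ((k + 1) * h) ω = j}) := fun k =>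
    (𝒢.le _ _ (hM.measurableSet_gridStay i h k)).inter
      (hM.measurable_snd _ (measurableSet_singleton j))
  simp only [firstCell]
  rw [lintegral_tsum]
  · simp only [hM.lintegral_gridStay_cell i j h _ hf, hM.measure_gridStay]
    rw [ENNReal.tsum_mul_right, ENNReal.tsum_geometric]
  · exact fun k => ((hf.comp ((hM.measurable_fst _).sub (hM.measurable_fst _))).indicator
      (hm k)).aemeasurable

theorem measurable_firstCell (hM : IsMAP 𝒢 P ξ J Q) (i j : E) (h : ℝ≥0)
    {f : ℝ → ℝ≥0∞} (hf : Measurable f) : Measurable (firstCell ξ J f i j h) :=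
  Measurable.tsum fun k => (hf.comp ((hM.measurable_fst _).sub (hM.measurable_fst _))).indicator
    ((𝒢.le _ _ (hM.measurableSet_gridStay i h k)).inter
      (hM.measurable_snd _ (measurableSet_singleton j)))

/-- For a fine mesh, the first cell at whose end J has left i is the one containing the first jump
time, and the increment of ξ over it converges to the jump there. If J never jumps, all terms
vanish. -/
theorem tendsto_firstCell (hM : IsMAP 𝒢 P ξ J Q) {i j : E} (hij : i ≠ j) {f : ℝ → ℝ≥0∞}
    (hf : Continuous f) {h : ℕ → ℝ≥0} (hpos : ∀ᶠ n in atTop, 0 < h n)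
    (hlim : Tendsto h atTop (𝓝 0)) {ω : Ω} (hω : J 0 ω = i) :
    Tendsto (fun n => firstCell ξ J f i j (h n) ω) atTop
      (𝓝 ({ω | J (firstJump J ω) ω = j}.indicator (fun ω => f (jumpAtFirst ξ J ω)) ω)) := by
  by_cases hT : J (firstJump J ω) ω = J 0 ω
  · have hc := (hM.cadlag_snd ω).eq_zero_of_sInf hT
    rw [indicator_of_notMem (show ω ∉ {ω | J (firstJump J ω) ω = j} from
      fun h => hij ((hω.symm.trans hT.symm).trans h))]
    refine tendsto_const_nhds.congr fun n => (firstCell_eq_zero fun k _ => ?_).symm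
    rw [hc, hω]
    exact hij
  · obtain ⟨k, h1, h2, h3⟩ := exists_firstJump_cell (hM.cadlag_snd ω) (hM.cadlag_fst ω)
      (T := firstJump J ω) rfl hT hpos hlim
    by_cases hj : J (firstJump J ω) ω = j
    · rw [indicator_of_mem (show ω ∈ {ω | J (firstJump J ω) ω = j} from hj)]
      refine ((hf.tendsto _).comp h3).congr' ?_
      filter_upwards [h1, h2] with n h1 h2
      exact (firstCell_eq hij (fun l hl => (h1 l hl).trans hω) (h2.trans hj)).symm
    · rw [indicator_of_notMem (show ω ∉ {ω | J (firstJump J ω) ω = j} from hj)]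
      refine tendsto_const_nhds.congr' ?_
      filter_upwards [h1, h2] with n h1 h2
      refine (firstCell_eq_zero fun l hl hl2 => ?_).symm
      rcases lt_trichotomy l (k n) with hlt | rfl | hlt
      · have := (h1 (l + 1) hlt).trans hω
        rw [Nat.cast_succ] at this
        exact hij (this.symm.trans hl2)
      · exact hj (h2.symm.trans hl2)
      · have := hl (k n + 1) hlt
        rw [Nat.cast_succ] at this
        exact hT ((h2.symm.trans this).trans hω.symm)

theorem tendsto_lintegral_firstCell (hM : IsMAP 𝒢 P ξ J Q) {i j : E} (hij : i ≠ j)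
    {f : ℝ → ℝ≥0∞} (hf : Continuous f) {K : ℝ≥0∞} (hK : K ≠ ∞) (hfK : ∀ x, f x ≤ K)
    {h : ℕ → ℝ≥0} (hpos : ∀ᶠ n in atTop, 0 < h n) (hlim : Tendsto h atTop (𝓝 0)) :
    Tendsto (fun n => (1 - P i {ω | J (h n) ω = i})⁻¹ * funMoment P ξ J f (h n) i j) atTop
      (𝓝 (∫⁻ ω, {ω | J (firstJump J ω) ω = j}.indicator (fun ω => f (jumpAtFirst ξ J ω)) ω
        ∂(P i))) := by
  have := hM.prob i
  simp only [← hM.lintegral_firstCell i j _ hf.measurable]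
  refine tendsto_lintegral_of_dominated_convergence (fun _ => K)
    (fun n => hM.measurable_firstCell i j _ hf.measurable)
    (fun n => Eventually.of_forall fun ω => ?_)
    (by simpa using hK) ?_
  · by_cases hex : ∃ k, ω ∈ gridStay J i (h n) k ∧ J ((k + 1) * h n) ω = j
    · obtain ⟨k, h1, h2⟩ := hex
      rw [firstCell_eq hij h1 h2]
      exact hfK _
    · push Not at hex
      rw [firstCell_eq_zero hex]
      exact zero_le
  · filter_upwards [hM.start i] with ω hω
    exact hM.tendsto_firstCell hij hf hpos hlim hω.2

/-- The indicator is an almost sure limit of the measurable grid functionals for f = 1. -/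
theorem nullMeasurableSet_firstJump (hM : IsMAP 𝒢 P ξ J Q) {i j : E} (hij : i ≠ j) :
    NullMeasurableSet {ω | J (firstJump J ω) ω = j} (P i) := by
  have hpos : ∀ᶠ n : ℕ in atTop, 0 < (1 : ℝ≥0) / n := by
    filter_upwards [eventually_gt_atTop 0] with n hn
    have : (0 : ℝ≥0) < n := by exact_mod_cast hn
    positivity
  have hae : AEMeasurable ({ω | J (firstJump J ω) ω = j}.indicator fun _ => (1 : ℝ≥0∞)) (P i) := by
    refine aemeasurable_of_tendsto_metrizable_ae atTop
      (fun n : ℕ => (hM.measurable_firstCell (ξ := ξ) i j (1 / n) (f := fun _ => 1)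
        measurable_const).aemeasurable) ?_
    filter_upwards [hM.start i] with ω hω
    exact hM.tendsto_firstCell hij continuous_const hpos (tendsto_div_natCast 1) hω.2
  have e : {ω | J (firstJump J ω) ω = j} =
      ({ω | J (firstJump J ω) ω = j}.indicator fun _ => (1 : ℝ≥0∞)) ⁻¹' {1} := by
    ext ω
    by_cases h : ω ∈ {ω | J (firstJump J ω) ω = j}
    · simp [h]
    · simp [h]
  rw [e]
  exact hae.nullMeasurable (measurableSet_singleton 1)

/-- The moment over a short cell is 1 - P_i(J_h = i) times the expectation of the first-cell
functional. The first factor is asymptotic to -q_ii h; the second tends to the expectation of f at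
the jump on the event that the jump leads to j. -/
theorem tendsto_funMoment_ne (hM : IsMAP 𝒢 P ξ J Q) {i j : E} (hij : i ≠ j)
    {f : ℝ → ℝ≥0∞} (hf : Continuous f) {K : ℝ≥0∞} (hK : K ≠ ∞) (hfK : ∀ x, f x ≤ K)
    {t : ℝ≥0} (ht : 0 < t) :
    Tendsto (fun n : ℕ => (n : ℝ) * (funMoment P ξ J f (t / n) i j).toReal) atTop
      (𝓝 (t * (Q i j * (∫⁻ ω, f (jumpAtFirst ξ J ω) ∂(transitionLaw P J i j)).toReal))) := by
  have := hM.prob i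
  have hp : ∀ (j : E) (s : ℝ≥0), (P i {ω | J s ω = j}).toReal = NormedSpace.exp ((s : ℝ) • Q) i j :=
    fun j s => hM.transition i j s
  have hle : ∀ s, funMoment P ξ J f s i j ≤ K * P i {ω | J s ω = j} := by
    intro s
    rw [funMoment, Matrix.of_apply, ← setLIntegral_const]
    exact lintegral_mono fun ω => hfK _
  have hoff : Tendsto (fun n : ℕ => (n : ℝ) * (P i {ω | J (t / n) ω = j}).toReal) atTop
      (𝓝 (t * Q i j)) := by
    have h := tendsto_natCast_mul_matrix_exp_sub_one Q ht i j
    simpa only [Matrix.one_apply_ne hij, sub_zero, ← hp] using h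
  -- With rate zero the event conditioned on may be null. Since f is bounded, the moment is then
  -- controlled by the transition probability, which is o(h).
  by_cases hq : Q i j = 0
  · rw [hq, zero_mul, mul_zero]
    rw [hq, mul_zero] at hoff
    refine squeeze_zero (fun n => by positivity) (fun n => ?_)
      (by simpa using hoff.const_mul K.toReal)
    have h1 := ENNReal.toReal_mono (ENNReal.mul_ne_top hK (measure_ne_top _ _)) (hle (t / n))
    rw [ENNReal.toReal_mul] at h1
    calc _ ≤ (n : ℝ) * (K.toReal * (P i {ω | J (t / n) ω = j}).toReal) := by gcongr
      _ = _ := by ring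
  have hqii := hM.rate_diag_neg hij hq
  have hdiag : Tendsto (fun n : ℕ => (n : ℝ) * (1 - P i {ω | J (t / n) ω = i}).toReal) atTop
      (𝓝 (t * -Q i i)) := by
    have h := (tendsto_natCast_mul_matrix_exp_sub_one Q ht i i).neg
    rw [← mul_neg] at h
    refine h.congr fun n => ?_
    rw [ENNReal.toReal_sub_of_le prob_le_one ENNReal.one_ne_top, hp, Matrix.one_apply_eq,
      ENNReal.toReal_one]
    ring
  have htq : 0 < (t : ℝ) * -Q i i := mul_pos ht (by linarith)
  have hev : ∀ᶠ n : ℕ in atTop, (1 - P i {ω | J (t / n) ω = i}).toReal ≠ 0 := by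
    filter_upwards [hdiag.eventually (lt_mem_nhds htq)] with n hn h0
    rw [h0, mul_zero] at hn
    exact lt_irrefl _ hn
  have hpos : ∀ᶠ n : ℕ in atTop, 0 < t / n := by
    filter_upwards [eventually_gt_atTop 0] with n hn
    have : (0 : ℝ≥0) < n := by exact_mod_cast hn
    positivity
  set S := {ω | J (firstJump J ω) ω = j} with hS
  have hSm := hM.nullMeasurableSet_firstJump (i := i) hij
  have general : ∀ {g : ℝ → ℝ≥0∞}, Continuous g → ∀ {L : ℝ≥0∞}, L ≠ ∞ → (∀ x, g x ≤ L) →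
      Tendsto (fun n : ℕ => (n : ℝ) * (funMoment P ξ J g (t / n) i j).toReal) atTop
        (𝓝 (t * -Q i i * (∫⁻ ω in S, g (jumpAtFirst ξ J ω) ∂(P i)).toReal)) := by
    intro g hg L hL hgL
    have h1 := hM.tendsto_lintegral_firstCell hij hg hL hgL hpos (tendsto_div_natCast t)
    rw [lintegral_indicator₀ hSm] at h1
    have hfin : ∫⁻ ω in S, g (jumpAtFirst ξ J ω) ∂(P i) ≠ ∞ := by
      refine ne_top_of_le_ne_top (ENNReal.mul_ne_top hL (measure_ne_top (P i) S)) ?_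
      rw [← setLIntegral_const]
      exact lintegral_mono fun ω => hgL _
    have h2 := hdiag.mul ((ENNReal.tendsto_toReal hfin).comp h1)
    refine h2.congr' ?_
    filter_upwards [hev] with n hn
    simp only [Function.comp_apply, ENNReal.toReal_mul, ENNReal.toReal_inv]
    field_simp
  -- The constant function identifies q_ij as -q_ii times the probability that the first jump leads
  -- to j, which turns the restricted integral into a conditional expectation.
  have hone := general (g := fun _ => 1) continuous_const ENNReal.one_ne_top fun _ => le_rfl
  have e1 : ∀ s, funMoment P ξ J (fun _ => 1) s i j = P i {ω | J s ω = j} := by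
    intro s; simp [funMoment]
  simp only [e1, setLIntegral_one] at hone
  have hSq : (t : ℝ) * Q i j = t * -Q i i * (P i S).toReal := tendsto_nhds_unique hoff hone
  have hPS : (P i S).toReal ≠ 0 := by
    intro h0
    rw [h0, mul_zero] at hSq
    have : (t : ℝ) ≠ 0 := by exact_mod_cast ht.ne'
    exact hq ((mul_eq_zero.1 hSq).resolve_left this)
  have hmain := general hf hK hfK
  have e2 : (∫⁻ ω, f (jumpAtFirst ξ J ω) ∂(transitionLaw P J i j)).toReal =
      (P i S).toReal⁻¹ * (∫⁻ ω in S, f (jumpAtFirst ξ J ω) ∂(P i)).toReal := by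
    rw [transitionLaw, ProbabilityTheory.cond, lintegral_smul_measure, smul_eq_mul,
      ENNReal.toReal_mul, ENNReal.toReal_inv]
  rw [e2, ← mul_assoc, hSq, ← mul_assoc, mul_assoc (_ * -_), mul_inv_cancel₀ hPS, mul_one]
  exact hmain

end IsMAP

end Rates

end MAP

end

/-! ### Moment matrices as exponentials of the matrix exponent. -/

noncomputable section

namespace MAP

section MatrixOfReal

variable {E : Type*} [Fintype E] [DecidableEq E]

theorem map_ofReal_pow {X : Matrix E E ℝ} (hX : ∀ i j, 0 ≤ X i j) (n : ℕ) :
    (X.map ENNReal.ofReal) ^ n = (X ^ n).map ENNReal.ofReal := by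
  induction n with
  | zero =>
    ext i j
    simp only [pow_zero, Matrix.map_apply, Matrix.one_apply]
    split_ifs <;> simp
  | succ n ih =>
    ext i j
    rw [pow_succ, ih, pow_succ, Matrix.mul_apply, Matrix.map_apply, Matrix.mul_apply,
      ENNReal.ofReal_sum_of_nonneg fun k _ => mul_nonneg (matrix_pow_nonneg hX n i k) (hX k j)]
    refine Finset.sum_congr rfl fun k _ => ?_
    rw [Matrix.map_apply, Matrix.map_apply, ENNReal.ofReal_mul (matrix_pow_nonneg hX n i k)]

theorem matrix_pow_le_pow {A B : Matrix E E ℝ≥0∞} (h : ∀ i j, A i j ≤ B i j) (n : ℕ) (i j : E) :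
    (A ^ n) i j ≤ (B ^ n) i j := by
  induction n generalizing i j with
  | zero => simp
  | succ n ih =>
    rw [pow_succ, pow_succ, Matrix.mul_apply, Matrix.mul_apply]
    exact Finset.sum_le_sum fun k _ => mul_le_mul' (ih i k) (h k j)

end MatrixOfReal

/-- The exponential `exp (z x)` truncated at level `K`. -/
def truncExpz (z : ℝ) (K : ℕ) (x : ℝ) : ℝ≥0∞ := min (expz z x) K

theorem continuous_truncExpz (z : ℝ) (K : ℕ) : Continuous (truncExpz z K) :=
  (continuous_expz z).min continuous_const

theorem truncExpz_le (z : ℝ) (K : ℕ) (x : ℝ) : truncExpz z K x ≤ K := min_le_right _ _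

section Exponent

set_option linter.unusedSectionVars false

variable {Ω E : Type*} {m : MeasurableSpace Ω}
  [Fintype E] [DecidableEq E] [MeasurableSpace E] [DiscreteMeasurableSpace E]
  {𝒢 : Filtration ℝ≥0 m} {P : E → Measure Ω} {ξ : ℝ≥0 → Ω → ℝ}
  {J : ℝ≥0 → Ω → E} {Q : Matrix E E ℝ}

/-- The moments over a time cell of length `h` on which `J` has no jump, or on which its endpoints
differ; in the latter case with truncation at level `K`. -/
def cellMatrix (P : E → Measure Ω) (ξ : ℝ≥0 → Ω → ℝ) (J : ℝ≥0 → Ω → E) (z : ℝ) (K : ℕ)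
    (h : ℝ≥0) : Matrix E E ℝ≥0∞ :=
  Matrix.of fun a b =>
    if a = b then stayMoment P ξ J z a h else funMoment P ξ J (truncExpz z K) h a b

/-- The path functional whose moments are the entries of `cellMatrix`. -/
def cellWeight (z : ℝ) (K : ℕ) (h : ℝ≥0) (a b : E) (x : ℝ≥0 → ℝ × E) : ℝ≥0∞ :=
  if a = b then (stayPath h a).indicator (fun x => expz z (x h).1) x
  else {x : ℝ≥0 → ℝ × E | (x h).2 = b}.indicator (fun x => truncExpz z K (x h).1) x

/-- The product of the cell weights along the first `k` cells of a grid, ending in `b`. -/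
def gridWeight (ξ : ℝ≥0 → Ω → ℝ) (J : ℝ≥0 → Ω → E) (z : ℝ) (K : ℕ) (h : ℝ≥0) :
    ℕ → E → Ω → ℝ≥0∞
  | 0, b, ω => {ω | J 0 ω = b}.indicator 1 ω
  | k + 1, b, ω => ∑ a, gridWeight ξ J z K h k a ω * cellWeight z K h a b (shiftPath ξ J (k * h) ω)

theorem measurable_cellWeight (z : ℝ) (K : ℕ) (h : ℝ≥0) (a b : E) :
    Measurable (cellWeight z K h a b) := by
  unfold cellWeight
  split_ifs
  · exact (IsMAP.measurable_path_apply _ (measurable_expz z) h).indicator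
      (measurableSet_stayPath h a)
  · exact (IsMAP.measurable_path_apply _ (continuous_truncExpz z K).measurable h).indicator
      ((_root_.measurable_snd.comp (measurable_pi_apply h)) (measurableSet_singleton b))

namespace IsMAP

theorem measurable_cellWeight_shiftPath (hM : IsMAP 𝒢 P ξ J Q) (z : ℝ) (K : ℕ) (h : ℝ≥0)
    (a b : E) (t : ℝ≥0) :
    Measurable[𝒢 (t + h)] fun ω => cellWeight z K h a b (shiftPath ξ J t ω) := by
  have hξ : Measurable[𝒢 (t + h)] fun ω => ξ (t + h) ω - ξ t ω :=
    (hM.adapted_fst (t + h)).sub (hM.measurable_fst_of_le le_self_add)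
  unfold cellWeight
  split_ifs with hab
  · have hs : MeasurableSet[𝒢 (t + h)] {ω | shiftPath ξ J t ω ∈ stayPath h a} := by
      have : {ω | shiftPath ξ J t ω ∈ stayPath h a} = ⋂ m : ℕ, ⋂ k : ℕ, ⋂ _ : k ≤ m,
          {ω | J (t + h * ((k : ℝ≥0) / m)) ω = a} := by
        ext ω; simp [stayPath, shiftPath]
      rw [this]
      refine MeasurableSet.iInter fun m => MeasurableSet.iInter fun k =>
        MeasurableSet.iInter fun hk => ?_
      refine hM.measurable_snd_of_le (add_le_add_right ?_ t) (measurableSet_singleton a)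
      exact mul_le_of_le_one_right zero_le (div_le_one_of_le₀ (by exact_mod_cast hk) zero_le)
    exact Measurable.indicator ((measurable_expz z).comp hξ) hs
  · exact Measurable.indicator ((continuous_truncExpz z K).measurable.comp hξ)
      (hM.adapted_snd (t + h) (measurableSet_singleton b))

theorem cellWeight_shiftPath_eq_zero (hM : IsMAP 𝒢 P ξ J Q) (z : ℝ) (K : ℕ) (h : ℝ≥0) (a b : E)
    (t : ℝ≥0) {ω : Ω} (hω : J (t + h) ω ≠ b) :
    cellWeight z K h a b (shiftPath ξ J t ω) = 0 := by
  unfold cellWeight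
  split_ifs with hab
  · subst hab
    refine indicator_of_notMem (fun h' => hω ?_) _
    exact (hM.shiftPath_mem_stayPath t h a ω).1 h' h le_rfl
  · exact indicator_of_notMem (show shiftPath ξ J t ω ∉ {x : ℝ≥0 → ℝ × E | (x h).2 = b} from hω) _

theorem lintegral_cellWeight (hM : IsMAP 𝒢 P ξ J Q) (z : ℝ) (K : ℕ) (h : ℝ≥0) (a b : E) :
    ∫⁻ ω, cellWeight z K h a b (fun s => (ξ s ω, J s ω)) ∂(P a) = cellMatrix P ξ J z K h a b := by
  simp only [cellWeight, cellMatrix, Matrix.of_apply]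
  split_ifs with hab
  · rw [stayMoment, ← lintegral_indicator (𝒢.le h _ (hM.measurableSet_stay h a))]
    refine lintegral_congr fun ω => ?_
    by_cases h' : ω ∈ stay J h a
    · rw [indicator_of_mem h', indicator_of_mem ((hM.path_mem_stayPath h a ω).2 h')]
    · rw [indicator_of_notMem h',
        indicator_of_notMem (fun h'' => h' ((hM.path_mem_stayPath h a ω).1 h''))]
  · have hm : MeasurableSet {ω | J h ω = b} := hM.measurable_snd h (measurableSet_singleton b)
    rw [funMoment, Matrix.of_apply, ← lintegral_indicator hm]
    rfl

theorem measurable_gridWeight (hM : IsMAP 𝒢 P ξ J Q) (z : ℝ) (K : ℕ) (h : ℝ≥0) (k : ℕ) (b : E) :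
    Measurable[𝒢 (k * h)] (gridWeight ξ J z K h k b) := by
  induction k generalizing b with
  | zero =>
    have hb : MeasurableSet[𝒢 (((0 : ℕ) : ℝ≥0) * h)] {ω | J 0 ω = b} :=
      hM.measurable_snd_of_le zero_le (measurableSet_singleton b)
    exact Measurable.indicator (m := 𝒢 (((0 : ℕ) : ℝ≥0) * h)) measurable_const hb
  | succ k ih =>
    have e : ((k + 1 : ℕ) : ℝ≥0) * h = k * h + h := by push_cast; ring
    rw [e]
    refine Finset.measurable_sum _ fun a _ => ?_
    exact ((ih a).mono (𝒢.mono le_self_add) le_rfl).mul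
      (hM.measurable_cellWeight_shiftPath z K h a b (k * h))

theorem gridWeight_eq_zero (hM : IsMAP 𝒢 P ξ J Q) (z : ℝ) (K : ℕ) (h : ℝ≥0) (k : ℕ) (b : E)
    {ω : Ω} (hω : J (k * h) ω ≠ b) : gridWeight ξ J z K h k b ω = 0 := by
  cases k with
  | zero =>
    rw [Nat.cast_zero, zero_mul] at hω
    exact indicator_of_notMem (show ω ∉ {ω | J 0 ω = b} from hω) _
  | succ k =>
    have e : ((k + 1 : ℕ) : ℝ≥0) * h = k * h + h := by push_cast; ring
    rw [e] at hω
    refine Finset.sum_eq_zero fun a _ => ?_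
    rw [hM.cellWeight_shiftPath_eq_zero z K h a b _ hω, mul_zero]

/-- The weight of the first k cells ending in a vanishes unless J is in a at time k h, so the Markov
property splits off the last cell as one matrix factor. -/
theorem lintegral_gridWeight (hM : IsMAP 𝒢 P ξ J Q) (z : ℝ) (K : ℕ) (h : ℝ≥0) (k : ℕ) (i b : E) :
    ∫⁻ ω, gridWeight ξ J z K h k b ω ∂(P i) = (cellMatrix P ξ J z K h ^ k) i b := by
  induction k generalizing b with
  | zero =>
    have h0 := congrFun (congrFun (hM.funMoment_zero (0 : ℝ)) i) b
    have hm : MeasurableSet {ω | J 0 ω = b} := hM.measurable_snd 0 (measurableSet_singleton b)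
    simp only [funMoment, Matrix.of_apply, expz_zero_left] at h0
    rw [pow_zero, ← h0, ← lintegral_indicator hm]
    rfl
  | succ k ih =>
    simp only [gridWeight]
    rw [lintegral_finsetSum, pow_succ, Matrix.mul_apply]
    · refine Finset.sum_congr rfl fun a _ => ?_
      rw [hM.lintegral_mul_shiftPath_of_support i a (hM.measurable_gridWeight z K h k a)
        (fun ω hω => hM.gridWeight_eq_zero z K h k a hω) (measurable_cellWeight z K h a b), ih,
        hM.lintegral_cellWeight]
    · exact fun a _ => ((hM.measurable_gridWeight z K h k a).mono (𝒢.le _) le_rfl).mul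
        ((measurable_cellWeight z K h a b).comp (hM.measurable_shiftPath _))

/-- In the sum over intermediate states only the term following the actual path is kept; under the
assumptions its cell weights are not reduced by the stay condition or the truncation. -/
theorem expz_le_gridWeight (hM : IsMAP 𝒢 P ξ J Q) {z : ℝ} {K : ℕ} {h : ℝ≥0} {n : ℕ} {ω : Ω}
    (hstay : ∀ l < n, J (l * h) ω = J (l * h + h) ω → ∀ u ≤ h, J (l * h + u) ω = J (l * h) ω)
    (hK : ∀ l < n, expz z (ξ (l * h + h) ω - ξ (l * h) ω) ≤ K) (k : ℕ) (hk : k ≤ n) :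
    expz z (ξ (k * h) ω - ξ 0 ω) ≤ gridWeight ξ J z K h k (J (k * h) ω) ω := by
  induction k with
  | zero => simp [gridWeight, expz_zero_right]
  | succ k ih =>
    have e : ((k + 1 : ℕ) : ℝ≥0) * h = k * h + h := by push_cast; ring
    rw [e]
    have h1 : expz z (ξ (k * h + h) ω - ξ 0 ω) =
        expz z (ξ (k * h) ω - ξ 0 ω) * expz z (ξ (k * h + h) ω - ξ (k * h) ω) := by
      rw [← expz_add]; congr 1; ring
    have h2 : expz z (ξ (k * h + h) ω - ξ (k * h) ω) ≤
        cellWeight z K h (J (k * h) ω) (J (k * h + h) ω) (shiftPath ξ J (k * h) ω) := by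
      unfold cellWeight
      split_ifs with hab
      · rw [indicator_of_mem]
        · rfl
        · exact (hM.shiftPath_mem_stayPath _ _ _ _).2 (hstay k hk hab)
      · rw [indicator_of_mem (show shiftPath ξ J (k * h) ω ∈
          {x : ℝ≥0 → ℝ × E | (x h).2 = J (k * h + h) ω} from rfl)]
        exact le_min le_rfl (hK k hk)
    rw [h1]
    calc _ ≤ gridWeight ξ J z K h k (J (k * h) ω) ω *
          cellWeight z K h (J (k * h) ω) (J (k * h + h) ω) (shiftPath ξ J (k * h) ω) :=
        mul_le_mul' (ih (Nat.le_of_succ_le hk)) h2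
      _ ≤ _ := Finset.single_le_sum (f := fun a => gridWeight ξ J z K h k a ω *
          cellWeight z K h a (J (k * h + h) ω) (shiftPath ξ J (k * h) ω))
          (fun _ _ => zero_le) (Finset.mem_univ (J (k * h) ω))

theorem eventually_expz_le_gridWeight (hM : IsMAP 𝒢 P ξ J Q) (z : ℝ) (t : ℝ≥0) (ω : Ω) :
    ∀ᶠ K : ℕ in atTop, ∀ᶠ n : ℕ in atTop,
      expz z (ξ t ω - ξ 0 ω) ≤ gridWeight ξ J z K (t / n) n (J t ω) ω := by
  obtain ⟨C, hC0, hC⟩ := (hM.cadlag_fst ω).exists_bound t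
  obtain ⟨δ, hδ, hmesh⟩ := (hM.cadlag_snd ω).exists_mesh t
  -- Increments of a path bounded by C are at most 2C in modulus, so truncation at this level has no
  -- effect on it, whatever the mesh.
  obtain ⟨K₀, hK₀⟩ := ENNReal.exists_nat_gt (r := expz |z| (2 * C)) (expz_ne_top _ _)
  filter_upwards [eventually_ge_atTop K₀] with K hK
  have hlim := (NNReal.tendsto_coe.2 (tendsto_div_natCast t)).eventually
    (gt_mem_nhds (show ((0 : ℝ≥0) : ℝ) < δ from hδ))
  filter_upwards [hlim, eventually_gt_atTop 0] with n hn hn0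
  have hn' : (0 : ℝ≥0) < n := by exact_mod_cast hn0
  have e : (n : ℝ≥0) * (t / n) = t := mul_div_cancel₀ _ hn'.ne'
  have hle : ∀ l < n, (l : ℝ≥0) * (t / n) + t / n ≤ t := by
    intro l hl
    calc (l : ℝ≥0) * (t / n) + t / n = ((l + 1 : ℕ) : ℝ≥0) * (t / n) := by push_cast; ring
      _ ≤ n * (t / n) := by gcongr; exact hl
      _ = t := e
  have key := hM.expz_le_gridWeight (z := z) (K := K) (h := t / n) (n := n) (ω := ω) ?_ ?_ n le_rfl
  · rwa [e] at key
  · intro l hl hJ u hu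
    refine hmesh (l * (t / n)) (l * (t / n) + t / n) le_self_add (hle l hl) ?_ hJ _
      ⟨le_self_add, add_le_add_right hu _⟩
    rw [NNReal.coe_add, add_sub_cancel_left]
    exact hn
  · intro l hl
    refine le_trans (ENNReal.ofReal_le_ofReal (Real.exp_le_exp.2 ?_))
      (hK₀.le.trans (by exact_mod_cast hK))
    have h1 := hC _ (hle l hl)
    have h2 := hC _ (le_self_add.trans (hle l hl))
    calc z * (ξ (l * (t / n) + t / n) ω - ξ (l * (t / n)) ω)
        ≤ |z * (ξ (l * (t / n) + t / n) ω - ξ (l * (t / n)) ω)| := le_abs_self _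
      _ = |z| * |ξ (l * (t / n) + t / n) ω - ξ (l * (t / n)) ω| := abs_mul _ _
      _ ≤ |z| * (2 * C) := by
        refine mul_le_mul_of_nonneg_left ((abs_sub _ _).trans ?_) (abs_nonneg _)
        linarith

/-- Each path is eventually dominated by its grid weight, first with K large and then n large;
Fatou's lemma is applied once for each limit. -/
theorem funMoment_le_liminf (hM : IsMAP 𝒢 P ξ J Q) (z : ℝ) (t : ℝ≥0) (i j : E) :
    funMoment P ξ J (expz z) t i j ≤
      liminf (fun K : ℕ => liminf (fun n : ℕ => (cellMatrix P ξ J z K (t / n) ^ n) i j) atTop)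
        atTop := by
  have hm : MeasurableSet {ω | J t ω = j} := hM.measurable_snd t (measurableSet_singleton j)
  have hW : ∀ K n : ℕ, Measurable (gridWeight ξ J z K (t / n) n j) := fun K n =>
    (hM.measurable_gridWeight z K (t / n) n j).mono (𝒢.le _) le_rfl
  calc funMoment P ξ J (expz z) t i j
      ≤ ∫⁻ ω, liminf (fun K : ℕ => liminf (fun n : ℕ => gridWeight ξ J z K (t / n) n j ω) atTop)
          atTop ∂(P i) := by
        rw [funMoment, Matrix.of_apply, ← lintegral_indicator hm]
        refine lintegral_mono_ae ?_
        filter_upwards [hM.start i] with ω hω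
        by_cases hj : J t ω = j
        · rw [indicator_of_mem (show ω ∈ {ω | J t ω = j} from hj)]
          refine le_liminf_of_le (by isBoundedDefault) ?_
          filter_upwards [hM.eventually_expz_le_gridWeight z t ω] with K hK
          refine le_liminf_of_le (by isBoundedDefault) ?_
          filter_upwards [hK] with n hn
          rwa [hω.1, sub_zero, hj] at hn
        · rw [indicator_of_notMem (show ω ∉ {ω | J t ω = j} from hj)]
          exact zero_le
    _ ≤ liminf (fun K : ℕ => ∫⁻ ω, liminf (fun n : ℕ => gridWeight ξ J z K (t / n) n j ω) atTop
          ∂(P i)) atTop := lintegral_liminf_le fun K => Measurable.liminf fun n => hW K n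
    _ ≤ liminf (fun K : ℕ => liminf (fun n : ℕ => ∫⁻ ω, gridWeight ξ J z K (t / n) n j ω ∂(P i))
          atTop) atTop := by
        refine liminf_le_liminf (Eventually.of_forall fun K => ?_)
        exact lintegral_liminf_le fun n => hW K n
    _ = _ := by simp only [hM.lintegral_gridWeight]

theorem cellMatrix_le (z : ℝ) (K : ℕ) (h : ℝ≥0) (i j : E) :
    cellMatrix P ξ J z K h i j ≤ funMoment P ξ J (expz z) h i j := by
  simp only [cellMatrix, Matrix.of_apply]
  split_ifs with hij
  · subst hij
    exact lintegral_mono_set fun ω hω => hω h le_rfl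
  · exact lintegral_mono fun ω => min_le_left _ _

/-- The cell matrix is differentiable at h = 0: the diagonal is exponential by assumption, and off
the diagonal truncation makes the function bounded, as the first-jump limit requires. -/
theorem tendsto_cellMatrix_pow (hM : IsMAP 𝒢 P ξ J Q) (z : ℝ) {c : E → ℝ}
    (hc : ∀ i (t : ℝ≥0), stayMoment P ξ J z i t = ENNReal.ofReal (Real.exp (c i * t))) (K : ℕ)
    {t : ℝ≥0} (ht : 0 < t) (i j : E) :
    Tendsto (fun n : ℕ => (cellMatrix P ξ J z K (t / n) ^ n) i j) atTop
      (𝓝 (ENNReal.ofReal (NormedSpace.exp ((t : ℝ) • Matrix.of fun i j => if i = j then c i else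
        Q i j * (∫⁻ ω, truncExpz z K (jumpAtFirst ξ J ω)
          ∂(transitionLaw P J i j)).toReal) i j))) := by
  have : Nonempty E := ⟨i⟩
  set C : ℝ≥0 → Matrix E E ℝ := fun h => Matrix.of fun a b =>
    if a = b then Real.exp (c a * h) else (funMoment P ξ J (truncExpz z K) h a b).toReal with hC
  have hC0 : ∀ h a b, 0 ≤ C h a b := by
    intro h a b
    simp only [hC, Matrix.of_apply]
    split_ifs
    · exact (Real.exp_pos _).le
    · exact ENNReal.toReal_nonneg
  have hCe : ∀ h, cellMatrix P ξ J z K h = (C h).map ENNReal.ofReal := by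
    intro h
    ext a b
    simp only [cellMatrix, hC, Matrix.of_apply, Matrix.map_apply]
    split_ifs with hab
    · rw [hc]
    · rw [ENNReal.ofReal_toReal]
      have := hM.prob a
      refine ne_top_of_le_ne_top (ENNReal.mul_ne_top (ENNReal.natCast_ne_top K)
        (measure_ne_top (P a) {ω | J h ω = b})) ?_
      rw [funMoment, Matrix.of_apply, ← setLIntegral_const]
      exact lintegral_mono fun ω => truncExpz_le _ _ _
  have hpow : ∀ n : ℕ, (cellMatrix P ξ J z K (t / n) ^ n) i j =
      ENNReal.ofReal ((C (t / n) ^ n) i j) := by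
    intro n
    rw [hCe, map_ofReal_pow (hC0 _), Matrix.map_apply]
  simp only [hpow]
  refine (ENNReal.continuous_ofReal.tendsto _).comp (tendsto_matrix_pow_exp (fun a b => ?_) i j)
  by_cases hab : a = b
  · subst hab
    simp only [hC, Matrix.of_apply, if_true, Matrix.smul_apply, smul_eq_mul, Matrix.one_apply_eq]
    have hd : HasDerivAt (fun x : ℝ => Real.exp (c a * x)) (c a) 0 := by
      simpa using ((hasDerivAt_id (0 : ℝ)).const_mul (c a)).exp
    have h2 := (hd.tendsto_slope_zero.comp (tendsto_div_natCast_nhdsNE ht)).const_mul (t : ℝ)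
    refine h2.congr' ?_
    filter_upwards [eventually_gt_atTop 0] with n hn
    have h1 : (n : ℝ) ≠ 0 := by exact_mod_cast hn.ne'
    have h2 : (t : ℝ) ≠ 0 := by exact_mod_cast ht.ne'
    simp only [Function.comp_apply, NNReal.coe_div, NNReal.coe_natCast, zero_add, mul_zero,
      Real.exp_zero, smul_eq_mul]
    field_simp
  · simp only [hC, Matrix.of_apply, if_neg hab, Matrix.smul_apply, smul_eq_mul,
      Matrix.one_apply_ne hab, sub_zero]
    exact hM.tendsto_funMoment_ne hab (continuous_truncExpz z K) (ENNReal.natCast_ne_top K)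
      (truncExpz_le z K) ht

/-- The upper bound comes from Fatou's lemma. For the lower bound, the cell matrix lies entrywise
below the moment matrix, whose n-th power at t/n is the moment matrix at t. Both bounds meet as K
tends to infinity, by monotone convergence of the jump transforms. -/
theorem funMoment_eq_exp (hM : IsMAP 𝒢 P ξ J Q) (z : ℝ) {c : E → ℝ}
    (hc : ∀ i (t : ℝ≥0), stayMoment P ξ J z i t = ENNReal.ofReal (Real.exp (c i * t)))
    {g : E → E → ℝ} (hg0 : ∀ i j, 0 ≤ g i j)
    (hmeas : ∀ i j, i ≠ j → Q i j ≠ 0 →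
      AEMeasurable (fun ω => expz z (jumpAtFirst ξ J ω)) (transitionLaw P J i j))
    (hg : ∀ i j, i ≠ j → Q i j ≠ 0 →
      ∫⁻ ω, expz z (jumpAtFirst ξ J ω) ∂(transitionLaw P J i j) = ENNReal.ofReal (g i j))
    (t : ℝ≥0) (i j : E) :
    funMoment P ξ J (expz z) t i j = ENNReal.ofReal (NormedSpace.exp
      ((t : ℝ) • Matrix.of fun i j => if i = j then c i else Q i j * g i j) i j) := by
  rcases eq_or_lt_of_le (zero_le (a := t)) with ht | ht
  · subst ht
    rw [hM.funMoment_zero, NNReal.coe_zero, zero_smul, NormedSpace.exp_zero, Matrix.one_apply,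
      Matrix.one_apply]
    split_ifs <;> simp
  have hlim : Tendsto (fun K : ℕ => ENNReal.ofReal (NormedSpace.exp ((t : ℝ) • Matrix.of fun i j =>
      if i = j then c i else
        Q i j * (∫⁻ ω, truncExpz z K (jumpAtFirst ξ J ω) ∂(transitionLaw P J i j)).toReal) i j))
      atTop (𝓝 (ENNReal.ofReal (NormedSpace.exp
        ((t : ℝ) • Matrix.of fun i j => if i = j then c i else Q i j * g i j) i j))) := by
    refine (ENNReal.continuous_ofReal.tendsto _).comp ?_
    have hcont : Continuous fun X : Matrix E E ℝ => NormedSpace.exp ((t : ℝ) • X) i j :=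
      (continuous_apply j).comp ((continuous_apply i).comp
        (continuous_matrix_exp.comp (continuous_const_smul (t : ℝ))))
    refine (hcont.tendsto _).comp ?_
    refine tendsto_pi_nhds.2 fun a => tendsto_pi_nhds.2 fun b => ?_
    simp only [Matrix.of_apply]
    split_ifs with hab
    · exact tendsto_const_nhds
    · by_cases hq : Q a b = 0
      · simp only [hq, zero_mul]
        exact tendsto_const_nhds
      · refine Tendsto.const_mul _ ?_
        have h1 : Tendsto (fun K : ℕ => ∫⁻ ω, truncExpz z K (jumpAtFirst ξ J ω)
            ∂(transitionLaw P J a b)) atTop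
            (𝓝 (∫⁻ ω, expz z (jumpAtFirst ξ J ω) ∂(transitionLaw P J a b))) := by
          refine lintegral_tendsto_of_tendsto_of_monotone
            (fun K => (hmeas a b hab hq).min aemeasurable_const)
            (Eventually.of_forall fun ω K L hKL => min_le_min le_rfl (by exact_mod_cast hKL))
            (Eventually.of_forall fun ω => ?_)
          obtain ⟨K₀, hK₀⟩ := ENNReal.exists_nat_gt (expz_ne_top z (jumpAtFirst ξ J ω))
          refine tendsto_const_nhds.congr' ?_
          filter_upwards [eventually_ge_atTop K₀] with K hK
          exact (min_eq_left (hK₀.le.trans (by exact_mod_cast hK))).symm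
        rw [hg a b hab hq] at h1
        have h2 := (ENNReal.tendsto_toReal ENNReal.ofReal_ne_top).comp h1
        rwa [ENNReal.toReal_ofReal (hg0 a b)] at h2
  refine le_antisymm ?_ ?_
  · refine (hM.funMoment_le_liminf z t i j).trans ?_
    simp only [fun K => (hM.tendsto_cellMatrix_pow z hc K ht i j).liminf_eq]
    exact hlim.liminf_eq.le
  · refine le_of_tendsto' hlim fun K => ?_
    refine le_of_tendsto (hM.tendsto_cellMatrix_pow z hc K ht i j) ?_
    filter_upwards [eventually_gt_atTop 0] with n hn
    have hn' : (0 : ℝ≥0) < n := by exact_mod_cast hn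
    have e : (n : ℝ≥0) * (t / n) = t := mul_div_cancel₀ _ hn'.ne'
    conv_rhs => rw [← e, hM.funMoment_nsmul]
    exact matrix_pow_le_pow (fun a b => cellMatrix_le z K _ a b) n i j

/-- The rate q_ij is obtained both from the transition function and from the first-jump limit for f
= 1; cancelling it leaves total mass 1. -/
theorem lintegral_one_transitionLaw (hM : IsMAP 𝒢 P ξ J Q) {i j : E} (hij : i ≠ j)
    (hq : Q i j ≠ 0) : ∫⁻ _, 1 ∂(transitionLaw P J i j) = 1 := by
  have h1 := hM.tendsto_funMoment_ne hij (f := fun _ => 1) continuous_const ENNReal.one_ne_top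
    (fun _ => le_rfl) one_pos
  have h2 := tendsto_natCast_mul_matrix_exp_sub_one Q one_pos i j
  have e : ∀ s : ℝ≥0, (funMoment P ξ J (fun _ => 1) s i j).toReal =
      NormedSpace.exp ((s : ℝ) • Q) i j - (1 : Matrix E E ℝ) i j := by
    intro s
    rw [Matrix.one_apply_ne hij, sub_zero, ← hM.transition]
    simp [funMoment, Measure.real]
  simp only [e] at h1
  have h3 := tendsto_nhds_unique h2 h1
  rw [NNReal.coe_one, one_mul, one_mul] at h3
  have h4 := mul_left_cancel₀ hq ((mul_one _).trans h3)
  exact ((ENNReal.toReal_eq_one_iff _).1 h4.symm)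

/-- Holding times are not part of the data. At z = 0 the exponential formula holds with unknown
holding exponents on the diagonal, while the moments are the known transition function; injectivity
of the exponential semigroup then gives c_i = q_ii. -/
theorem measure_stay_one (hM : IsMAP 𝒢 P ξ J Q) (i : E) :
    P i (stay J 1 i) = ENNReal.ofReal (Real.exp (Q i i)) := by
  have hst : ∀ i t, stayMoment P ξ J 0 i t = P i (stay J t i) := by
    intro i t
    simp [stayMoment, expz_zero_left]
  have hex : ∀ i, ∃ c : ℝ, ∀ t : ℝ≥0,
      stayMoment P ξ J 0 i t = ENNReal.ofReal (Real.exp (c * t)) := by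
    intro i
    have := hM.prob i
    exact hM.exists_stayMoment_eq 0 i (by rw [hst]; exact measure_ne_top _ _)
  choose c hc using hex
  have key := hM.funMoment_eq_exp 0 hc (g := fun _ _ => 1) (fun _ _ => zero_le_one)
    (fun i j _ _ => by simp only [expz_zero_left]; exact aemeasurable_const)
    (fun i j hij hq => by
      simp only [expz_zero_left, ENNReal.ofReal_one]
      exact hM.lintegral_one_transitionLaw hij hq)
  set X : Matrix E E ℝ := Matrix.of fun i j => if i = j then c i else Q i j * 1 with hX
  have hXnn : ∀ i j, i ≠ j → 0 ≤ X i j := by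
    intro i j hij
    simpa [hX, hij] using hM.rate_nonneg hij
  have hQX : Q = X := by
    refine matrix_exp_injective fun t => ?_
    ext a b
    have h1 := key t a b
    rw [hM.funMoment_expz_zero] at h1
    have h2 : 0 ≤ NormedSpace.exp ((t : ℝ) • Q) a b := by
      rw [← hM.transition]; exact measureReal_nonneg
    have h3 : 0 ≤ NormedSpace.exp ((t : ℝ) • X) a b :=
      matrix_exp_nonneg (fun i j hij => mul_nonneg t.2 (hXnn i j hij)) a b
    exact (ENNReal.ofReal_eq_ofReal_iff h2 h3).1 h1
  have hcQ : c i = Q i i := by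
    have := congrFun (congrFun hQX i) i
    simpa [hX] using this.symm
  rw [← hst, hc, NNReal.coe_one, mul_one, hcQ]

theorem offDiag_nonneg_of_exists (hM : IsMAP 𝒢 P ξ J Q) (z : ℝ) {i j : E} (hij : i ≠ j) :
    0 ≤ matrixExponent P ξ J Q z i j := by
  simp only [matrixExponent, Matrix.add_apply, Matrix.diagonal_apply_ne _ hij, zero_add,
    Matrix.hadamard_apply, jumpTransform, Matrix.of_apply]
  refine mul_nonneg (hM.rate_nonneg hij) ?_
  split_ifs
  · exact zero_le_one
  · exact mgf_nonneg

theorem isProbabilityMeasure_transitionLaw (hM : IsMAP 𝒢 P ξ J Q) {i j : E} (hij : i ≠ j)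
    (hq : Q i j ≠ 0) : IsProbabilityMeasure (transitionLaw P J i j) :=
  ⟨by simpa using hM.lintegral_one_transitionLaw hij hq⟩

theorem isIrreducibleRate_matrixExponent (hM : IsMAP 𝒢 P ξ J Q) (hirr : IsIrreducibleRate Q)
    {z : ℝ} (hz : MatrixExponentExists P ξ J Q z) :
    IsIrreducibleRate (matrixExponent P ξ J Q z) := by
  intro i j
  have key : ∀ a b, a ≠ b → 0 < Q a b → 0 < matrixExponent P ξ J Q z a b := by
    intro a b hab hq
    have := hM.isProbabilityMeasure_transitionLaw hab hq.ne'
    simp only [matrixExponent, Matrix.add_apply, Matrix.diagonal_apply_ne _ hab, zero_add,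
      Matrix.hadamard_apply, jumpTransform, Matrix.of_apply, hab, hq.ne', or_self, if_false]
    exact mul_pos hq (mgf_pos (hz.2 a b hab hq.ne'))
  induction hirr i j with
  | refl => exact Relation.ReflTransGen.refl
  | @tail b c _ hbc ih =>
    by_cases h : b = c
    · exact h ▸ ih
    · exact ih.tail (key b c h hbc)

/-- The moments of a Markov additive process are given by the exponential of its matrix
exponent. -/
theorem funMoment_eq_exp_matrixExponent (hM : IsMAP 𝒢 P ξ J Q) {z : ℝ}
    (hz : MatrixExponentExists P ξ J Q z) (t : ℝ≥0) (i j : E) :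
    funMoment P ξ J (expz z) t i j =
      ENNReal.ofReal (NormedSpace.exp ((t : ℝ) • matrixExponent P ξ J Q z) i j) := by
  have hlev : ∀ i, ∫⁻ ω, expz z (ξ 1 ω) ∂(levyLaw P J i) =
      ENNReal.ofReal (mgf (ξ 1) (levyLaw P J i) z) := fun i =>
    (ofReal_integral_eq_lintegral_ofReal (hz.1 i)
      (Eventually.of_forall fun _ => (Real.exp_pos _).le)).symm
  have hPpos : ∀ i, P i (stay J 1 i) ≠ 0 := by
    intro i
    rw [hM.measure_stay_one]
    simpa using Real.exp_pos _
  have hst : ∀ i, stayMoment P ξ J z i 1 =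
      ENNReal.ofReal (Real.exp (Q i i) * mgf (ξ 1) (levyLaw P J i) z) := by
    intro i
    have := hM.prob i
    rw [ENNReal.ofReal_mul (Real.exp_pos _).le, ← hlev, ← hM.measure_stay_one, levyLaw,
      ProbabilityTheory.cond, lintegral_smul_measure, smul_eq_mul, ← mul_assoc]
    change _ = P i (stay J 1 i) * (P i (stay J 1 i))⁻¹ * stayMoment P ξ J z i 1
    rw [ENNReal.mul_inv_cancel (hPpos i) (measure_ne_top _ _), one_mul]
  have hex : ∀ i, ∃ c : ℝ, ∀ t : ℝ≥0,
      stayMoment P ξ J z i t = ENNReal.ofReal (Real.exp (c * t)) := fun i =>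
    hM.exists_stayMoment_eq z i (by rw [hst]; exact ENNReal.ofReal_ne_top)
  choose c hc using hex
  -- The Lévy law is conditioned on an event of probability exp(q_ii), which accounts for the
  -- summand q_ii.
  have hcv : ∀ i, c i = Q i i + cgf (ξ 1) (levyLaw P J i) z := by
    intro i
    have := hM.prob i
    have h1 := hst i
    have : IsProbabilityMeasure (levyLaw P J i) := cond_isProbabilityMeasure (hPpos i)
    have h2 : 0 < mgf (ξ 1) (levyLaw P J i) z := mgf_pos (hz.1 i)
    rw [hc, NNReal.coe_one, mul_one, ENNReal.ofReal_eq_ofReal_iff (Real.exp_pos _).le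
      (mul_pos (Real.exp_pos _) h2).le] at h1
    rw [cgf, ← Real.log_exp (c i), h1, Real.log_mul (Real.exp_pos _).ne' h2.ne', Real.log_exp]
  have hX : (Matrix.of fun i j => if i = j then c i else
      Q i j * mgf (jumpAtFirst ξ J) (transitionLaw P J i j) z) = matrixExponent P ξ J Q z := by
    ext a b
    simp only [Matrix.of_apply, matrixExponent, Matrix.add_apply, Matrix.hadamard_apply,
      jumpTransform]
    by_cases hab : a = b
    · subst hab
      simp only [if_true, Matrix.diagonal_apply_eq, true_or, laplaceExponent, hcv]
      ring
    · rw [if_neg hab, Matrix.diagonal_apply_ne _ hab, zero_add]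
      by_cases hq : Q a b = 0
      · simp [hq]
      · simp [hab, hq]
  rw [hM.funMoment_eq_exp z hc (g := fun i j => mgf (jumpAtFirst ξ J) (transitionLaw P J i j) z)
    (fun i j => mgf_nonneg) (fun i j hij hq => (hz.2 i j hij hq).aemeasurable.ennreal_ofReal)
    (fun i j hij hq => (ofReal_integral_eq_lintegral_ofReal (hz.2 i j hij hq)
      (Eventually.of_forall fun _ => (Real.exp_pos _).le)).symm), hX]

end IsMAP

end Exponent

end MAP

end

/-! ### Jensen's inequality, the harmonic vector and geometric decay. -/

noncomputable section

namespace MAP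

/-- Jensen's inequality for powers with exponent in `(0, 1)`, with its equality case. -/
theorem integral_rpow_le_one {Ω : Type*} {m : MeasurableSpace Ω} {μ : Measure Ω}
    [IsProbabilityMeasure μ] {Y : Ω → ℝ} (hY : ∀ ω, 0 ≤ Y ω) (hm : Measurable Y)
    (hint : Integrable Y μ) (h1 : ∫ ω, Y ω ∂μ = 1) {q : ℝ} (hq : q ∈ Ioo (0 : ℝ) 1) :
    Integrable (fun ω => Y ω ^ q) μ ∧ ∫ ω, Y ω ^ q ∂μ ≤ 1 ∧
      (∫ ω, Y ω ^ q ∂μ = 1 → ∀ᵐ ω ∂μ, Y ω = 1) := by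
  -- The tangent line at 1 of the concave power. It is strictly above away from 1, which gives the
  -- equality case.
  have hle : ∀ ω, Y ω ^ q ≤ 1 + q * (Y ω - 1) := by
    intro ω
    have := rpow_one_add_le_one_add_mul_self (s := Y ω - 1) (by linarith [hY ω]) hq.1.le hq.2.le
    simpa using this
  have hint2 : Integrable (fun ω => 1 + q * (Y ω - 1)) μ :=
    (integrable_const 1).add ((hint.sub (integrable_const 1)).const_mul q)
  have hval : ∫ ω, (1 + q * (Y ω - 1)) ∂μ = 1 := by
    have hi : Integrable (fun ω => q * (Y ω - 1)) μ := (hint.sub (integrable_const 1)).const_mul q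
    rw [integral_add (integrable_const 1) hi, integral_const_mul,
      integral_sub hint (integrable_const 1), h1]
    simp
  have hintq : Integrable (fun ω => Y ω ^ q) μ := by
    refine hint2.mono' (hm.pow_const q).aestronglyMeasurable (Eventually.of_forall fun ω => ?_)
    rw [Real.norm_of_nonneg (Real.rpow_nonneg (hY ω) q)]
    exact hle ω
  refine ⟨hintq, hval ▸ integral_mono hintq hint2 hle, fun heq => ?_⟩
  have h0 : ∫ ω, (1 + q * (Y ω - 1) - Y ω ^ q) ∂μ = 0 := by
    rw [integral_sub hint2 hintq, hval, heq, sub_self]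
  rw [integral_eq_zero_iff_of_nonneg (fun ω => sub_nonneg.2 (hle ω)) (hint2.sub hintq)] at h0
  filter_upwards [h0] with ω hω
  by_contra hne
  have := rpow_one_add_lt_one_add_mul_self (s := Y ω - 1) (by linarith [hY ω])
    (sub_ne_zero.2 hne) hq.1 hq.2
  rw [add_sub_cancel] at this
  have h2 : 1 + q * (Y ω - 1) - Y ω ^ q = 0 := hω
  linarith

section Decay

set_option linter.unusedSectionVars false

variable {Ω E : Type*} {m : MeasurableSpace Ω}
  [Fintype E] [DecidableEq E] [MeasurableSpace E] [DiscreteMeasurableSpace E]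
  {𝒢 : Filtration ℝ≥0 m} {P : E → Measure Ω} {ξ : ℝ≥0 → Ω → ℝ}
  {J : ℝ≥0 → Ω → E} {Q : Matrix E E ℝ}

namespace IsMAP

theorem lintegral_mul_state (hM : IsMAP 𝒢 P ξ J Q) (i : E) (t : ℝ≥0) {X : Ω → ℝ≥0∞}
    (hX : Measurable X) (w : E → ℝ≥0∞) :
    ∫⁻ ω, X ω * w (J t ω) ∂(P i) = ∑ j, (∫⁻ ω in {ω | J t ω = j}, X ω ∂(P i)) * w j := by
  have hm : ∀ j, MeasurableSet {ω | J t ω = j} := fun j =>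
    hM.measurable_snd t (measurableSet_singleton j)
  have hsum : ∀ ω, X ω * w (J t ω) = ∑ j, {ω | J t ω = j}.indicator X ω * w j := by
    intro ω
    rw [Finset.sum_eq_single (J t ω), indicator_of_mem (show ω ∈ {ω' | J t ω' = J t ω} from rfl)]
    · intro j _ hj
      rw [indicator_of_notMem (show ω ∉ {ω | J t ω = j} from fun h => hj h.symm), zero_mul]
    · simp
  rw [lintegral_congr hsum, lintegral_finsetSum]
  · refine Finset.sum_congr rfl fun j _ => ?_
    rw [lintegral_mul_const _ (hX.indicator (hm j)), lintegral_indicator (hm j)]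
  · exact fun j _ => (hX.indicator (hm j)).mul_const _

theorem lintegral_expz_mul_state (hM : IsMAP 𝒢 P ξ J Q) (z : ℝ) (i : E) (t : ℝ≥0)
    (w : E → ℝ≥0∞) :
    ∫⁻ ω, expz z (ξ t ω) * w (J t ω) ∂(P i) = ∑ j, funMoment P ξ J (expz z) t i j * w j :=
  hM.lintegral_mul_state i t ((measurable_expz z).comp (hM.measurable_fst t)) w

theorem offDiag_smul_nonneg (hM : IsMAP 𝒢 P ξ J Q) (z : ℝ) (t : ℝ≥0) (i j : E) (hij : i ≠ j) :
    0 ≤ ((t : ℝ) • matrixExponent P ξ J Q z) i j :=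
  mul_nonneg t.2 (hM.offDiag_nonneg_of_exists z hij)

theorem exp_matrixExponent_nonneg (hM : IsMAP 𝒢 P ξ J Q) (z : ℝ) (t : ℝ≥0) (i j : E) :
    0 ≤ NormedSpace.exp ((t : ℝ) • matrixExponent P ξ J Q z) i j :=
  matrix_exp_nonneg (hM.offDiag_smul_nonneg z t) i j

theorem lintegral_expz_mul_state_ofReal (hM : IsMAP 𝒢 P ξ J Q) {z : ℝ}
    (hz : MatrixExponentExists P ξ J Q z) (i : E) (t : ℝ≥0) {w : E → ℝ} (hw : ∀ j, 0 ≤ w j) :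
    ∫⁻ ω, expz z (ξ t ω) * ENNReal.ofReal (w (J t ω)) ∂(P i) =
      ENNReal.ofReal ((NormedSpace.exp ((t : ℝ) • matrixExponent P ξ J Q z) *ᵥ w) i) := by
  have h := hM.lintegral_expz_mul_state z i t fun j => ENNReal.ofReal (w j)
  rw [h, Matrix.mulVec, dotProduct, ENNReal.ofReal_sum_of_nonneg fun j _ =>
    mul_nonneg (hM.exp_matrixExponent_nonneg z t i j) (hw j)]
  refine Finset.sum_congr rfl fun j _ => ?_
  rw [hM.funMoment_eq_exp_matrixExponent hz,
    ENNReal.ofReal_mul (hM.exp_matrixExponent_nonneg z t i j)]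

theorem integrable_exp_mul_state (hM : IsMAP 𝒢 P ξ J Q) {z : ℝ}
    (hz : MatrixExponentExists P ξ J Q z) (i : E) (t : ℝ≥0) {w : E → ℝ} (hw : ∀ j, 0 ≤ w j) :
    Integrable (fun ω => Real.exp (z * ξ t ω) * w (J t ω)) (P i) ∧
    ∫ ω, Real.exp (z * ξ t ω) * w (J t ω) ∂(P i) =
      (NormedSpace.exp ((t : ℝ) • matrixExponent P ξ J Q z) *ᵥ w) i := by
  have hmeas : Measurable fun ω => Real.exp (z * ξ t ω) * w (J t ω) :=
    (((hM.measurable_fst t).const_mul z).exp).mul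
      ((Measurable.of_discrete (f := w)).comp (hM.measurable_snd t))
  have hnn : ∀ ω, 0 ≤ Real.exp (z * ξ t ω) * w (J t ω) := fun ω =>
    mul_nonneg (Real.exp_pos _).le (hw _)
  have hl : ∫⁻ ω, ENNReal.ofReal (Real.exp (z * ξ t ω) * w (J t ω)) ∂(P i) =
      ENNReal.ofReal ((NormedSpace.exp ((t : ℝ) • matrixExponent P ξ J Q z) *ᵥ w) i) := by
    rw [← hM.lintegral_expz_mul_state_ofReal hz i t hw]
    refine lintegral_congr fun ω => ?_
    rw [ENNReal.ofReal_mul (Real.exp_pos _).le, expz]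
  have hR : 0 ≤ (NormedSpace.exp ((t : ℝ) • matrixExponent P ξ J Q z) *ᵥ w) i :=
    Finset.sum_nonneg fun j _ => mul_nonneg (hM.exp_matrixExponent_nonneg z t i j) (hw j)
  refine ⟨⟨hmeas.aestronglyMeasurable, ?_⟩, ?_⟩
  · rw [hasFiniteIntegral_iff_ofReal (Eventually.of_forall hnn), hl]
    exact ENNReal.ofReal_lt_top
  · rw [integral_eq_lintegral_of_nonneg_ae (Eventually.of_forall hnn) hmeas.aestronglyMeasurable,
      hl, ENNReal.toReal_ofReal hR]

/-- A positive harmonic vector for the Cramér exponent. -/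
theorem exists_harmonic (hM : IsMAP 𝒢 P ξ J Q) (hirr : IsIrreducibleRate Q) [Nonempty E] {z : ℝ}
    (hz : MatrixExponentExists P ξ J Q z)
    (hlead : leadingEigenvalue (matrixExponent P ξ J Q z) = 0) :
    ∃ h : E → ℝ, (∀ i, 0 < h i) ∧
      ∀ t : ℝ≥0, NormedSpace.exp ((t : ℝ) • matrixExponent P ξ J Q z) *ᵥ h = h := by
  obtain ⟨h, hpos, hh⟩ := exists_pos_eigenvector
    (fun i j hij => hM.offDiag_nonneg_of_exists z hij) (hM.isIrreducibleRate_matrixExponent hirr hz)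
  refine ⟨h, hpos, fun t => matrix_exp_mulVec_eq_self ?_⟩
  rw [Matrix.smul_mulVec, hh, hlead, zero_smul, smul_zero]

/-- Jensen applied to Y = exp(-θξ_t) h(J_t)/h(i), which has mean 1 under P_i, with exponent p/θ < 1.
Equality forces Y = 1 almost surely, and taking logarithms expresses ξ_t through J_t. -/
theorem exp_mulVec_rpow_le (hM : IsMAP 𝒢 P ξ J Q) {θ : ℝ} (hθ : 0 < θ)
    (hzθ : MatrixExponentExists P ξ J Q (-θ)) {h : E → ℝ} (hpos : ∀ i, 0 < h i)
    (hh : ∀ t : ℝ≥0, NormedSpace.exp ((t : ℝ) • matrixExponent P ξ J Q (-θ)) *ᵥ h = h)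
    {p : ℝ} (hp : p ∈ Ioo 0 θ) (hzp : MatrixExponentExists P ξ J Q (-p)) (i : E) (t : ℝ≥0) :
    (NormedSpace.exp ((t : ℝ) • matrixExponent P ξ J Q (-p)) *ᵥ fun j => h j ^ (p / θ)) i ≤
      h i ^ (p / θ) ∧
    ((NormedSpace.exp ((t : ℝ) • matrixExponent P ξ J Q (-p)) *ᵥ fun j => h j ^ (p / θ)) i =
      h i ^ (p / θ) → ∀ᵐ ω ∂(P i), ξ t ω = Real.log (h (J t ω)) / θ - Real.log (h i) / θ) := by
  have := hM.prob i
  set q := p / θ with hq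
  have hq01 : q ∈ Ioo (0 : ℝ) 1 := ⟨div_pos hp.1 hθ, (div_lt_one hθ).2 hp.2⟩
  set Y : Ω → ℝ := fun ω => Real.exp (-θ * ξ t ω) * h (J t ω) / h i with hYdef
  have hY0 : ∀ ω, 0 ≤ Y ω := fun ω => (div_pos (mul_pos (Real.exp_pos _) (hpos _)) (hpos i)).le
  obtain ⟨hi1, he1⟩ := hM.integrable_exp_mul_state hzθ i t fun j => (hpos j).le
  have hYm : Measurable Y := ((((hM.measurable_fst t).const_mul (-θ)).exp).mul
      ((Measurable.of_discrete (f := h)).comp (hM.measurable_snd t))).div_const _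
  have hY1 : ∫ ω, Y ω ∂(P i) = 1 := by
    simp only [hYdef]
    rw [integral_div, he1, hh t, div_self (hpos i).ne']
  obtain ⟨-, hle, heq⟩ := integral_rpow_le_one hY0 hYm (hi1.div_const _) hY1 hq01
  have hYq : ∀ ω, Real.exp (-p * ξ t ω) * h (J t ω) ^ q = h i ^ q * Y ω ^ q := by
    intro ω
    simp only [hYdef]
    rw [Real.div_rpow (mul_pos (Real.exp_pos _) (hpos _)).le (hpos i).le,
      Real.mul_rpow (Real.exp_pos _).le (hpos _).le, ← Real.exp_mul,
      mul_div_cancel₀ _ (Real.rpow_pos_of_pos (hpos i) q).ne']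
    congr 2
    rw [hq]; field_simp
  have he2 := (hM.integrable_exp_mul_state hzp i t (w := fun j => h j ^ q)
    fun j => (Real.rpow_pos_of_pos (hpos j) q).le).2
  simp only [hYq] at he2
  rw [integral_const_mul] at he2
  have hiq := Real.rpow_pos_of_pos (hpos i) q
  rw [← he2]
  refine ⟨mul_le_of_le_one_right hiq.le hle, fun h' => ?_⟩
  have h1 : ∫ ω, Y ω ^ q ∂(P i) = 1 := mul_left_cancel₀ hiq.ne' (h'.trans (mul_one _).symm)
  filter_upwards [heq h1] with ω hω
  simp only [hYdef] at hω
  rw [div_eq_one_iff_eq (hpos i).ne'] at hω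
  rw [← hω, Real.log_mul (Real.exp_pos _).ne' (hpos _).ne', Real.log_exp]
  field_simp
  ring

/-- The vector v = h^(p/θ) decreases under the semigroup, strictly at some state and time t₀ by
non-degeneracy. One more unit of time, whose matrix is positive, makes the decrease strict at every
state, hence T = 1 + t₀. The factor ρ is the largest ratio at time T, and it is iterated. -/
theorem exists_decay (hM : IsMAP 𝒢 P ξ J Q) (hirr : IsIrreducibleRate Q)
    (hnd : ¬ IsDegenerate P ξ J) {θ : ℝ} (hθ : 0 < θ)
    (hzθ : MatrixExponentExists P ξ J Q (-θ)) {h : E → ℝ} (hpos : ∀ i, 0 < h i)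
    (hh : ∀ t : ℝ≥0, NormedSpace.exp ((t : ℝ) • matrixExponent P ξ J Q (-θ)) *ᵥ h = h)
    {p : ℝ} (hp : p ∈ Ioo 0 θ) (hzp : MatrixExponentExists P ξ J Q (-p)) :
    ∃ (T : ℝ≥0) (ρ : ℝ) (v : E → ℝ), 0 < T ∧ 0 ≤ ρ ∧ ρ < 1 ∧ (∀ i, 0 < v i) ∧ ∀ (n : ℕ) (i : E),
      (NormedSpace.exp (((n * T : ℝ≥0) : ℝ) • matrixExponent P ξ J Q (-p)) *ᵥ v) i ≤
        ρ ^ n * v i := by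
  set F := matrixExponent P ξ J Q (-p) with hF
  set v : E → ℝ := fun j => h j ^ (p / θ) with hv
  have hvpos : ∀ i, 0 < v i := fun i => Real.rpow_pos_of_pos (hpos i) _
  have hle := hM.exp_mulVec_rpow_le hθ hzθ hpos hh hp hzp
  obtain ⟨i₀, t₀, hlt⟩ : ∃ i₀ t₀, (NormedSpace.exp ((t₀ : ℝ≥0) • F) *ᵥ v) i₀ < v i₀ := by
    by_contra hcon
    push Not at hcon
    -- Equality for all states and times would represent ξ by this function of the chain.
    refine hnd ⟨fun j => Real.log (h j) / θ, fun i t => ?_⟩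
    exact (hle i t).2 (le_antisymm (hle i t).1 (hcon i t))
  have hexp_nonneg := hM.exp_matrixExponent_nonneg (-p)
  have hexp_pos : ∀ i j, 0 < NormedSpace.exp F i j :=
    matrix_exp_pos (fun i j hij => hM.offDiag_nonneg_of_exists (-p) hij)
      (hM.isIrreducibleRate_matrixExponent hirr hzp)
  have hadd : ∀ s t : ℝ, NormedSpace.exp ((s + t) • F) =
      NormedSpace.exp (s • F) * NormedSpace.exp (t • F) := by
    intro s t
    rw [add_smul, Matrix.exp_add_of_commute]
    exact ((Commute.refl F).smul_left s).smul_right t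
  set T : ℝ≥0 := 1 + t₀ with hT
  have hstrict : ∀ i, (NormedSpace.exp ((T : ℝ) • F) *ᵥ v) i < v i := by
    intro i
    have e : NormedSpace.exp ((T : ℝ) • F) *ᵥ v =
        NormedSpace.exp F *ᵥ (NormedSpace.exp ((t₀ : ℝ) • F) *ᵥ v) := by
      rw [hT, NNReal.coe_add, hadd, NNReal.coe_one, one_smul, Matrix.mulVec_mulVec]
    rw [e]
    have h1 := (hle i 1).1
    rw [NNReal.coe_one, one_smul] at h1
    refine lt_of_lt_of_le ?_ h1
    refine Finset.sum_lt_sum (fun j _ => mul_le_mul_of_nonneg_left (hle j t₀).1 (hexp_pos i j).le)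
      ⟨i₀, Finset.mem_univ _, mul_lt_mul_of_pos_left hlt (hexp_pos i i₀)⟩
  have : Nonempty E := ⟨i₀⟩
  obtain ⟨i₁, hi₁⟩ := Finite.exists_max fun i => (NormedSpace.exp ((T : ℝ) • F) *ᵥ v) i / v i
  set ρ := (NormedSpace.exp ((T : ℝ) • F) *ᵥ v) i₁ / v i₁ with hρ
  have hmv : ∀ (t : ℝ≥0) (i : E), 0 ≤ (NormedSpace.exp ((t : ℝ) • F) *ᵥ v) i := fun t i =>
    Finset.sum_nonneg fun j _ => mul_nonneg (hexp_nonneg t i j) (hvpos j).le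
  have hρ0 : 0 ≤ ρ := div_nonneg (hmv T i₁) (hvpos _).le
  refine ⟨T, ρ, v, by positivity, hρ0, (div_lt_one (hvpos i₁)).2 (hstrict i₁), hvpos,
    fun n => ?_⟩
  induction n with
  | zero => intro i; simp
  | succ n ih =>
    intro i
    have e : NormedSpace.exp ((((n + 1 : ℕ) * T : ℝ≥0) : ℝ) • F) *ᵥ v =
        NormedSpace.exp (((n * T : ℝ≥0) : ℝ) • F) *ᵥ (NormedSpace.exp ((T : ℝ) • F) *ᵥ v) := by
      rw [Matrix.mulVec_mulVec, ← hadd]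
      congr 3
      push_cast; ring
    rw [e]
    calc _ ≤ (NormedSpace.exp (((n * T : ℝ≥0) : ℝ) • F) *ᵥ (ρ • v)) i := by
          refine Finset.sum_le_sum fun j _ => mul_le_mul_of_nonneg_left ?_ (hexp_nonneg _ i j)
          exact (div_le_iff₀ (hvpos j)).1 (hi₁ j)
      _ = ρ * (NormedSpace.exp (((n * T : ℝ≥0) : ℝ) • F) *ᵥ v) i := by
          rw [Matrix.mulVec_smul]; rfl
      _ ≤ ρ * (ρ ^ n * v i) := mul_le_mul_of_nonneg_left (ih i) hρ0
      _ = _ := by ring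

/-- A null vector of the exponent is fixed by the semigroup, yet it is dominated by a multiple of v,
which decays to 0. -/
theorem isUnit_of_decay (hM : IsMAP 𝒢 P ξ J Q) {z : ℝ} {T : ℝ≥0} {ρ : ℝ} {v : E → ℝ}
    (hρ0 : 0 ≤ ρ) (hρ1 : ρ < 1) (hv : ∀ i, 0 < v i)
    (hdec : ∀ (n : ℕ) (i : E),
      (NormedSpace.exp (((n * T : ℝ≥0) : ℝ) • matrixExponent P ξ J Q z) *ᵥ v) i ≤ ρ ^ n * v i) :
    IsUnit (matrixExponent P ξ J Q z) := by
  rw [Matrix.isUnit_iff_isUnit_det, isUnit_iff_ne_zero]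
  intro hdet
  obtain ⟨x, hx, hFx⟩ := Matrix.exists_mulVec_eq_zero_iff.2 hdet
  refine hx (funext fun i => ?_)
  obtain ⟨C, hC⟩ : ∃ C, ∀ j, |x j| ≤ C * v j := by
    have : Nonempty E := ⟨i⟩
    obtain ⟨j₀, hj₀⟩ := Finite.exists_max fun j => |x j| / v j
    exact ⟨_, fun j => (div_le_iff₀ (hv j)).1 (hj₀ j)⟩
  have hbound : ∀ n : ℕ, |x i| ≤ C * (ρ ^ n * v i) := by
    intro n
    have e : NormedSpace.exp (((n * T : ℝ≥0) : ℝ) • matrixExponent P ξ J Q z) *ᵥ x = x :=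
      matrix_exp_mulVec_eq_self (by rw [Matrix.smul_mulVec, hFx, smul_zero])
    have hC0 : 0 ≤ C := by
      have := (abs_nonneg _).trans (hC i)
      exact nonneg_of_mul_nonneg_left this (hv i)
    conv_lhs => rw [← e]
    calc _ ≤ ∑ j, |NormedSpace.exp (((n * T : ℝ≥0) : ℝ) • matrixExponent P ξ J Q z) i j * x j| :=
          Finset.abs_sum_le_sum_abs _ _
      _ ≤ ∑ j, NormedSpace.exp (((n * T : ℝ≥0) : ℝ) • matrixExponent P ξ J Q z) i j *
            (C * v j) := by
          refine Finset.sum_le_sum fun j _ => ?_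
          have h0 := hM.exp_matrixExponent_nonneg z (n * T) i j
          rw [abs_mul, abs_of_nonneg h0]
          exact mul_le_mul_of_nonneg_left (hC j) h0
      _ = C * (NormedSpace.exp (((n * T : ℝ≥0) : ℝ) • matrixExponent P ξ J Q z) *ᵥ v) i := by
          rw [Matrix.mulVec, dotProduct, Finset.mul_sum]
          exact Finset.sum_congr rfl fun j _ => by ring
      _ ≤ _ := mul_le_mul_of_nonneg_left (hdec n i) hC0
  have hlim : Tendsto (fun n : ℕ => C * (ρ ^ n * v i)) atTop (𝓝 0) := by
    simpa using ((tendsto_pow_atTop_nhds_zero_of_lt_one hρ0 hρ1).mul_const (v i)).const_mul C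
  have := ge_of_tendsto' hlim hbound
  exact abs_nonpos_iff.1 this

end IsMAP

end Decay

end MAP

end

/-! ### The maximal inequality and fractional moments of the exponential functional. -/

noncomputable section

namespace MAP

theorem rpow_tsum_le_tsum_rpow (f : ℕ → ℝ≥0∞) {p : ℝ} (hp0 : 0 < p) (hp1 : p ≤ 1) :
    (∑' n, f n) ^ p ≤ ∑' n, f n ^ p := by
  have hfin : ∀ n, (∑ k ∈ Finset.range n, f k) ^ p ≤ ∑ k ∈ Finset.range n, f k ^ p := by
    intro n
    induction n with
    | zero => simp [hp0]
    | succ n ih =>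
      rw [Finset.sum_range_succ, Finset.sum_range_succ]
      exact (ENNReal.rpow_add_le_add_rpow _ _ hp0.le hp1).trans (add_le_add_left ih _)
  have hlim := (ENNReal.continuous_rpow_const (y := p)).tendsto _ |>.comp
    (ENNReal.tendsto_nat_tsum f)
  exact le_of_tendsto' hlim fun n => (hfin n).trans (ENNReal.sum_le_tsum _)

/-- A weak moment bound of order `θ` gives finite moments of orders smaller than `θ`. -/
theorem lintegral_rpow_lt_top_of_weak {Ω : Type*} {m : MeasurableSpace Ω} {μ : Measure Ω}
    [IsProbabilityMeasure μ] {S : Ω → ℝ≥0∞} (hS : Measurable S) {p θ : ℝ} (hp : 0 < p)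
    (hpθ : p < θ) {C : ℝ≥0∞} (hC : C ≠ ∞)
    (hweak : ∀ n : ℕ, μ {ω | (2 : ℝ≥0∞) ^ n < S ω} ≤ C * (ENNReal.ofReal (2 ^ (-θ))) ^ n) :
    ∫⁻ ω, S ω ^ p ∂μ < ∞ := by
  have hr1 : (2 : ℝ) ^ (p - θ) < 1 :=
    Real.rpow_lt_one_of_one_lt_of_neg (by norm_num) (by linarith)
  have hθ1 : (2 : ℝ) ^ (-θ) < 1 :=
    Real.rpow_lt_one_of_one_lt_of_neg (by norm_num) (by linarith)
  have htop : μ {ω | S ω = ∞} = 0 := by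
    have hlim : Tendsto (fun n : ℕ => C * (ENNReal.ofReal (2 ^ (-θ))) ^ n) atTop (𝓝 0) := by
      have h1 := ENNReal.tendsto_pow_atTop_nhds_zero_of_lt_one
        (r := ENNReal.ofReal (2 ^ (-θ))) (by rw [ENNReal.ofReal_lt_one]; exact hθ1)
      simpa using ENNReal.Tendsto.const_mul h1 (Or.inr hC)
    refine le_antisymm (ge_of_tendsto' hlim fun n => (measure_mono ?_).trans (hweak n)) zero_le
    intro ω hω
    rw [mem_ofPred_eq, show S ω = ∞ from hω]
    exact ENNReal.pow_lt_top (by norm_num)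
  set c : ℝ≥0∞ := ENNReal.ofReal (2 ^ p) with hc
  have hc2 : c = (2 : ℝ≥0∞) ^ p := by
    rw [hc, ← ENNReal.ofReal_rpow_of_pos (by norm_num)]; simp
  -- Dyadic layers: if 2^n < S ≤ 2^(n+1), the term of index n already dominates S^p. Against the
  -- weak bound the series has ratio 2^(p-θ) < 1.
  have hpt : ∀ᵐ ω ∂μ, S ω ^ p ≤ 1 + ∑' n : ℕ, {ω | (2 : ℝ≥0∞) ^ n < S ω}.indicator
      (fun _ => c ^ (n + 1)) ω := by
    have : ∀ᵐ ω ∂μ, S ω ≠ ∞ := by rw [ae_iff]; simpa using htop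
    filter_upwards [this] with ω hω
    have hex : ∃ n : ℕ, S ω ≤ 2 ^ n := by
      obtain ⟨n, hn⟩ := ENNReal.exists_nat_gt hω
      refine ⟨n, hn.le.trans ?_⟩
      exact_mod_cast (Nat.lt_two_pow_self).le
    classical
    rcases h : Nat.find hex with _ | n
    · have h1 := Nat.find_spec hex
      rw [h, pow_zero] at h1
      calc S ω ^ p ≤ 1 ^ p := ENNReal.rpow_le_rpow h1 hp.le
        _ ≤ _ := by rw [ENNReal.one_rpow]; exact le_self_add
    · have h1 := Nat.find_spec hex
      rw [h] at h1
      have h2 : (2 : ℝ≥0∞) ^ n < S ω := not_le.1 (Nat.find_min hex (by omega))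
      calc S ω ^ p ≤ ((2 : ℝ≥0∞) ^ (n + 1)) ^ p := ENNReal.rpow_le_rpow h1 hp.le
        _ = c ^ (n + 1) := by
          rw [hc2, ← ENNReal.rpow_natCast, ← ENNReal.rpow_natCast, ← ENNReal.rpow_mul,
            ← ENNReal.rpow_mul, mul_comm]
        _ = {ω | (2 : ℝ≥0∞) ^ n < S ω}.indicator (fun _ => c ^ (n + 1)) ω := by
          rw [indicator_of_mem (show ω ∈ {ω | (2 : ℝ≥0∞) ^ n < S ω} from h2)]
        _ ≤ _ := (ENNReal.le_tsum (f := fun n : ℕ => {ω | (2 : ℝ≥0∞) ^ n < S ω}.indicator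
            (fun _ => c ^ (n + 1)) ω) n).trans le_add_self
  have hms : ∀ n : ℕ, MeasurableSet {ω | (2 : ℝ≥0∞) ^ n < S ω} := fun n =>
    measurableSet_lt measurable_const hS
  refine (lintegral_mono_ae hpt).trans_lt ?_
  rw [lintegral_add_left measurable_const, lintegral_const, measure_univ, one_mul,
    lintegral_tsum fun n => (measurable_const.indicator (hms n)).aemeasurable]
  refine ENNReal.add_lt_top.2 ⟨ENNReal.one_lt_top, ?_⟩
  have hterm : ∀ n : ℕ, ∫⁻ ω, {ω | (2 : ℝ≥0∞) ^ n < S ω}.indicator (fun _ => c ^ (n + 1)) ω ∂μ ≤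
      (c * C) * (ENNReal.ofReal (2 ^ (p - θ))) ^ n := by
    intro n
    rw [lintegral_indicator_const (hms n)]
    calc _ ≤ c ^ (n + 1) * (C * (ENNReal.ofReal (2 ^ (-θ))) ^ n) := by gcongr; exact hweak n
      _ = (c * C) * (c * ENNReal.ofReal (2 ^ (-θ))) ^ n := by ring
      _ = _ := by
        rw [hc, ← ENNReal.ofReal_mul (by positivity), ← Real.rpow_add (by norm_num),
          ← sub_eq_add_neg]
  refine (ENNReal.tsum_le_tsum hterm).trans_lt ?_
  rw [ENNReal.tsum_mul_left, ENNReal.tsum_geometric]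
  refine ENNReal.mul_lt_top (ENNReal.mul_lt_top ENNReal.ofReal_lt_top hC.lt_top) ?_
  rw [ENNReal.inv_lt_top, tsub_pos_iff_lt, ENNReal.ofReal_lt_one]
  exact hr1

theorem IsCadlagReal.shift_sub {f : ℝ≥0 → ℝ} (hf : IsCadlagReal f) (t : ℝ≥0) :
    IsCadlagReal fun u => f (t + u) - f t := by
  intro u
  have hc : Continuous fun v : ℝ≥0 => t + v := by fun_prop
  obtain ⟨h1, l, h2⟩ := hf (t + u)
  refine ⟨(h1.comp ?_).sub_const _, l - f t, (h2.comp ?_).sub_const _⟩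
  · exact tendsto_nhdsWithin_of_tendsto_nhds_of_eventually_within _
      (hc.continuousAt.tendsto.mono_left nhdsWithin_le_nhds)
      (eventually_nhdsWithin_of_forall fun v (hv : u ≤ v) => add_le_add_right hv t)
  · exact tendsto_nhdsWithin_of_tendsto_nhds_of_eventually_within _
      (hc.continuousAt.tendsto.mono_left nhdsWithin_le_nhds)
      (eventually_nhdsWithin_of_forall fun v (hv : v < u) => add_lt_add_right hv t)

/-- The supremum of `exp (-ξ_u)` over the grid points `u` of `[0, T]`. -/
def supExp {E : Type*} (T : ℝ≥0) (x : ℝ≥0 → ℝ × E) : ℝ≥0∞ :=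
  ⨆ (m : ℕ) (k : ℕ) (_ : k ≤ m), expz (-1) (x (T * ((k : ℝ≥0) / m))).1

section Maximal

set_option linter.unusedSectionVars false

variable {Ω E : Type*} {m : MeasurableSpace Ω}
  [Fintype E] [DecidableEq E] [MeasurableSpace E] [DiscreteMeasurableSpace E]
  {𝒢 : Filtration ℝ≥0 m} {P : E → Measure Ω} {ξ : ℝ≥0 → Ω → ℝ}
  {J : ℝ≥0 → Ω → E} {Q : Matrix E E ℝ}

theorem measurable_supExp (T : ℝ≥0) : Measurable (supExp (E := E) T) :=
  Measurable.iSup fun _ => Measurable.iSup fun _ => Measurable.iSup fun _ =>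
    IsMAP.measurable_path_apply _ (measurable_expz (-1)) _

theorem grid_le (T : ℝ≥0) {k n : ℕ} (h : k ≤ n) : T * ((k : ℝ≥0) / n) ≤ T :=
  mul_le_of_le_one_right zero_le (div_le_one_of_le₀ (by exact_mod_cast h) zero_le)

theorem expz_le_supExp {x : ℝ≥0 → ℝ × E} (hx : IsCadlagReal fun u => (x u).1) {u T : ℝ≥0}
    (hu : u ≤ T) : expz (-1) (x u).1 ≤ supExp T x := by
  obtain ⟨k, hk, hlim⟩ := exists_grid_seq hu
  have h1 : Tendsto (fun n : ℕ => (x (T * ((k n : ℝ≥0) / n))).1) atTop (𝓝 (x u).1) :=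
    (hx u).1.comp hlim
  refine le_of_tendsto' (((continuous_expz (-1)).tendsto _).comp h1) fun n => ?_
  exact le_iSup_of_le n (le_iSup_of_le (k n) (le_iSup_of_le (hk n) le_rfl))

theorem expz_rpow (z : ℝ) (x : ℝ) (p : ℝ) : expz z x ^ p = expz (z * p) x := by
  rw [expz, ENNReal.ofReal_rpow_of_pos (Real.exp_pos _), ← Real.exp_mul, expz]
  congr 2; ring

namespace IsMAP

/-- The martingale property of exp(zξ_t) w(J_t) for a harmonic vector w, tested against weights from
the past. -/
theorem lintegral_mul_martingale (hM : IsMAP 𝒢 P ξ J Q) {z : ℝ} {w : E → ℝ≥0∞}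
    (hw : ∀ t i, ∑ j, funMoment P ξ J (expz z) t i j * w j = w i) (k : E) {s : ℝ≥0} (t : ℝ≥0)
    {X : Ω → ℝ≥0∞} (hX : Measurable[𝒢 s] X) :
    ∫⁻ ω, X ω * (expz z (ξ (s + t) ω) * w (J (s + t) ω)) ∂(P k) =
      ∫⁻ ω, X ω * (expz z (ξ s ω) * w (J s ω)) ∂(P k) := by
  have hX' : Measurable X := hX.mono (𝒢.le s) le_rfl
  simp only [← mul_assoc]
  have e : ∀ u, ∫⁻ ω, X ω * expz z (ξ u ω) * w (J u ω) ∂(P k) =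
      ∑ j, (∫⁻ ω in {ω | J u ω = j}, X ω * expz z (ξ u ω) ∂(P k)) * w j := fun u =>
    hM.lintegral_mul_state k u (hX'.mul ((measurable_expz z).comp (hM.measurable_fst u))) w
  rw [e, e]
  simp only [hM.lintegral_mul_expz_shift z k _ hX t, Finset.sum_mul]
  rw [Finset.sum_comm]
  refine Finset.sum_congr rfl fun a _ => ?_
  rw [← hw t a, Finset.mul_sum]
  exact Finset.sum_congr rfl fun j _ => mul_assoc _ _ _

/-- Doob's inequality: the event is split by the first grid time at which the level is exceeded, and
on each piece the martingale property moves the expectation to time T. -/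
theorem maximal_grid (hM : IsMAP 𝒢 P ξ J Q) {z : ℝ} {w : E → ℝ≥0∞}
    (hw : ∀ t i, ∑ j, funMoment P ξ J (expz z) t i j * w j = w i) (k : E) (T : ℝ≥0) (n : ℕ)
    (y : ℝ≥0∞) :
    y * P k {ω | ∃ l ≤ n, y < expz z (ξ (T * ((l : ℝ≥0) / n)) ω) * w (J (T * ((l : ℝ≥0) / n)) ω)} ≤
      w k := by
  set s : ℕ → ℝ≥0 := fun l => T * ((l : ℝ≥0) / n) with hs
  set Z : ℝ≥0 → Ω → ℝ≥0∞ := fun u ω => expz z (ξ u ω) * w (J u ω) with hZ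
  have hsmono : Monotone s := fun a b hab => by simp only [hs]; gcongr
  have hZm : ∀ {u v : ℝ≥0}, u ≤ v → Measurable[𝒢 v] (Z u) := fun {u v} huv =>
    ((measurable_expz z).comp (hM.measurable_fst_of_le huv)).mul
      ((Measurable.of_discrete (f := w)).comp (hM.measurable_snd_of_le huv))
  set D : ℕ → Set Ω := fun l => {ω | y < Z (s l) ω ∧ ∀ r < l, Z (s r) ω ≤ y} with hD
  have hDm : ∀ l, MeasurableSet[𝒢 (s l)] (D l) := by
    intro l
    have : D l = {ω | y < Z (s l) ω} ∩ ⋂ r, ⋂ _ : r < l, {ω | Z (s r) ω ≤ y} := by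
      ext; simp [hD]
    rw [this]
    refine MeasurableSet.inter (hZm le_rfl measurableSet_Ioi)
      (MeasurableSet.iInter fun r => MeasurableSet.iInter fun hr => ?_)
    exact hZm (hsmono hr.le) measurableSet_Iic
  have hcover : {ω | ∃ l ≤ n, y < Z (s l) ω} ⊆ ⋃ l ∈ Finset.range (n + 1), D l := by
    rintro ω ⟨l, hl, hy⟩
    classical
    have hex : ∃ l, y < Z (s l) ω := ⟨l, hy⟩
    refine mem_iUnion₂.2 ⟨Nat.find hex, ?_, Nat.find_spec hex, fun r hr => ?_⟩
    · exact Finset.mem_range.2 (Nat.lt_succ_of_le ((Nat.find_min' hex hy).trans hl))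
    · exact not_lt.1 (Nat.find_min hex hr)
  have hdisj : (↑(Finset.range (n + 1)) : Set ℕ).PairwiseDisjoint D := by
    have aux : ∀ a b, a < b → Disjoint (D a) (D b) := fun a b hab =>
      Set.disjoint_left.2 fun ω h1 h2 => absurd h1.1 (not_lt.2 (h2.2 a hab))
    intro a _ b _ hab
    rcases lt_or_gt_of_ne hab with h | h
    · exact aux a b h
    · exact (aux b a h).symm
  have hDm' : ∀ l, MeasurableSet (D l) := fun l => 𝒢.le _ _ (hDm l)
  have hstep : ∀ l ∈ Finset.range (n + 1), y * P k (D l) ≤ ∫⁻ ω in D l, Z T ω ∂(P k) := by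
    intro l hl
    have hle : s l ≤ T := grid_le T (Nat.lt_succ_iff.1 (Finset.mem_range.1 hl))
    have hX : Measurable[𝒢 (s l)] ((D l).indicator fun _ => (1 : ℝ≥0∞)) :=
      Measurable.indicator measurable_const (hDm l)
    have hind : ∀ u, ∫⁻ ω in D l, Z u ω ∂(P k) =
        ∫⁻ ω, (D l).indicator (fun _ => (1 : ℝ≥0∞)) ω * (expz z (ξ u ω) * w (J u ω)) ∂(P k) := by
      intro u
      rw [← lintegral_indicator (hDm' l)]
      refine lintegral_congr fun ω => ?_
      by_cases h : ω ∈ D l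
      · rw [indicator_of_mem h, indicator_of_mem h, one_mul]
      · rw [indicator_of_notMem h, indicator_of_notMem h, zero_mul]
    have hmart := hM.lintegral_mul_martingale hw k (T - s l) hX
    rw [add_tsub_cancel_of_le hle, ← hind, ← hind] at hmart
    rw [hmart, ← setLIntegral_const]
    exact setLIntegral_mono' (hDm' l) fun ω hω => hω.1.le
  calc y * P k {ω | ∃ l ≤ n, y < Z (s l) ω}
      ≤ y * ∑ l ∈ Finset.range (n + 1), P k (D l) := by
        gcongr
        exact (measure_mono hcover).trans (measure_biUnion_finset_le _ _)
    _ = ∑ l ∈ Finset.range (n + 1), y * P k (D l) := Finset.mul_sum _ _ _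
    _ ≤ ∑ l ∈ Finset.range (n + 1), ∫⁻ ω in D l, Z T ω ∂(P k) := Finset.sum_le_sum hstep
    _ = ∫⁻ ω in ⋃ l ∈ Finset.range (n + 1), D l, Z T ω ∂(P k) :=
        (lintegral_biUnion_finset hdisj (fun l _ => hDm' l) _).symm
    _ ≤ ∫⁻ ω, Z T ω ∂(P k) := setLIntegral_le_lintegral _ _
    _ = w k := by
        simp only [hZ]
        rw [hM.lintegral_expz_mul_state z k T w, hw]

/-- Passing to continuous time: a strict crossing is seen by all sufficiently fine grids, by
right-continuity. The grids are not nested, so the increasing events that all grids from index N on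
see a crossing are used. -/
theorem maximal_ineq (hM : IsMAP 𝒢 P ξ J Q) {z : ℝ} {w : E → ℝ≥0∞}
    (hw : ∀ t i, ∑ j, funMoment P ξ J (expz z) t i j * w j = w i) (hwfin : ∀ i, w i ≠ ∞)
    (k : E) (T : ℝ≥0) (y : ℝ≥0∞) :
    y * P k {ω | ∃ u ≤ T, y < expz z (ξ u ω) * w (J u ω)} ≤ w k := by
  set U : ℕ → Set Ω := fun n => {ω | ∃ l ≤ n, y < expz z (ξ (T * ((l : ℝ≥0) / n)) ω) *
    w (J (T * ((l : ℝ≥0) / n)) ω)} with hU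
  set V : ℕ → Set Ω := fun N => ⋂ n ≥ N, U n with hV
  have hmono : Monotone V := fun a b hab =>
    biInter_mono (fun n (hn : b ≤ n) => hab.trans hn) fun _ _ => le_rfl
  have hsub : {ω | ∃ u ≤ T, y < expz z (ξ u ω) * w (J u ω)} ⊆ ⋃ N, V N := by
    rintro ω ⟨u, hu, hy⟩
    obtain ⟨l, hl, hlim⟩ := exists_grid_seq hu
    have h1 : Tendsto (fun n : ℕ => expz z (ξ (T * ((l n : ℝ≥0) / n)) ω) *
        w (J (T * ((l n : ℝ≥0) / n)) ω)) atTop (𝓝 (expz z (ξ u ω) * w (J u ω))) := by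
      have h2 : Tendsto (fun n : ℕ => ξ (T * ((l n : ℝ≥0) / n)) ω) atTop (𝓝 (ξ u ω)) :=
        ((hM.cadlag_fst ω) u).1.comp hlim
      have h3 : Tendsto (fun n : ℕ => expz z (ξ (T * ((l n : ℝ≥0) / n)) ω)) atTop
        (𝓝 (expz z (ξ u ω))) := ((continuous_expz z).tendsto _).comp h2
      refine (ENNReal.Tendsto.mul_const h3 (Or.inr (hwfin (J u ω)))).congr' ?_
      filter_upwards [hlim.eventually ((hM.cadlag_snd ω) u).1] with n hn
      rw [hn]
    obtain ⟨N, hN⟩ := eventually_atTop.1 (h1.eventually (lt_mem_nhds hy))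
    exact mem_iUnion.2 ⟨N, mem_iInter₂.2 fun n hn => ⟨l n, hl n, hN n hn⟩⟩
  calc _ ≤ y * P k (⋃ N, V N) := by gcongr
    _ = ⨆ N, y * P k (V N) := by rw [hmono.measure_iUnion, ENNReal.mul_iSup]
    _ ≤ w k := by
        refine iSup_le fun N => le_trans ?_ (hM.maximal_grid hw k T N y)
        gcongr
        exact iInter₂_subset N le_rfl

/-- The maximal inequality for the Cramér martingale, with h bounded below by its minimum, is a weak
bound of order θ for the supremum. -/
theorem lintegral_supExp_rpow_lt_top (hM : IsMAP 𝒢 P ξ J Q) {θ : ℝ}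
    (hzθ : MatrixExponentExists P ξ J Q (-θ)) {h : E → ℝ} (hpos : ∀ i, 0 < h i)
    (hh : ∀ t : ℝ≥0, NormedSpace.exp ((t : ℝ) • matrixExponent P ξ J Q (-θ)) *ᵥ h = h)
    {p : ℝ} (hp : p ∈ Ioo 0 θ) (k : E) (T : ℝ≥0) :
    ∫⁻ ω, supExp T (fun s => (ξ s ω, J s ω)) ^ p ∂(P k) < ∞ := by
  have := hM.prob k
  have : Nonempty E := ⟨k⟩
  set w : E → ℝ≥0∞ := fun j => ENNReal.ofReal (h j) with hwdef
  have hw : ∀ t i, ∑ j, funMoment P ξ J (expz (-θ)) t i j * w j = w i := by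
    intro t i
    rw [← hM.lintegral_expz_mul_state (-θ) i t w,
      hM.lintegral_expz_mul_state_ofReal hzθ i t fun j => (hpos j).le, hh]
  have hw0 : ∀ i, 0 < w i := fun i => ENNReal.ofReal_pos.2 (hpos i)
  have hwfin : ∀ i, w i ≠ ∞ := fun i => ENNReal.ofReal_ne_top
  obtain ⟨j₀, hj₀⟩ := Finite.exists_min w
  have hmeas : Measurable fun ω => supExp T (fun s => (ξ s ω, J s ω)) :=
    (measurable_supExp T).comp (measurable_pi_lambda _ fun s =>
      (hM.measurable_fst s).prodMk (hM.measurable_snd s))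
  have hθ0 : 0 < θ := hp.1.trans hp.2
  refine lintegral_rpow_lt_top_of_weak hmeas hp.1 hp.2 (C := w k / w j₀)
    (ENNReal.div_ne_top (hwfin k) (hw0 j₀).ne') fun n => ?_
  set y : ℝ≥0∞ := (2 : ℝ≥0∞) ^ n with hy
  have hyθ : y ^ θ = (ENNReal.ofReal (2 ^ θ)) ^ n := by
    rw [hy, ← ENNReal.ofReal_rpow_of_pos (by norm_num), ← ENNReal.rpow_natCast,
      ← ENNReal.rpow_natCast, ← ENNReal.rpow_mul, ← ENNReal.rpow_mul, mul_comm]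
    simp
  have hsub : {ω | y < supExp T (fun s => (ξ s ω, J s ω))} ⊆
      {ω | ∃ u ≤ T, y ^ θ * w j₀ < expz (-θ) (ξ u ω) * w (J u ω)} := by
    intro ω hω
    rw [mem_ofPred_eq, supExp] at hω
    simp only [lt_iSup_iff] at hω
    obtain ⟨N, l, hl, hlt⟩ := hω
    refine ⟨T * ((l : ℝ≥0) / N), grid_le T hl, ?_⟩
    have h1 := ENNReal.rpow_lt_rpow hlt hθ0
    rw [expz_rpow, neg_one_mul] at h1
    calc y ^ θ * w j₀ < expz (-θ) (ξ (T * ((l : ℝ≥0) / N)) ω) * w j₀ :=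
          ENNReal.mul_lt_mul_left (hw0 j₀).ne' (hwfin j₀) h1
      _ ≤ _ := by gcongr; exact hj₀ _
  have hmax := hM.maximal_ineq hw hwfin k T (y ^ θ * w j₀)
  have hpow : (0 : ℝ) < 2 ^ θ := Real.rpow_pos_of_pos (by norm_num) θ
  have hne0 : (ENNReal.ofReal (2 ^ θ)) ^ n ≠ 0 := pow_ne_zero _ (ENNReal.ofReal_pos.2 hpow).ne'
  have hnetop : (ENNReal.ofReal (2 ^ θ)) ^ n ≠ ∞ := ENNReal.pow_ne_top ENNReal.ofReal_ne_top
  have e : w k / w j₀ * (ENNReal.ofReal (2 ^ (-θ))) ^ n = w k / (y ^ θ * w j₀) := by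
    rw [hyθ, Real.rpow_neg (by norm_num), ENNReal.ofReal_inv_of_pos hpow, div_eq_mul_inv,
      div_eq_mul_inv, ENNReal.mul_inv (Or.inl hne0) (Or.inl hnetop), ENNReal.inv_pow]
    ring
  rw [e]
  refine (measure_mono hsub).trans ?_
  rw [ENNReal.le_div_iff_mul_le (Or.inl ?_) (Or.inl ?_), mul_comm]
  · exact hmax
  · rw [hyθ]; exact mul_ne_zero hne0 (hw0 j₀).ne'
  · rw [hyθ]; exact ENNReal.mul_ne_top hnetop (hwfin j₀)

theorem expFunctional_le_tsum (hM : IsMAP 𝒢 P ξ J Q) {T : ℝ≥0} (hT : 0 < T) (ω : Ω) :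
    expFunctional ξ ω ≤ ∑' n : ℕ, T * (expz (-1) (ξ (n * T) ω) *
      supExp T (shiftPath ξ J (n * T) ω)) := by
  have hcover : Ioi (0 : ℝ) ⊆ ⋃ n : ℕ, Ioc ((n : ℝ) * T) ((n + 1) * T) := by
    intro x hx
    have hT' : (0 : ℝ) < T := hT
    have hx' : (0 : ℝ) < x := hx
    have hc : 0 < ⌈x / T⌉₊ := Nat.ceil_pos.2 (div_pos hx hT')
    refine mem_iUnion.2 ⟨⌈x / T⌉₊ - 1, ?_, ?_⟩
    · rw [← lt_div_iff₀ hT']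
      exact Nat.lt_ceil.1 (Nat.sub_lt hc one_pos)
    · rw [← div_le_iff₀ hT']
      have : ((⌈x / T⌉₊ - 1 : ℕ) : ℝ) + 1 = ⌈x / T⌉₊ := by
        exact_mod_cast Nat.succ_pred_eq_of_pos hc
      rw [this]
      exact Nat.le_ceil _
  calc expFunctional ξ ω
      ≤ ∫⁻ t in ⋃ n : ℕ, Ioc ((n : ℝ) * T) ((n + 1) * T),
          ENNReal.ofReal (Real.exp (-ξ t.toNNReal ω)) := lintegral_mono_set hcover
    _ ≤ ∑' n : ℕ, ∫⁻ t in Ioc ((n : ℝ) * T) ((n + 1) * T),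
          ENNReal.ofReal (Real.exp (-ξ t.toNNReal ω)) := lintegral_iUnion_le _ _
    _ ≤ _ := by
        refine ENNReal.tsum_le_tsum fun n => ?_
        have hb : ∀ t ∈ Ioc ((n : ℝ) * T) ((n + 1) * T),
            ENNReal.ofReal (Real.exp (-ξ t.toNNReal ω)) ≤
              expz (-1) (ξ (n * T) ω) * supExp T (shiftPath ξ J (n * T) ω) := by
          intro t ht
          have h0 : ((n * T : ℝ≥0) : ℝ) = n * T := by push_cast; rfl
          have ht0 : (0 : ℝ) ≤ t := (by positivity : (0 : ℝ) ≤ n * T).trans ht.1.le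
          have h1 : n * T ≤ t.toNNReal := by
            rw [← NNReal.coe_le_coe, h0, Real.coe_toNNReal _ ht0]; exact ht.1.le
          have h2 : t.toNNReal - n * T ≤ T := by
            rw [tsub_le_iff_left, ← NNReal.coe_le_coe, Real.coe_toNNReal _ ht0, NNReal.coe_add, h0]
            linarith [ht.2]
          have h3 := expz_le_supExp (x := shiftPath ξ J (n * T) ω) 
            ((hM.cadlag_fst ω).shift_sub (n * T)) h2
          have h4 : ENNReal.ofReal (Real.exp (-ξ t.toNNReal ω)) = expz (-1) (ξ (n * T) ω) *
              expz (-1) (shiftPath ξ J (n * T) ω (t.toNNReal - n * T)).1 := by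
            rw [← expz_add, expz, shiftPath, add_tsub_cancel_of_le h1]
            congr 2; ring
          rw [h4]
          gcongr
        refine (setLIntegral_mono' measurableSet_Ioc hb).trans ?_
        rw [setLIntegral_const, Real.volume_Ioc, mul_comm]
        gcongr
        rw [show ((n : ℝ) + 1) * T - n * T = T by ring, ENNReal.ofReal_coe_nnreal]

/-- The p-th power is subadditive over the blocks of length T. By the Markov property the n-th block
contributes the moment matrix at time nT applied to the vector of moments of the block supremum,
which decays like ρ^n. -/
theorem lintegral_expFunctional_rpow_lt_top (hM : IsMAP 𝒢 P ξ J Q) {θ : ℝ} (hθ1 : θ ≤ 1)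
    (hzθ : MatrixExponentExists P ξ J Q (-θ)) {h : E → ℝ} (hpos : ∀ i, 0 < h i)
    (hh : ∀ t : ℝ≥0, NormedSpace.exp ((t : ℝ) • matrixExponent P ξ J Q (-θ)) *ᵥ h = h)
    {p : ℝ} (hp : p ∈ Ioo 0 θ) (hzp : MatrixExponentExists P ξ J Q (-p))
    {T : ℝ≥0} {ρ : ℝ} {v : E → ℝ} (hT : 0 < T) (hρ0 : 0 ≤ ρ) (hρ1 : ρ < 1) (hv : ∀ i, 0 < v i)
    (hdec : ∀ (n : ℕ) (i : E),
      (NormedSpace.exp (((n * T : ℝ≥0) : ℝ) • matrixExponent P ξ J Q (-p)) *ᵥ v) i ≤ ρ ^ n * v i)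
    (i : E) : ∫⁻ ω, expFunctional ξ ω ^ p ∂(P i) < ∞ := by
  set M : E → ℝ≥0∞ := fun a => ∫⁻ ω, supExp T (fun s => (ξ s ω, J s ω)) ^ p ∂(P a) with hMdef
  have hMfin : ∀ a, M a < ∞ := fun a => hM.lintegral_supExp_rpow_lt_top hzθ hpos hh hp a T
  -- Domination by a multiple of v transfers the decay of v to the block moments.
  obtain ⟨K, hK0, hK⟩ : ∃ K : ℝ, 0 ≤ K ∧ ∀ a, M a ≤ ENNReal.ofReal (K * v a) := by
    refine ⟨∑ a, (M a).toReal / v a, Finset.sum_nonneg fun a _ =>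
      div_nonneg ENNReal.toReal_nonneg (hv a).le, fun a => ?_⟩
    rw [← ENNReal.ofReal_toReal (hMfin a).ne]
    refine ENNReal.ofReal_le_ofReal ?_
    rw [← div_le_iff₀ (hv a)]
    exact Finset.single_le_sum (f := fun a => (M a).toReal / v a)
      (fun b _ => div_nonneg ENNReal.toReal_nonneg (hv b).le) (Finset.mem_univ a)
  have hpsi := (measurable_supExp (E := E) T).pow_const p
  have hterm : ∀ n : ℕ, ∫⁻ ω, ((T : ℝ≥0∞) * (expz (-1) (ξ (n * T) ω) *
      supExp T (shiftPath ξ J (n * T) ω))) ^ p ∂(P i) ≤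
      (T : ℝ≥0∞) ^ p * ENNReal.ofReal (K * v i) * ENNReal.ofReal ρ ^ n := by
    intro n
    have e1 : ∀ ω, ((T : ℝ≥0∞) * (expz (-1) (ξ (n * T) ω) *
        supExp T (shiftPath ξ J (n * T) ω))) ^ p =
        (T : ℝ≥0∞) ^ p * (expz (-p) (ξ (n * T) ω) * supExp T (shiftPath ξ J (n * T) ω) ^ p) := by
      intro ω
      rw [ENNReal.mul_rpow_of_nonneg _ _ hp.1.le, ENNReal.mul_rpow_of_nonneg _ _ hp.1.le,
        expz_rpow, neg_one_mul]
    have hX : Measurable[𝒢 (n * T)] fun ω => expz (-p) (ξ (n * T) ω) :=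
      (measurable_expz (-p)).comp (hM.adapted_fst _)
    have hXm : Measurable fun ω => expz (-p) (ξ (n * T) ω) := hX.mono (𝒢.le _) le_rfl
    have e2 : ∫⁻ ω, (T : ℝ≥0∞) ^ p * (expz (-p) (ξ (n * T) ω) *
        supExp T (shiftPath ξ J (n * T) ω) ^ p) ∂(P i) = (T : ℝ≥0∞) ^ p *
          ∫⁻ ω, expz (-p) (ξ (n * T) ω) * supExp T (shiftPath ξ J (n * T) ω) ^ p ∂(P i) :=
      lintegral_const_mul _ (hXm.mul (hpsi.comp (hM.measurable_shiftPath _)))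
    rw [lintegral_congr e1, e2, mul_assoc]
    gcongr
    rw [hM.lintegral_mul_shiftPath i hX hpsi]
    calc ∫⁻ ω, expz (-p) (ξ (n * T) ω) *
          ∫⁻ ω', supExp T (shiftPath ξ J 0 ω') ^ p ∂(P (J (n * T) ω)) ∂(P i)
        ≤ ∫⁻ ω, expz (-p) (ξ (n * T) ω) * ENNReal.ofReal (K * v (J (n * T) ω)) ∂(P i) := by
          refine lintegral_mono fun ω => ?_
          gcongr
          rw [hM.lintegral_shiftPath_zero _ fun x => supExp T x ^ p]
          exact hK _
      _ = ENNReal.ofReal ((NormedSpace.exp (((n * T : ℝ≥0) : ℝ) • matrixExponent P ξ J Q (-p)) *ᵥ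
            (K • v)) i) := hM.lintegral_expz_mul_state_ofReal hzp i _
              (w := K • v) fun j => mul_nonneg hK0 (hv j).le
      _ ≤ ENNReal.ofReal (K * v i * ρ ^ n) := by
          refine ENNReal.ofReal_le_ofReal ?_
          rw [Matrix.mulVec_smul, Pi.smul_apply, smul_eq_mul]
          calc _ ≤ K * (ρ ^ n * v i) := mul_le_mul_of_nonneg_left (hdec n i) hK0
            _ = _ := by ring
      _ = _ := by
          rw [ENNReal.ofReal_mul (mul_nonneg hK0 (hv i).le), ENNReal.ofReal_pow hρ0]
  have hmeas : ∀ n : ℕ, Measurable fun ω => ((T : ℝ≥0∞) * (expz (-1) (ξ (n * T) ω) *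
      supExp T (shiftPath ξ J (n * T) ω))) ^ p := fun n =>
    ((((measurable_expz (-1)).comp (hM.measurable_fst _)).mul
      ((measurable_supExp T).comp (hM.measurable_shiftPath _))).const_mul _).pow_const p
  calc ∫⁻ ω, expFunctional ξ ω ^ p ∂(P i)
      ≤ ∫⁻ ω, ∑' n : ℕ, ((T : ℝ≥0∞) * (expz (-1) (ξ (n * T) ω) *
          supExp T (shiftPath ξ J (n * T) ω))) ^ p ∂(P i) := by
        refine lintegral_mono fun ω => ?_
        exact (ENNReal.rpow_le_rpow (hM.expFunctional_le_tsum hT ω) hp.1.le).trans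
          (rpow_tsum_le_tsum_rpow _ hp.1 (hp.2.le.trans hθ1))
    _ = ∑' n : ℕ, ∫⁻ ω, ((T : ℝ≥0∞) * (expz (-1) (ξ (n * T) ω) *
          supExp T (shiftPath ξ J (n * T) ω))) ^ p ∂(P i) :=
        lintegral_tsum fun n => (hmeas n).aemeasurable
    _ ≤ ∑' n : ℕ, (T : ℝ≥0∞) ^ p * ENNReal.ofReal (K * v i) * ENNReal.ofReal ρ ^ n :=
        ENNReal.tsum_le_tsum hterm
    _ < ∞ := by
        rw [ENNReal.tsum_mul_left, ENNReal.tsum_geometric]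
        refine ENNReal.mul_lt_top (ENNReal.mul_lt_top
          (ENNReal.rpow_lt_top_of_nonneg hp.1.le ENNReal.coe_ne_top) ENNReal.ofReal_lt_top) ?_
        rw [ENNReal.inv_lt_top, tsub_pos_iff_lt, ENNReal.ofReal_lt_one]
        exact hρ1

end IsMAP

end Maximal

end MAP

end

/-! ### The integral equation for powers of the exponential functional. -/

noncomputable section

namespace MAP

/-- The fundamental theorem of calculus for a power of the tail integral of a positive
right-continuous function. -/
theorem rpow_tail_lintegral {g : ℝ → ℝ} (hg0 : ∀ x, 0 < g x) (hgm : Measurable g)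
    (hright : ∀ x ∈ Ioi (0 : ℝ), ContinuousWithinAt g (Ioi x) x)
    (hbdd : ∀ t, ∃ C, ∀ x ∈ Icc 0 t, g x ≤ C)
    (hI : ∫⁻ x in Ioi (0 : ℝ), ENNReal.ofReal (g x) < ∞) {p : ℝ} (hp : p ∈ Ioo (0 : ℝ) 1)
    {t : ℝ} (ht : 0 ≤ t) :
    (∫⁻ x in Ioi (0 : ℝ), ENNReal.ofReal (g x)) ^ p =
      (∫⁻ x in Ioi t, ENNReal.ofReal (g x)) ^ p + ENNReal.ofReal p *
        ∫⁻ u in Ioc 0 t, ENNReal.ofReal (g u) *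
          (∫⁻ x in Ioi u, ENNReal.ofReal (g x)) ^ (p - 1) := by
  have hint : IntegrableOn g (Ioi 0) := ⟨hgm.aestronglyMeasurable, by
    rwa [hasFiniteIntegral_iff_ofReal (Eventually.of_forall fun x => (hg0 x).le)]⟩
  set R : ℝ → ℝ := fun u => ∫ x in Ioi u, g x with hR
  have hintu : ∀ u, 0 ≤ u → IntegrableOn g (Ioi u) := fun u hu =>
    hint.mono_set (Ioi_subset_Ioi hu)
  have hRl : ∀ u, 0 ≤ u → ∫⁻ x in Ioi u, ENNReal.ofReal (g x) = ENNReal.ofReal (R u) :=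
    fun u hu => (ofReal_integral_eq_lintegral_ofReal (hintu u hu)
      (Eventually.of_forall fun x => (hg0 x).le)).symm
  have hsupp : Function.support g = univ := eq_univ_of_forall fun x => (hg0 x).ne'
  have hRpos : ∀ u, 0 ≤ u → 0 < R u := by
    intro u hu
    rw [hR]
    refine (setIntegral_pos_iff_support_of_nonneg_ae
      (Eventually.of_forall fun x => (hg0 x).le) (hintu u hu)).2 ?_
    rw [hsupp, univ_inter, Real.volume_Ioi]
    exact ENNReal.zero_lt_top
  have hRsub : ∀ u, 0 ≤ u → R u = R 0 - ∫ x in 0..u, g x := by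
    intro u hu
    rw [← intervalIntegral.integral_Ioi_sub_Ioi hint hu]
    simp only [hR]; ring
  have hii : ∀ u, 0 ≤ u → IntervalIntegrable g volume 0 u := fun u hu =>
    (intervalIntegrable_iff_integrableOn_Ioc_of_le hu).2 (hint.mono_set Ioc_subset_Ioi_self)
  have hcont : ContinuousOn R (Icc 0 t) := by
    have h1 : ContinuousOn (fun u => R 0 - ∫ x in 0..u, g x) (Icc 0 t) := by
      have hIcc : IntegrableOn g (uIcc 0 t) := by
        rw [uIcc_of_le ht, integrableOn_Icc_iff_integrableOn_Ioc]
        exact hint.mono_set Ioc_subset_Ioi_self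
      have := intervalIntegral.continuousOn_primitive_interval hIcc
      rw [uIcc_of_le ht] at this
      exact continuousOn_const.sub this
    exact h1.congr fun u hu => hRsub u hu.1
  -- Only a right derivative is available, because the integrand is merely right-continuous; this
  -- suffices for the fundamental theorem of calculus.
  have hder : ∀ x ∈ Ioo 0 t, HasDerivWithinAt (fun u => -(R u ^ p))
      (p * (g x * R x ^ (p - 1))) (Ioi x) x := by
    intro x hx
    have h1 : HasDerivWithinAt (fun u => ∫ y in 0..u, g y) (g x) (Ioi x) x :=
      (intervalIntegral.integral_hasDerivWithinAt_right (s := Ici x) (t := Ioi x) (hii x hx.1.le)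
        (hgm.stronglyMeasurable.stronglyMeasurableAtFilter) (hright x hx.1)).mono
        Ioi_subset_Ici_self
    have h2 : HasDerivWithinAt R (-g x) (Ioi x) x := by
      refine (h1.const_sub (R 0)).congr (fun u hu => hRsub u (hx.1.le.trans (le_of_lt hu)))
        (hRsub x hx.1.le)
    have h3 := (h2.rpow_const (p := p) (Or.inl (hRpos x hx.1.le).ne')).neg
    refine h3.congr_deriv ?_
    ring
  obtain ⟨C, hC⟩ := hbdd t
  have hRt : ∀ u ∈ Icc 0 t, R t ≤ R u := fun u hu =>
    setIntegral_mono_set (hintu u hu.1) (Eventually.of_forall fun x => (hg0 x).le)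
      (Ioi_subset_Ioi hu.2).eventuallyLE
  have hRpc : ContinuousOn (fun u => R u ^ (p - 1)) (Icc 0 t) :=
    hcont.rpow_const fun u hu => Or.inl (hRpos u hu.1).ne'
  -- The power p - 1 is negative, but the tail is at least R t > 0 on [0, t], so the integrand is
  -- bounded.
  have hint' : IntegrableOn (fun x => p * (g x * R x ^ (p - 1))) (Ioc 0 t) := by
    refine Integrable.of_bound ?_ (p * (C * R t ^ (p - 1))) ?_
    · exact (((hgm.aestronglyMeasurable).mul ((hRpc.mono Ioc_subset_Icc_self).aestronglyMeasurable
        measurableSet_Ioc)).const_mul p)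
    · refine (ae_restrict_mem measurableSet_Ioc).mono fun x hx => ?_
      have hx' := Ioc_subset_Icc_self hx
      have hpos1 : 0 ≤ R x ^ (p - 1) := (Real.rpow_pos_of_pos (hRpos x hx.1.le) _).le
      rw [Real.norm_of_nonneg (mul_nonneg hp.1.le (mul_nonneg (hg0 x).le hpos1))]
      refine mul_le_mul_of_nonneg_left (mul_le_mul (hC x hx') ?_ hpos1
        ((hg0 x).le.trans (hC x hx'))) hp.1.le
      exact Real.rpow_le_rpow_of_nonpos (hRpos t ht) (hRt x hx') (by linarith [hp.2])
  have hftc := intervalIntegral.integral_eq_sub_of_hasDeriv_right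
    (f := fun u => -(R u ^ p)) (f' := fun x => p * (g x * R x ^ (p - 1))) (a := 0) (b := t)
    (by rw [uIcc_of_le ht]; exact (hcont.rpow_const fun u hu => Or.inl (hRpos u hu.1).ne').neg)
    (by rw [min_eq_left ht, max_eq_right ht]; exact hder)
    ((intervalIntegrable_iff_integrableOn_Ioc_of_le ht).2 hint')
  have hnn : ∀ x ∈ Ioc 0 t, 0 ≤ p * (g x * R x ^ (p - 1)) := fun x hx =>
    mul_nonneg hp.1.le (mul_nonneg (hg0 x).le (Real.rpow_pos_of_pos (hRpos x hx.1.le) _).le)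
  have hlast : ENNReal.ofReal p * ∫⁻ u in Ioc 0 t, ENNReal.ofReal (g u) *
      (∫⁻ x in Ioi u, ENNReal.ofReal (g x)) ^ (p - 1) =
      ENNReal.ofReal (∫ x in 0..t, p * (g x * R x ^ (p - 1))) := by
    rw [intervalIntegral.integral_of_le ht, ofReal_integral_eq_lintegral_ofReal hint'
      ((ae_restrict_mem measurableSet_Ioc).mono hnn),
      ← lintegral_const_mul' _ _ ENNReal.ofReal_ne_top]
    refine setLIntegral_congr_fun measurableSet_Ioc fun u hu => ?_
    rw [hRl u hu.1.le, ENNReal.ofReal_rpow_of_pos (hRpos u hu.1.le), ENNReal.ofReal_mul hp.1.le,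
      ENNReal.ofReal_mul (hg0 u).le]
  rw [hlast, hftc, hRl 0 le_rfl, hRl t ht, ENNReal.ofReal_rpow_of_pos (hRpos 0 le_rfl),
    ENNReal.ofReal_rpow_of_pos (hRpos t ht), ← ENNReal.ofReal_add]
  · congr 1; ring
  · exact (Real.rpow_pos_of_pos (hRpos t ht) _).le
  · rw [← hftc, intervalIntegral.integral_of_le ht]
    exact setIntegral_nonneg measurableSet_Ioc hnn

section PathFunctional

set_option linter.unusedSectionVars false

variable {E : Type*} [MeasurableSpace E]

/-- Evaluation at a grid time is jointly measurable in time and path because only countably many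
times occur. Functionals of the path are therefore defined through limits along grids, which recover
the true values on càdlàg paths. -/
theorem measurable_eval_gridAbove (n : ℕ) :
    Measurable fun q : ℝ × (ℝ≥0 → ℝ × E) => (q.2 (gridAbove n q.1.toNNReal)).1 := by
  have h1 : Measurable fun q : ℕ × (ℝ≥0 → ℝ × E) => (q.2 (((q.1 : ℝ≥0) + 1) / (n + 1))).1 :=
    measurable_from_prod_countable_right fun k =>
      measurable_fst.comp (measurable_pi_apply (((k : ℝ≥0) + 1) / (n + 1)))
  have h2 : Measurable fun q : ℝ × (ℝ≥0 → ℝ × E) => ⌊q.1.toNNReal * ((n : ℝ≥0) + 1)⌋₊ :=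
    Nat.measurable_floor.comp (measurable_fst.real_toNNReal.mul_const _)
  exact h1.comp (h2.prodMk measurable_snd)

/-- The value `exp (-ξ_t)` as a functional of the path. -/
def pathDensity (t : ℝ) (x : ℝ≥0 → ℝ × E) : ℝ≥0∞ :=
  liminf (fun n => expz (-1) (x (gridAbove n t.toNNReal)).1) atTop

/-- The tail `∫_u^∞ exp (-ξ_t) dt` as a functional of the path. -/
def pathTail (u : ℝ) (x : ℝ≥0 → ℝ × E) : ℝ≥0∞ := ∫⁻ t in Ioi u, pathDensity t x

theorem measurable_pathDensity :
    Measurable fun q : ℝ × (ℝ≥0 → ℝ × E) => pathDensity q.1 q.2 :=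
  Measurable.liminf fun n => (measurable_expz (-1)).comp (measurable_eval_gridAbove n)

theorem measurable_pathTail :
    Measurable fun q : ℝ × (ℝ≥0 → ℝ × E) => pathTail q.1 q.2 := by
  have h : Measurable fun r : (ℝ × (ℝ≥0 → ℝ × E)) × ℝ =>
      {r : (ℝ × (ℝ≥0 → ℝ × E)) × ℝ | r.1.1 < r.2}.indicator
        (fun r => pathDensity r.2 r.1.2) r :=
    (measurable_pathDensity.comp (measurable_snd.prodMk (measurable_snd.comp
      measurable_fst))).indicator (measurableSet_lt (measurable_fst.comp measurable_fst)
        measurable_snd)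
  have e : (fun q : ℝ × (ℝ≥0 → ℝ × E) => pathTail q.1 q.2) = fun q =>
      ∫⁻ t, {r : (ℝ × (ℝ≥0 → ℝ × E)) × ℝ | r.1.1 < r.2}.indicator
        (fun r => pathDensity r.2 r.1.2) (q, t) := by
    funext q
    rw [pathTail, ← lintegral_indicator measurableSet_Ioi]
    rfl
  rw [e]
  exact h.lintegral_prod_right'

theorem pathDensity_eq {x : ℝ≥0 → ℝ × E} (hx : IsCadlagReal fun u => (x u).1) (t : ℝ) :
    pathDensity t x = expz (-1) (x t.toNNReal).1 :=
  (((continuous_expz (-1)).tendsto _).comp (hx.tendsto_gridAbove t.toNNReal)).liminf_eq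

theorem measurable_expz_path {x : ℝ≥0 → ℝ × E} (hx : IsCadlagReal fun u => (x u).1) :
    Measurable fun t : ℝ => expz (-1) (x t.toNNReal).1 := by
  have h1 : ∀ n : ℕ, Measurable fun t : ℝ => expz (-1) (x (gridAbove n t.toNNReal)).1 := by
    intro n
    have h : Measurable fun t : ℝ => ⌊t.toNNReal * ((n : ℝ≥0) + 1)⌋₊ :=
      Nat.measurable_floor.comp (measurable_id.real_toNNReal.mul_const _)
    exact (Measurable.of_discrete
      (f := fun k : ℕ => expz (-1) (x (((k : ℝ≥0) + 1) / (n + 1))).1)).comp h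
  exact measurable_of_tendsto_metrizable h1 (tendsto_pi_nhds.2 fun t =>
    ((continuous_expz (-1)).tendsto _).comp (hx.tendsto_gridAbove t.toNNReal))

theorem pathTail_eq {x : ℝ≥0 → ℝ × E} (hx : IsCadlagReal fun u => (x u).1) (u : ℝ) :
    pathTail u x = ∫⁻ t in Ioi u, expz (-1) (x t.toNNReal).1 := by
  simp only [pathTail, pathDensity_eq hx]

theorem pathTail_pos {x : ℝ≥0 → ℝ × E} (hx : IsCadlagReal fun u => (x u).1) (u : ℝ) :
    0 < pathTail u x := by
  rw [pathTail_eq hx, setLIntegral_pos_iff (measurable_expz_path hx)]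
  have : Function.support (fun t : ℝ => expz (-1) (x t.toNNReal).1) = univ :=
    eq_univ_of_forall fun t => (expz_pos _ _).ne'
  rw [this, univ_inter, Real.volume_Ioi]
  exact ENNReal.zero_lt_top

end PathFunctional

section Recurrence

set_option linter.unusedSectionVars false

variable {Ω E : Type*} {m : MeasurableSpace Ω}
  [Fintype E] [DecidableEq E] [MeasurableSpace E] [DiscreteMeasurableSpace E]
  {𝒢 : Filtration ℝ≥0 m} {P : E → Measure Ω} {ξ : ℝ≥0 → Ω → ℝ}
  {J : ℝ≥0 → Ω → E} {Q : Matrix E E ℝ}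

namespace IsMAP

theorem expFunctional_eq_pathTail (hM : IsMAP 𝒢 P ξ J Q) (ω : Ω) :
    expFunctional ξ ω = pathTail 0 (fun s => (ξ s ω, J s ω)) := by
  rw [pathTail_eq (hM.cadlag_fst ω), expFunctional]
  simp only [expz, neg_one_mul]

theorem measurable_path (hM : IsMAP 𝒢 P ξ J Q) :
    Measurable fun ω => fun s => (ξ s ω, J s ω) :=
  measurable_pi_lambda _ fun s => (hM.measurable_fst s).prodMk (hM.measurable_snd s)

theorem measurable_expFunctional (hM : IsMAP 𝒢 P ξ J Q) : Measurable (expFunctional ξ) := by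
  have : expFunctional ξ = fun ω => pathTail 0 (fun s => (ξ s ω, J s ω)) :=
    funext hM.expFunctional_eq_pathTail
  rw [this]
  exact measurable_pathTail.comp (measurable_const.prodMk hM.measurable_path)

theorem expFunctional_pos (hM : IsMAP 𝒢 P ξ J Q) (ω : Ω) : 0 < expFunctional ξ ω := by
  rw [hM.expFunctional_eq_pathTail]
  exact pathTail_pos (hM.cadlag_fst ω) 0

theorem pathTail_shift (hM : IsMAP 𝒢 P ξ J Q) (u : ℝ≥0) (ω : Ω) :
    pathTail u (fun s => (ξ s ω, J s ω)) =
      expz (-1) (ξ u ω) * pathTail 0 (shiftPath ξ J u ω) := by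
  have hc : IsCadlagReal fun s => (shiftPath ξ J u ω s).1 := (hM.cadlag_fst ω).shift_sub u
  have hm := measurable_expz_path (x := fun s => (ξ s ω, J s ω)) (hM.cadlag_fst ω)
  rw [pathTail_eq (hM.cadlag_fst ω), pathTail_eq hc,
    ← lintegral_const_mul _ (measurable_expz_path hc),
    ← (measurePreserving_add_left volume (u : ℝ)).setLIntegral_comp_preimage measurableSet_Ioi hm]
  have hpre : (fun x : ℝ => (u : ℝ) + x) ⁻¹' Ioi (u : ℝ) = Ioi 0 := by
    ext x; simp
  rw [hpre]
  refine setLIntegral_congr_fun measurableSet_Ioi fun t (ht : 0 < t) => ?_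
  simp only [shiftPath]
  have e : ((u : ℝ) + t).toNNReal = u + t.toNNReal := by
    rw [Real.toNNReal_add u.coe_nonneg ht.le, Real.toNNReal_coe]
  rw [← expz_add, e, add_sub_cancel]

theorem lintegral_expz_mul_path (hM : IsMAP 𝒢 P ξ J Q) {z : ℝ}
    (hz : MatrixExponentExists P ξ J Q z) (i : E) (t : ℝ≥0) {F : (ℝ≥0 → ℝ × E) → ℝ≥0∞}
    (hF : Measurable F) :
    ∫⁻ ω, expz z (ξ t ω) * F (shiftPath ξ J t ω) ∂(P i) =
      ∑ j, ENNReal.ofReal (NormedSpace.exp ((t : ℝ) • matrixExponent P ξ J Q z) i j) *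
        ∫⁻ ω, F (fun s => (ξ s ω, J s ω)) ∂(P j) := by
  have h := hM.lintegral_mul_shiftPath i (X := fun ω => expz z (ξ t ω))
    ((measurable_expz z).comp (hM.adapted_fst t)) hF
  rw [h]
  simp only [hM.lintegral_shiftPath_zero _ F]
  rw [hM.lintegral_expz_mul_state z i t fun j => ∫⁻ ω, F (fun s => (ξ s ω, J s ω)) ∂(P j)]
  simp only [hM.funMoment_eq_exp_matrixExponent hz]

theorem rpow_expFunctional_eq (hM : IsMAP 𝒢 P ξ J Q) {ω : Ω} (hI : expFunctional ξ ω < ∞)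
    {p : ℝ} (hp : p ∈ Ioo (0 : ℝ) 1) (t : ℝ≥0) :
    expFunctional ξ ω ^ p = pathTail t (fun s => (ξ s ω, J s ω)) ^ p +
      ENNReal.ofReal p * ∫⁻ u in Ioc 0 (t : ℝ), pathDensity u (fun s => (ξ s ω, J s ω)) *
        pathTail u (fun s => (ξ s ω, J s ω)) ^ (p - 1) := by
  have hc : IsCadlagReal fun s => ((ξ s ω, J s ω) : ℝ × E).1 := hM.cadlag_fst ω
  have hm : Measurable fun x : ℝ => Real.exp (-ξ x.toNNReal ω) := by
    have := (measurable_expz_path hc).ennreal_toReal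
    simpa only [expz, neg_one_mul, ENNReal.toReal_ofReal (Real.exp_pos _).le] using this
  have key := rpow_tail_lintegral (g := fun x => Real.exp (-ξ x.toNNReal ω))
    (fun x => Real.exp_pos _) hm ?_ ?_ hI hp t.coe_nonneg
  · simp only [pathTail_eq hc, pathDensity_eq hc]
    simpa only [expFunctional, expz, neg_one_mul] using key
  · intro x hx
    have h1 : Tendsto (fun y : ℝ => ξ y.toNNReal ω) (𝓝[>] x) (𝓝 (ξ x.toNNReal ω)) := by
      refine (hc x.toNNReal).1.comp (tendsto_nhdsWithin_iff.2 ⟨?_, ?_⟩)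
      · exact (continuous_real_toNNReal.tendsto x).mono_left nhdsWithin_le_nhds
      · exact eventually_nhdsWithin_of_forall fun y (hy : x < y) => Real.toNNReal_le_toNNReal hy.le
    exact (Real.continuous_exp.tendsto _).comp h1.neg
  · intro T
    obtain ⟨C, -, hC⟩ := hc.exists_bound T.toNNReal
    refine ⟨Real.exp C, fun x hx => Real.exp_le_exp.2 ?_⟩
    exact (neg_le_abs _).trans (hC _ (Real.toNNReal_le_toNNReal hx.2))

/-- Expectation of the pathwise identity. The tail from u is exp(-ξ_u) times the functional of the
shifted path, so both terms on the right carry the factor exp(-pξ), whose moments are given by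
exp(uF(-p)). -/
theorem lintegral_expFunctional_rpow_eq (hM : IsMAP 𝒢 P ξ J Q) {p : ℝ} (hp : p ∈ Ioo (0 : ℝ) 1)
    (hz : MatrixExponentExists P ξ J Q (-p)) (i : E)
    (hI : ∀ᵐ ω ∂(P i), expFunctional ξ ω < ∞) (t : ℝ≥0) :
    ∫⁻ ω, expFunctional ξ ω ^ p ∂(P i) =
      ∑ j, ENNReal.ofReal (NormedSpace.exp ((t : ℝ) • matrixExponent P ξ J Q (-p)) i j) *
        ∫⁻ ω, expFunctional ξ ω ^ p ∂(P j) +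
      ENNReal.ofReal p * ∫⁻ u in Ioc 0 (t : ℝ),
        ∑ j, ENNReal.ofReal (NormedSpace.exp (u • matrixExponent P ξ J Q (-p)) i j) *
          ∫⁻ ω, expFunctional ξ ω ^ (p - 1) ∂(P j) := by
  have := hM.prob i
  have hpow : ∀ r : ℝ, Measurable fun x : ℝ≥0 → ℝ × E => pathTail 0 x ^ r := fun r =>
    (measurable_pathTail.comp (measurable_const.prodMk measurable_id)).pow_const r
  have hM' : ∀ (r : ℝ) (j : E), ∫⁻ ω, pathTail 0 (fun s => (ξ s ω, J s ω)) ^ r ∂(P j) =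
      ∫⁻ ω, expFunctional ξ ω ^ r ∂(P j) := fun r j => by
    simp only [hM.expFunctional_eq_pathTail]
  have hpt : ∀ (u : ℝ≥0) (r : ℝ) (ω : Ω), pathTail u (fun s => (ξ s ω, J s ω)) ^ r =
      expz (-r) (ξ u ω) * pathTail 0 (shiftPath ξ J u ω) ^ r := by
    intro u r ω
    have hc : IsCadlagReal fun s => (shiftPath ξ J u ω s).1 := (hM.cadlag_fst ω).shift_sub u
    rw [hM.pathTail_shift, ENNReal.mul_rpow_of_ne_zero (expz_pos _ _).ne' (pathTail_pos hc 0).ne',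
      expz_rpow, neg_one_mul]
  have hjoint : Measurable fun q : ℝ × Ω => pathDensity q.1 (fun s => (ξ s q.2, J s q.2)) *
      pathTail q.1 (fun s => (ξ s q.2, J s q.2)) ^ (p - 1) := by
    have hq : Measurable fun q : ℝ × Ω => (q.1, fun s => (ξ s q.2, J s q.2)) :=
      _root_.measurable_fst.prodMk (hM.measurable_path.comp _root_.measurable_snd)
    exact (measurable_pathDensity.comp hq).mul ((measurable_pathTail.comp hq).pow_const _)
  have hinner : Measurable fun ω => ∫⁻ u in Ioc 0 (t : ℝ),
      pathDensity u (fun s => (ξ s ω, J s ω)) * pathTail u (fun s => (ξ s ω, J s ω)) ^ (p - 1) :=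
    hjoint.lintegral_prod_left'
  rw [lintegral_congr_ae (hI.mono fun ω hω => hM.rpow_expFunctional_eq hω hp t),
    lintegral_add_right _ (hinner.const_mul _), lintegral_const_mul _ hinner]
  congr 1
  · simp only [hpt t p]
    rw [hM.lintegral_expz_mul_path hz i t (hpow p)]
    simp only [hM']
  · congr 1
    have hswap := lintegral_lintegral_swap (μ := P i) (ν := volume.restrict (Ioc 0 (t : ℝ)))
      (f := fun ω u => pathDensity u (fun s => (ξ s ω, J s ω)) *
        pathTail u (fun s => (ξ s ω, J s ω)) ^ (p - 1)) (hjoint.comp measurable_swap).aemeasurable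
    rw [hswap]
    refine setLIntegral_congr_fun measurableSet_Ioc fun u hu => ?_
    lift u to ℝ≥0 using hu.1.le
    have e : ∀ ω, pathDensity u (fun s => (ξ s ω, J s ω)) *
        pathTail u (fun s => (ξ s ω, J s ω)) ^ (p - 1) =
        expz (-p) (ξ u ω) * pathTail 0 (shiftPath ξ J u ω) ^ (p - 1) := by
      intro ω
      rw [hpt u, pathDensity_eq (hM.cadlag_fst ω), Real.toNNReal_coe, ← mul_assoc]
      congr 1
      rw [expz, expz, expz, ← ENNReal.ofReal_mul (Real.exp_pos _).le, ← Real.exp_add]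
      congr 2; ring
    simp only [e]
    rw [hM.lintegral_expz_mul_path hz i u (hpow (p - 1))]
    simp only [hM']

end IsMAP

end Recurrence

end MAP

end

/-! ### The recurrence for moments and analyticity of the Mellin transform. -/

noncomputable section

namespace MAP

section Mellin

set_option linter.unusedSectionVars false

variable {Ω E : Type*} {m : MeasurableSpace Ω}
  [Fintype E] [DecidableEq E] [MeasurableSpace E] [DiscreteMeasurableSpace E]
  {𝒢 : Filtration ℝ≥0 m} {P : E → Measure Ω} {ξ : ℝ≥0 → Ω → ℝ}
  {J : ℝ≥0 → Ω → E} {Q : Matrix E E ℝ}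

namespace IsMAP

theorem ae_expFunctional_lt_top (hM : IsMAP 𝒢 P ξ J Q) {p : ℝ} (hp : 0 < p) {i : E}
    (h : ∫⁻ ω, expFunctional ξ ω ^ p ∂(P i) < ∞) : ∀ᵐ ω ∂(P i), expFunctional ξ ω < ∞ := by
  filter_upwards [ae_lt_top (hM.measurable_expFunctional.pow_const p) h.ne] with ω hω
  exact (ENNReal.rpow_lt_top_iff_of_pos hp).1 hω

/-- Near time 0 the diagonal entries of exp(uF(-p)) exceed 1/2, so the integral term bounds a
positive multiple of the moment of order p - 1, while the left side of the integral equation is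
finite. -/
theorem lintegral_expFunctional_rpow_sub_one_lt_top (hM : IsMAP 𝒢 P ξ J Q) {p : ℝ}
    (hp : p ∈ Ioo (0 : ℝ) 1) (hz : MatrixExponentExists P ξ J Q (-p))
    (hfin : ∀ i, ∫⁻ ω, expFunctional ξ ω ^ p ∂(P i) < ∞) (j : E) :
    ∫⁻ ω, expFunctional ξ ω ^ (p - 1) ∂(P j) < ∞ := by
  set F := matrixExponent P ξ J Q (-p) with hF
  have hev : ∀ᶠ u in 𝓝 (0 : ℝ), (1 / 2 : ℝ) < NormedSpace.exp (u • F) j j := by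
    refine ((continuous_matrix_exp_smul F j j).tendsto 0).eventually (lt_mem_nhds ?_)
    rw [zero_smul, NormedSpace.exp_zero, Matrix.one_apply_eq]
    norm_num
  obtain ⟨ε, hε, hball⟩ := Metric.eventually_nhds_iff.1 hev
  set t : ℝ≥0 := ⟨ε / 2, (half_pos hε).le⟩ with ht
  have htε : (t : ℝ) = ε / 2 := rfl
  have heq := hM.lintegral_expFunctional_rpow_eq hp hz j
    (hM.ae_expFunctional_lt_top hp.1 (hfin j)) t
  set M₀ := ∫⁻ ω, expFunctional ξ ω ^ (p - 1) ∂(P j) with hM₀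
  have hlow : ENNReal.ofReal p * (ENNReal.ofReal (1 / 2) * M₀ * t) ≤
      ∫⁻ ω, expFunctional ξ ω ^ p ∂(P j) := by
    rw [heq]
    refine le_trans ?_ le_add_self
    gcongr
    have hc : ENNReal.ofReal (1 / 2) * M₀ * t =
        ∫⁻ _ in Ioc 0 (t : ℝ), ENNReal.ofReal (1 / 2) * M₀ := by
      rw [setLIntegral_const, Real.volume_Ioc, sub_zero, ENNReal.ofReal_coe_nnreal]
    rw [hc]
    refine setLIntegral_mono' measurableSet_Ioc fun u hu => ?_
    refine le_trans ?_ (Finset.single_le_sum (f := fun a => ENNReal.ofReal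
      (NormedSpace.exp (u • F) j a) * ∫⁻ ω, expFunctional ξ ω ^ (p - 1) ∂(P a))
      (fun _ _ => zero_le) (Finset.mem_univ j))
    refine mul_le_mul_left (ENNReal.ofReal_le_ofReal (hball ?_).le) _
    rw [Real.dist_eq, sub_zero, abs_of_pos hu.1]
    have := hu.2
    rw [htε] at this
    linarith
  by_contra hcon
  rw [not_lt_top_iff] at hcon
  have ht0 : (t : ℝ≥0∞) ≠ 0 := by
    rw [Ne, ENNReal.coe_eq_zero, ← NNReal.coe_eq_zero, htε]
    exact (half_pos hε).ne'
  rw [hcon, ENNReal.mul_top (ENNReal.ofReal_pos.2 (by norm_num)).ne', ENNReal.top_mul ht0,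
    ENNReal.mul_top (ENNReal.ofReal_pos.2 hp.1).ne'] at hlow
  exact absurd (hfin j) (not_lt.2 hlow)

/-- The right derivative at t = 0 of the integral equation: the semigroup yields the matrix
exponent, the integral yields its integrand at 0. -/
theorem matrixExponent_mulVec_moment (hM : IsMAP 𝒢 P ξ J Q) {p : ℝ}
    (hp : p ∈ Ioo (0 : ℝ) 1) (hz : MatrixExponentExists P ξ J Q (-p))
    (hfin : ∀ i, ∫⁻ ω, expFunctional ξ ω ^ p ∂(P i) < ∞) :
    (matrixExponent P ξ J Q (-p)) *ᵥ (fun i => (∫⁻ ω, expFunctional ξ ω ^ p ∂(P i)).toReal) =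
      (-p) • fun i => (∫⁻ ω, expFunctional ξ ω ^ (p - 1) ∂(P i)).toReal := by
  set F := matrixExponent P ξ J Q (-p) with hF
  have hfin₀ := hM.lintegral_expFunctional_rpow_sub_one_lt_top hp hz hfin
  set M₁ : E → ℝ := fun i => (∫⁻ ω, expFunctional ξ ω ^ p ∂(P i)).toReal with hM₁
  set M₀ : E → ℝ := fun i => (∫⁻ ω, expFunctional ξ ω ^ (p - 1) ∂(P i)).toReal with hM₀
  have e₁ : ∀ i, ∫⁻ ω, expFunctional ξ ω ^ p ∂(P i) = ENNReal.ofReal (M₁ i) := fun i =>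
    (ENNReal.ofReal_toReal (hfin i).ne).symm
  have e₀ : ∀ i, ∫⁻ ω, expFunctional ξ ω ^ (p - 1) ∂(P i) = ENNReal.ofReal (M₀ i) := fun i =>
    (ENNReal.ofReal_toReal (hfin₀ i).ne).symm
  have hM₁0 : ∀ i, 0 ≤ M₁ i := fun i => ENNReal.toReal_nonneg
  have hM₀0 : ∀ i, 0 ≤ M₀ i := fun i => ENNReal.toReal_nonneg
  have hnn : ∀ (t : ℝ), 0 ≤ t → ∀ i j, 0 ≤ NormedSpace.exp (t • F) i j := fun t ht i j =>
    hM.exp_matrixExponent_nonneg (-p) ⟨t, ht⟩ i j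
  have hsum : ∀ (t : ℝ), 0 ≤ t → ∀ (i : E) (v : E → ℝ), (∀ j, 0 ≤ v j) →
      ∑ j, ENNReal.ofReal (NormedSpace.exp (t • F) i j) * ENNReal.ofReal (v j) =
        ENNReal.ofReal ((NormedSpace.exp (t • F) *ᵥ v) i) := by
    intro t ht i v hv
    rw [Matrix.mulVec, dotProduct,
      ENNReal.ofReal_sum_of_nonneg fun j _ => mul_nonneg (hnn t ht i j) (hv j)]
    exact Finset.sum_congr rfl fun j _ => (ENNReal.ofReal_mul (hnn t ht i j)).symm
  funext i
  set φ : ℝ → ℝ := fun u => (NormedSpace.exp (u • F) *ᵥ M₀) i with hφ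
  have hφc : Continuous φ := continuous_finsetSum _ fun j _ =>
    (continuous_matrix_exp_smul F i j).mul continuous_const
  have hmv : ∀ t : ℝ, 0 ≤ t → ∀ v : E → ℝ, (∀ j, 0 ≤ v j) →
      0 ≤ (NormedSpace.exp (t • F) *ᵥ v) i := fun t ht v hv =>
    Finset.sum_nonneg fun j _ => mul_nonneg (hnn t ht i j) (hv j)
  have hreal : ∀ t : ℝ, 0 < t →
      M₁ i = (NormedSpace.exp (t • F) *ᵥ M₁) i + p * ∫ u in 0..t, φ u := by
    intro t ht
    have heq := hM.lintegral_expFunctional_rpow_eq hp hz i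
      (hM.ae_expFunctional_lt_top hp.1 (hfin i)) t.toNNReal
    simp only [e₁, e₀, Real.coe_toNNReal t ht.le, ← hF] at heq
    have hφnn : ∀ u ∈ Ioc 0 t, 0 ≤ φ u := fun u hu => hmv u hu.1.le M₀ hM₀0
    have hint : IntegrableOn φ (Ioc 0 t) := (hφc.integrableOn_Icc).mono_set Ioc_subset_Icc_self
    have hI0 : 0 ≤ ∫ u in 0..t, φ u := by
      rw [intervalIntegral.integral_of_le ht.le]
      exact setIntegral_nonneg measurableSet_Ioc hφnn
    have hl : ∫⁻ u in Ioc 0 t, ∑ j, ENNReal.ofReal (NormedSpace.exp (u • F) i j) *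
        ENNReal.ofReal (M₀ j) = ENNReal.ofReal (∫ u in 0..t, φ u) := by
      rw [intervalIntegral.integral_of_le ht.le, ofReal_integral_eq_lintegral_ofReal hint
        ((ae_restrict_mem measurableSet_Ioc).mono hφnn)]
      exact setLIntegral_congr_fun measurableSet_Ioc fun u hu => hsum u hu.1.le i M₀ hM₀0
    rw [hl, hsum t ht.le i M₁ hM₁0, ← ENNReal.ofReal_mul hp.1.le,
      ← ENNReal.ofReal_add (hmv t ht.le M₁ hM₁0) (mul_nonneg hp.1.le hI0),
      ENNReal.ofReal_eq_ofReal_iff (hM₁0 i)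
        (add_nonneg (hmv t ht.le M₁ hM₁0) (mul_nonneg hp.1.le hI0))] at heq
    exact heq
  have hlim₁ : Tendsto (fun t : ℝ => t⁻¹ * ((NormedSpace.exp (t • F) *ᵥ M₁) i - M₁ i))
      (𝓝[>] 0) (𝓝 ((F *ᵥ M₁) i)) := by
    have h1 : Tendsto (fun t : ℝ => ∑ j, t⁻¹ * (NormedSpace.exp (t • F) i j -
        (1 : Matrix E E ℝ) i j) * M₁ j) (𝓝[>] 0) (𝓝 ((F *ᵥ M₁) i)) :=
      tendsto_finsetSum _ fun j _ => ((tendsto_matrix_exp_sub_one F i j).mono_left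
        (nhdsWithin_mono _ fun x (hx : 0 < x) => hx.ne')).mul_const _
    refine h1.congr fun t => ?_
    have h2 : M₁ i = ∑ j, (1 : Matrix E E ℝ) i j * M₁ j := by
      simpa [Matrix.mulVec, dotProduct] using (congrFun (Matrix.one_mulVec M₁) i).symm
    conv_rhs => rw [h2]
    rw [Matrix.mulVec, dotProduct, ← Finset.sum_sub_distrib, Finset.mul_sum]
    exact Finset.sum_congr rfl fun j _ => by ring
  have hlim₀ : Tendsto (fun t : ℝ => t⁻¹ * ((NormedSpace.exp (t • F) *ᵥ M₁) i - M₁ i))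
      (𝓝[>] 0) (𝓝 (-p * M₀ i)) := by
    have h1 := (hasDerivAt_iff_tendsto_slope_zero.1
      (hφc.integral_hasStrictDerivAt 0 0).hasDerivAt).mono_left
        (nhdsWithin_mono (0 : ℝ) fun x (hx : 0 < x) => hx.ne')
    have h2 : φ 0 = M₀ i := by simp [hφ, NormedSpace.exp_zero]
    rw [h2] at h1
    refine (h1.const_mul (-p)).congr' ?_
    filter_upwards [self_mem_nhdsWithin] with t ht
    have h3 := hreal t ht
    rw [zero_add, intervalIntegral.integral_same, sub_zero, smul_eq_mul]
    rw [show (NormedSpace.exp (t • F) *ᵥ M₁) i - M₁ i = -(p * ∫ u in 0..t, φ u) by linarith]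
    ring
  rw [Pi.smul_apply, smul_eq_mul]
  exact tendsto_nhds_unique hlim₁ hlim₀

theorem exp_mul_log_expFunctional (hM : IsMAP 𝒢 P ξ J Q) {ω : Ω} (hω : expFunctional ξ ω < ∞)
    (t : ℝ) : Real.exp (t * Real.log (expFunctional ξ ω).toReal) =
      (expFunctional ξ ω ^ t).toReal := by
  have h := ENNReal.toReal_pos (hM.expFunctional_pos ω).ne' hω.ne
  rw [← ENNReal.toReal_rpow, Real.rpow_def_of_pos h, mul_comm]

theorem cpow_expFunctional (hM : IsMAP 𝒢 P ξ J Q) {ω : Ω} (hω : expFunctional ξ ω < ∞) (z : ℂ) :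
    ((expFunctional ξ ω).toReal : ℂ) ^ z =
      Complex.exp (z * (Real.log (expFunctional ξ ω).toReal : ℝ)) := by
  have h := ENNReal.toReal_pos (hM.expFunctional_pos ω).ne' hω.ne
  rw [Complex.cpow_def_of_ne_zero (by exact_mod_cast h.ne'), Complex.ofReal_log h.le, mul_comm]

theorem mem_integrableExpSet_log (hM : IsMAP 𝒢 P ξ J Q) {i : E}
    (hI : ∀ᵐ ω ∂(P i), expFunctional ξ ω < ∞) {t : ℝ}
    (h : ∫⁻ ω, expFunctional ξ ω ^ t ∂(P i) < ∞) :
    t ∈ integrableExpSet (fun ω => Real.log (expFunctional ξ ω).toReal) (P i) :=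
  (integrable_toReal_of_lintegral_ne_top
    (hM.measurable_expFunctional.pow_const t).aemeasurable h.ne).congr
      (hI.mono fun _ hω => (hM.exp_mul_log_expFunctional hω t).symm)

/-- The functional is positive and finite, so its power s - 1 is exp((s - 1) log I), and
integrability and analyticity follow from the theory of complex moment generating functions. -/
theorem mellin_eq_complexMGF (hM : IsMAP 𝒢 P ξ J Q) {i : E}
    (hI : ∀ᵐ ω ∂(P i), expFunctional ξ ω < ∞) (s : ℂ) :
    mellin P ξ s i =
      complexMGF (fun ω => Real.log (expFunctional ξ ω).toReal) (P i) (s - 1) :=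
  integral_congr_ae (hI.mono fun _ hω => hM.cpow_expFunctional hω (s - 1))

theorem mellin_ofReal_add_one (hM : IsMAP 𝒢 P ξ J Q) {i : E}
    {t : ℝ} (h : ∫⁻ ω, expFunctional ξ ω ^ t ∂(P i) < ∞) :
    mellin P ξ ((t : ℂ) + 1) i = ((∫⁻ ω, expFunctional ξ ω ^ t ∂(P i)).toReal : ℝ) := by
  have hm := hM.measurable_expFunctional.pow_const t
  rw [mellin, ← integral_toReal hm.aemeasurable (ae_lt_top hm h.ne), ← integral_complex_ofReal]
  refine integral_congr_ae (Eventually.of_forall fun ω => ?_)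
  simp only
  rw [add_sub_cancel_right, ← ENNReal.toReal_rpow, Complex.ofReal_cpow ENNReal.toReal_nonneg]

/-- All exponents strictly between `-1` and `θ` are interior to the domain of the moments of the
exponential functional. -/
theorem Ioo_subset_interior_integrableExpSet (hM : IsMAP 𝒢 P ξ J Q) {θ : ℝ} (hθ : 0 < θ) {i : E}
    (hI : ∀ᵐ ω ∂(P i), expFunctional ξ ω < ∞)
    (hfin : ∀ p ∈ Ioo 0 θ, ∫⁻ ω, expFunctional ξ ω ^ p ∂(P i) < ∞)
    (hfin₀ : ∀ p ∈ Ioo 0 θ, ∫⁻ ω, expFunctional ξ ω ^ (p - 1) ∂(P i) < ∞) :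
    Ioo (-1) θ ⊆
      interior (integrableExpSet (fun ω => Real.log (expFunctional ξ ω).toReal) (P i)) := by
  refine interior_maximal (fun t ht => ?_) isOpen_Ioo
  -- Moments of orders a - 1 and b with a, b in (0, θ) enclose t, and the set of admissible orders
  -- is convex.
  obtain ⟨a, ha, hat⟩ : ∃ a ∈ Ioo 0 θ, a - 1 ≤ t := by
    refine ⟨min (θ / 2) ((t + 1) / 2), ⟨lt_min (by linarith) (by linarith [ht.1]), ?_⟩, ?_⟩
    · exact (min_le_left _ _).trans_lt (by linarith)
    · have := min_le_right (θ / 2) ((t + 1) / 2)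
      linarith [ht.1]
  obtain ⟨b, hb, hbt⟩ : ∃ b ∈ Ioo 0 θ, t ≤ b := by
    refine ⟨(max t 0 + θ) / 2, ⟨?_, ?_⟩, ?_⟩
    · linarith [le_max_right t 0]
    · linarith [max_lt ht.2 hθ]
    · linarith [le_max_left t 0, ht.2]
  exact convex_integrableExpSet.ordConnected.out (hM.mem_integrableExpSet_log hI (hfin₀ a ha))
    (hM.mem_integrableExpSet_log hI (hfin b hb)) ⟨hat, hbt⟩

end IsMAP

end Mellin

end MAP

end

/-! ### The main theorem. -/

theorem mainTheorem5 {Ω E : Type*} [Fintype E] [DecidableEq E] [MeasurableSpace E]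
    [DiscreteMeasurableSpace E] {m : MeasurableSpace Ω}
    (𝒢 : Filtration ℝ≥0 m) (P : E → Measure Ω) (ξ : ℝ≥0 → Ω → ℝ) (J : ℝ≥0 → Ω → E)
    (Q : Matrix E E ℝ) (hMAP : MAP.IsMAP 𝒢 P ξ J Q) (hirr : MAP.IsIrreducibleRate Q)
    (hnd : ¬ MAP.IsDegenerate P ξ J)
    (θ : ℝ) (hθ : θ ∈ Ioo (0 : ℝ) 1) (hcramer : MAP.CramerCondition P ξ J Q θ) :
    (∀ i, ∀ᵐ ω ∂(P i), MAP.expFunctional ξ ω < ∞) ∧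
    (∀ i, ∀ s : ℂ, s.re ∈ Ioo 0 (1 + θ) →
      Integrable (fun ω => ((MAP.expFunctional ξ ω).toReal : ℂ) ^ (s - 1)) (P i)) ∧
    (∀ i, AnalyticOnNhd ℂ (fun s => MAP.mellin P ξ s i) {s : ℂ | s.re ∈ Ioo 0 (1 + θ)}) ∧
    (∀ s ∈ Ioo 0 θ,
      IsUnit (MAP.matrixExponent P ξ J Q (-s)) ∧
      MAP.mellin P ξ ((s : ℂ) + 1) =
        (-(s : ℂ)) • (((MAP.matrixExponent P ξ J Q (-s))⁻¹.map (fun x : ℝ => (x : ℂ))) *ᵥ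
          MAP.mellin P ξ (s : ℂ))) := by
  -- An empty state space is vacuously degenerate.
  have : Nonempty E := by
    by_contra h
    rw [not_nonempty_iff] at h
    exact hnd ⟨fun _ => 0, fun i => h.elim i⟩
  obtain ⟨z₀, -, hex, hθz, hlead⟩ := hcramer
  have hzθ : MAP.MatrixExponentExists P ξ J Q (-θ) :=
    hex _ ⟨by linarith [hθz.2], by linarith [hθ.1]⟩
  have hzp : ∀ p ∈ Ioo 0 θ, MAP.MatrixExponentExists P ξ J Q (-p) := fun p hp =>
    hex _ ⟨by linarith [hθz.2, hp.2], by linarith [hp.1]⟩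
  obtain ⟨h, hpos, hh⟩ := hMAP.exists_harmonic hirr hzθ hlead
  have hfin : ∀ p ∈ Ioo 0 θ, ∀ i, ∫⁻ ω, MAP.expFunctional ξ ω ^ p ∂(P i) < ∞ := by
    intro p hp i
    obtain ⟨T, ρ, v, hT, hρ0, hρ1, hv, hdec⟩ :=
      hMAP.exists_decay hirr hnd hθ.1 hzθ hpos hh hp (hzp p hp)
    exact hMAP.lintegral_expFunctional_rpow_lt_top hθ.2.le hzθ hpos hh hp (hzp p hp) hT hρ0 hρ1 hv
      hdec i
  have hp1 : ∀ p ∈ Ioo 0 θ, p ∈ Ioo (0 : ℝ) 1 := fun p hp => ⟨hp.1, hp.2.trans hθ.2⟩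
  have hfin₀ : ∀ p ∈ Ioo 0 θ, ∀ i, ∫⁻ ω, MAP.expFunctional ξ ω ^ (p - 1) ∂(P i) < ∞ :=
    fun p hp => hMAP.lintegral_expFunctional_rpow_sub_one_lt_top (hp1 p hp) (hzp p hp) (hfin p hp)
  have hI : ∀ i, ∀ᵐ ω ∂(P i), MAP.expFunctional ξ ω < ∞ := fun i =>
    hMAP.ae_expFunctional_lt_top (half_pos hθ.1)
      (hfin _ ⟨half_pos hθ.1, half_lt_self hθ.1⟩ i)
  have hint := fun i => hMAP.Ioo_subset_interior_integrableExpSet hθ.1 (hI i)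
    (fun p hp => hfin p hp i) (fun p hp => hfin₀ p hp i)
  have hre : ∀ s : ℂ, s.re ∈ Ioo 0 (1 + θ) → (s - 1).re ∈ Ioo (-1) θ := fun s hs => by
    rw [Complex.sub_re, Complex.one_re]
    exact ⟨by linarith [hs.1], by linarith [hs.2]⟩
  refine ⟨hI, fun i s hs => ?_, fun i => ?_, fun s hs => ⟨?_, ?_⟩⟩
  · exact (integrable_cexp_mul_of_re_mem_interior_integrableExpSet (hint i (hre s hs))).congr
      ((hI i).mono fun _ hω => (hMAP.cpow_expFunctional hω (s - 1)).symm)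
  · rw [show (fun s => MAP.mellin P ξ s i) = _ from funext (hMAP.mellin_eq_complexMGF (hI i))]
    intro s hs
    exact AnalyticAt.comp (g := complexMGF _ (P i)) (f := fun s : ℂ => s - 1)
      (analyticAt_complexMGF (hint i (hre s hs))) (analyticAt_id.sub analyticAt_const)
  · obtain ⟨T, ρ, v, -, hρ0, hρ1, hv, hdec⟩ :=
      hMAP.exists_decay hirr hnd hθ.1 hzθ hpos hh hs (hzp s hs)
    exact hMAP.isUnit_of_decay hρ0 hρ1 hv hdec
  · obtain ⟨T, ρ, v, -, hρ0, hρ1, hv, hdec⟩ :=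
      hMAP.exists_decay hirr hnd hθ.1 hzθ hpos hh hs (hzp s hs)
    have hunit := (Matrix.isUnit_iff_isUnit_det _).1 (hMAP.isUnit_of_decay hρ0 hρ1 hv hdec)
    have hrec := hMAP.matrixExponent_mulVec_moment (hp1 s hs) (hzp s hs) (hfin s hs)
    -- The moment identity is solved in real vectors; both Mellin values are real at real arguments,
    -- so it then passes to complex ones.
    have hsolve := congrArg ((MAP.matrixExponent P ξ J Q (-s))⁻¹ *ᵥ ·) hrec
    simp only [Matrix.mulVec_mulVec, Matrix.nonsing_inv_mul _ hunit, Matrix.one_mulVec,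
      Matrix.mulVec_smul] at hsolve
    have e₁ : ∀ i, MAP.mellin P ξ ((s : ℂ) + 1) i =
        ((∫⁻ ω, MAP.expFunctional ξ ω ^ s ∂(P i)).toReal : ℝ) := fun i =>
      hMAP.mellin_ofReal_add_one (hfin s hs i)
    have e₀ : ∀ i, MAP.mellin P ξ (s : ℂ) i =
        ((∫⁻ ω, MAP.expFunctional ξ ω ^ (s - 1) ∂(P i)).toReal : ℝ) := fun i => by
      rw [← hMAP.mellin_ofReal_add_one (hfin₀ s hs i)]
      congr 1
      push_cast
      ring
    funext i
    rw [e₁ i, congrFun hsolve i]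
    simp only [Pi.smul_apply, smul_eq_mul, Matrix.mulVec, dotProduct, Matrix.map_apply, e₀]
    push_cast
    rfl
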